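/- **Programs and semantics.** A program $P$ has finitely many threads; each thread has an initial label, its own local registers, and a finite sequence of labelled instructions $l\colon \mathit{inst};\ \mathbf{goto}\ l'$ (several may carry the same label $l$), where $\mathit{inst}$ is a load $r\leftarrow \mathrm{mem}[e]$, a store $\mathrm{mem}[e]\leftarrow e'$, a fence $\mathtt{mfence}$, an assignment $r\leftarrow e$, or $\mathtt{assert}\ e$. Expressions are arbitrary functions of the thread's registers over a data domain $D\ni 0$, which is also the set of addresses and need not be finite; registers and memory are initially $0$. Under TSO every thread has a FIFO store buffer: a store instruction enqueues an address-value pair (an *issue* action); the oldest entry of a buffer may at any time be written to memory (a *store* action); a load reads the newest entry for its address in its own thread's buffer, or memory if there is none; a fence requires its thread's buffer to be empty. A TSO computation is the action sequence of a run from the initial state to a state with all buffers empty. Under SC, issues are immediately followed by their stores and fences have no effect. The trace of a computation is the graph whose nodes are the actions (an issue and its store form one node), labelled by the actions, with program order $\mathrm{po}$ (order of issue within each thread), store order $\mathrm{st}$ (order of the stores to each address), and source relation $\mathrm{src}$ (from a store to the loads reading its value). Its happens-before relation is $\to_{hb}=\mathrm{po}\cup \mathrm{st}\cup \mathrm{src}\cup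 \mathrm{cf}$, where $\mathrm{cf}$ relates a load to the store overwriting the (possibly initial) value that it read. $P$ is *robust* if its TSO traces and its SC traces coincide. **Attacks.** An attack $A=(t,s,\ell)$ of $P$ consists of a thread $t$ (the attacker) and a store instruction $s$ and a load instruction $\ell$ of $t$. It is *feasible* if there is a TSO computation $\tau_1\cdot \mathsf{isu}\cdot\tau_2\cdot \mathsf{ld}\cdot\tau_3\cdot \mathsf{st}\cdot\tau_4$ in which $\mathsf{isu}$, $\mathsf{st}$ are the issue and store of one instance of $s$ and $\mathsf{ld}$ is an instance of $\ell$, such that: (a) only $t$ delays stores (a store is delayed if some action of its own thread lies between its issue and it); (b) $\mathsf{st}$ is the first delayed store of $t$, and $\mathsf{ld}$ is the last action of $t$ before $\mathsf{st}$; (c) $\mathsf{ld}\to_{hb}^+ x$ for every action $x$ of $\mathsf{ld}\cdot\tau_3\cdot \mathsf{st}$; (d) $\tau_4$ consists only of stores of $t$ (issued before $\mathsf{ld}$ and delayed past it); (e) the address of $\mathsf{ld}$ differs from the addresses of $\mathsf{st}$ and of all stores in $\tau_4$. **Fences.** Inserting a fence at a label $l$ means introducing a fresh label $l_f$, replacing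 each instruction $l\colon \mathit{inst};\ \mathbf{goto}\ l'$ by $l_f\colon \mathit{inst};\ \mathbf{goto}\ l'$, and adding $l\colon \mathtt{mfence};\ \mathbf{goto}\ l_f$. A set $F$ of labels of $P$ is a *valid fence set* if inserting fences at all labels in $F$ yields a robust program, and an *irreducible valid fence set* if moreover no strict subset of $F$ is a valid fence set. A set $F_A$ of labels of $P$ is an *eliminating fence set* for an attack $A$ if $A$ (with its two instructions relabelled accordingly) is not feasible in the program obtained by inserting fences at all labels in $F_A$; it is an *irreducible eliminating fence set* for $A$ if moreover no strict subset of $F_A$ is an eliminating fence set for $A$. **Lemma.** Let $P$ be a program and let $F$ be an irreducible valid fence set of $P$. Then there is a family $(F_A)$, indexed by the feasible attacks $A$ of $P$, such that each $F_A$ is an irreducible eliminating fence set for $A$ and $$F=\bigcup_{A\text{ feasible attack of }P}F_A .$$ -/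

import Mathlib

namespace FenceTSO

/-! ### Programs -/

/-- An expression `f(r₁, …, rₖ)`: a function on the data domain applied to registers. -/
structure Expr (R D : Type*) where
  fn : List D → D
  args : List R

/-- The value of an expression under a register valuation. -/
def Expr.eval {R D : Type*} (e : Expr R D) (ρ : R → D) : D := e.fn (e.args.map ρ)

/-- Instructions: `r ← mem[e]`, `mem[e] ← e'`, `mfence`, `r ← e`, `assert e`. -/
inductive Instr (R D : Type*) where
  | load (r : R) (addr : Expr R D)
  | store (addr val : Expr R D)
  | mfence
  | assign (r : R) (e : Expr R D)
  | assertion (e : Expr R D)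

/-- A labelled instruction `src: inst; goto dst;`. -/
structure LInstr (L R D : Type*) where
  src : L
  inst : Instr R D
  dst : L

/-- A parallel program with threads `T`, labels from `L`, register names from `R` and data domain
`D` (every value is also an address).  Each thread has an initial label and a finite sequence of
labelled instructions; several instructions may carry the same label.  Registers are local to the
threads: see `TSOState.reg` and `SCState.reg`. -/
structure Program (T L R D : Type*) where
  init : T → L
  code : T → List (LInstr L R D)

variable {T L R D : Type*}

/-- The labels that occur in thread `t`. -/
def Program.threadLabels (P : Program T L R D) (t : T) : Set L :=
  {l | l = P.init t ∨ ∃ i ∈ P.code t, l = i.src ∨ l = i.dst}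

/-- The labels that occur in the program. -/
def Program.labels (P : Program T L R D) : Set L := ⋃ t, P.threadLabels t

/-! ### Actions -/

/-- Actions of a thread: issue of a store, local action (assignment, assertion, fence), load of
value `v` from address `a`, and store of value `v` to address `a` becoming visible in memory. -/
inductive Action (T D : Type*) where
  | issue (t : T)
  | loc (t : T)
  | load (t : T) (a v : D)
  | store (t : T) (a v : D)

/-- The thread of an action. -/
def Action.thread : Action T D → T
  | .issue t => t
  | .loc t => t
  | .load t _ _ => t
  | .store t _ _ => t

def Action.isIssue : Action T D → Bool
  | .issue _ => true
  | _ => false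

def Action.isStore : Action T D → Bool
  | .store _ _ _ => true
  | _ => false

/-- An occurrence of an action in a run, together with the labelled instruction whose execution
produced it (`none` when a buffered store is written to memory). -/
structure Event (T L R D : Type*) where
  act : Action T D
  inst : Option (LInstr L R D)

/-! ### TSO semantics -/

/-- TSO states: program counters, registers of each thread, memory, and store buffers
(oldest entry first). -/
structure TSOState (T L R D : Type*) where
  pc : T → L
  reg : T → R → D
  mem : D → D
  buf : T → List (D × D)

def TSOState.initial [Zero D] (P : Program T L R D) : TSOState T L R D where
  pc := P.init
  reg := fun _ _ => 0
  mem := fun _ => 0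
  buf := fun _ => []

open Classical in
/-- The TSO transition relation, labelled by events. -/
inductive TSOStep [Zero D] (P : Program T L R D) :
    TSOState T L R D → Event T L R D → TSOState T L R D → Prop
  | loadBuffer (s : TSOState T L R D) (t : T) (i : LInstr L R D) (r : R) (e : Expr R D)
      (a v : D) (β : List (D × D))
      (hi : i ∈ P.code t) (hpc : s.pc t = i.src) (hinst : i.inst = .load r e)
      (ha : a = e.eval (s.reg t))
      (hbuf : (s.buf t).filter (fun p => decide (p.1 = a)) = β ++ [(a, v)]) :
      TSOStep P s ⟨.load t a v, some i⟩
        { s with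
          pc := Function.update s.pc t i.dst
          reg := Function.update s.reg t (Function.update (s.reg t) r v) }
  | loadMemory (s : TSOState T L R D) (t : T) (i : LInstr L R D) (r : R) (e : Expr R D)
      (a v : D)
      (hi : i ∈ P.code t) (hpc : s.pc t = i.src) (hinst : i.inst = .load r e)
      (ha : a = e.eval (s.reg t))
      (hbuf : (s.buf t).filter (fun p => decide (p.1 = a)) = [])
      (hv : v = s.mem a) :
      TSOStep P s ⟨.load t a v, some i⟩
        { s with
          pc := Function.update s.pc t i.dst
          reg := Function.update s.reg t (Function.update (s.reg t) r v) }
  | issue (s : TSOState T L R D) (t : T) (i : LInstr L R D) (ea ev : Expr R D) (a v : D)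
      (hi : i ∈ P.code t) (hpc : s.pc t = i.src) (hinst : i.inst = .store ea ev)
      (ha : a = ea.eval (s.reg t)) (hv : v = ev.eval (s.reg t)) :
      TSOStep P s ⟨.issue t, some i⟩
        { s with
          pc := Function.update s.pc t i.dst
          buf := Function.update s.buf t (s.buf t ++ [(a, v)]) }
  | store (s : TSOState T L R D) (t : T) (a v : D) (β : List (D × D))
      (hbuf : s.buf t = (a, v) :: β) :
      TSOStep P s ⟨.store t a v, none⟩
        { s with
          mem := Function.update s.mem a v
          buf := Function.update s.buf t β }
  | mfence (s : TSOState T L R D) (t : T) (i : LInstr L R D)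
      (hi : i ∈ P.code t) (hpc : s.pc t = i.src) (hinst : i.inst = .mfence)
      (hbuf : s.buf t = []) :
      TSOStep P s ⟨.loc t, some i⟩
        { s with pc := Function.update s.pc t i.dst }
  | assign (s : TSOState T L R D) (t : T) (i : LInstr L R D) (r : R) (e : Expr R D)
      (hi : i ∈ P.code t) (hpc : s.pc t = i.src) (hinst : i.inst = .assign r e) :
      TSOStep P s ⟨.loc t, some i⟩
        { s with
          pc := Function.update s.pc t i.dst
          reg := Function.update s.reg t (Function.update (s.reg t) r (e.eval (s.reg t))) }
  | assertion (s : TSOState T L R D) (t : T) (i : LInstr L R D) (e : Expr R D)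
      (hi : i ∈ P.code t) (hpc : s.pc t = i.src) (hinst : i.inst = .assertion e)
      (he : e.eval (s.reg t) ≠ 0) :
      TSOStep P s ⟨.loc t, some i⟩
        { s with pc := Function.update s.pc t i.dst }

/-- Finite sequences of TSO transitions. -/
inductive TSORun [Zero D] (P : Program T L R D) :
    TSOState T L R D → List (Event T L R D) → TSOState T L R D → Prop
  | nil (s : TSOState T L R D) : TSORun P s [] s
  | cons {s s' s'' : TSOState T L R D} {e : Event T L R D} {w : List (Event T L R D)}
      (h : TSOStep P s e s') (hw : TSORun P s' w s'') : TSORun P s (e :: w) s''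

/-- `w` is the event sequence of a TSO computation: it leads from the initial state to a state
in which all buffers are empty. -/
def IsTSOExecution [Zero D] (P : Program T L R D) (w : List (Event T L R D)) : Prop :=
  ∃ s, TSORun P (TSOState.initial P) w s ∧ ∀ t, s.buf t = []

/-- The TSO computations of a program. -/
def tsoComputations [Zero D] (P : Program T L R D) : Set (List (Action T D)) :=
  {τ | ∃ w, IsTSOExecution P w ∧ τ = w.map Event.act}

/-! ### SC semantics -/

/-- SC states: program counters, registers of each thread, memory. -/
structure SCState (T L R D : Type*) where
  pc : T → L
  reg : T → R → D
  mem : D → D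

def SCState.initial [Zero D] (P : Program T L R D) : SCState T L R D where
  pc := P.init
  reg := fun _ _ => 0
  mem := fun _ => 0

open Classical in
/-- The SC transition relation.  A store instruction produces an issue directly followed by the
store; fences have no effect. -/
inductive SCStep [Zero D] (P : Program T L R D) :
    SCState T L R D → List (Action T D) → SCState T L R D → Prop
  | load (s : SCState T L R D) (t : T) (i : LInstr L R D) (r : R) (e : Expr R D) (a v : D)
      (hi : i ∈ P.code t) (hpc : s.pc t = i.src) (hinst : i.inst = .load r e)
      (ha : a = e.eval (s.reg t)) (hv : v = s.mem a) :
      SCStep P s [.load t a v]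
        { s with
          pc := Function.update s.pc t i.dst
          reg := Function.update s.reg t (Function.update (s.reg t) r v) }
  | store (s : SCState T L R D) (t : T) (i : LInstr L R D) (ea ev : Expr R D) (a v : D)
      (hi : i ∈ P.code t) (hpc : s.pc t = i.src) (hinst : i.inst = .store ea ev)
      (ha : a = ea.eval (s.reg t)) (hv : v = ev.eval (s.reg t)) :
      SCStep P s [.issue t, .store t a v]
        { s with
          pc := Function.update s.pc t i.dst
          mem := Function.update s.mem a v }
  | mfence (s : SCState T L R D) (t : T) (i : LInstr L R D)
      (hi : i ∈ P.code t) (hpc : s.pc t = i.src) (hinst : i.inst = .mfence) :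
      SCStep P s [.loc t] { s with pc := Function.update s.pc t i.dst }
  | assign (s : SCState T L R D) (t : T) (i : LInstr L R D) (r : R) (e : Expr R D)
      (hi : i ∈ P.code t) (hpc : s.pc t = i.src) (hinst : i.inst = .assign r e) :
      SCStep P s [.loc t]
        { s with
          pc := Function.update s.pc t i.dst
          reg := Function.update s.reg t (Function.update (s.reg t) r (e.eval (s.reg t))) }
  | assertion (s : SCState T L R D) (t : T) (i : LInstr L R D) (e : Expr R D)
      (hi : i ∈ P.code t) (hpc : s.pc t = i.src) (hinst : i.inst = .assertion e)
      (he : e.eval (s.reg t) ≠ 0) :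
      SCStep P s [.loc t] { s with pc := Function.update s.pc t i.dst }

/-- Finite sequences of SC transitions, labelled by the produced actions. -/
inductive SCRun [Zero D] (P : Program T L R D) :
    SCState T L R D → List (Action T D) → SCState T L R D → Prop
  | nil (s : SCState T L R D) : SCRun P s [] s
  | cons {s s' s'' : SCState T L R D} {x σ : List (Action T D)}
      (h : SCStep P s x s') (hσ : SCRun P s' σ s'') : SCRun P s (x ++ σ) s''

/-- The SC computations of a program. -/
def scComputations [Zero D] (P : Program T L R D) : Set (List (Action T D)) :=
  {σ | ∃ s, SCRun P (SCState.initial P) σ s}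

/-! ### Traces -/

/-- The node `(t, k)` is the `k`-th node (counted from `0`) of thread `t` in program order. -/
abbrev Node (T : Type*) := T × ℕ

/-- Traces: labelled graphs with program order, store order and source relation.
`seq t` lists the labels of the nodes of thread `t` in program order, and so encodes the nodes,
their labels, and the program order (see `nodes`, `label`, `po`).  As labels contain the thread and
the program order of a thread is total, each isomorphism class of traces has exactly one member
whose nodes are named in this way; hence equality below is isomorphism of traces. -/
structure Trace (T D : Type*) where
  seq : T → List (Action T D)
  st : Node T → Node T → Prop
  src : Node T → Node T → Prop

namespace Trace

def nodes (G : Trace T D) : Set (Node T) := {n | n.2 < (G.seq n.1).length}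

/-- The label of a node (`none` if it is not a node of the trace). -/
def label (G : Trace T D) (n : Node T) : Option (Action T D) := (G.seq n.1)[n.2]?

/-- Program order, as the relation of direct successors. -/
def po (G : Trace T D) (m n : Node T) : Prop :=
  m ∈ G.nodes ∧ n ∈ G.nodes ∧ m.1 = n.1 ∧ m.2 + 1 = n.2

/-- `n` is the maximal element of the store order for address `a`. -/
def IsMaxStore (G : Trace T D) (a : D) (n : Node T) : Prop :=
  (∃ t v, G.label n = some (.store t a v)) ∧ ∀ m, ¬ G.st n m

def empty : Trace T D where
  seq := fun _ => []
  st := fun _ _ => False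
  src := fun _ _ => False

/-- The node that an action yields when it is appended to a trace: for a store, the first node of
the thread that is still labelled as an issue; otherwise a fresh node at the end of the thread. -/
def nodeOf (G : Trace T D) : Action T D → Node T
  | .store t _ _ => (t, (G.seq t).findIdx Action.isIssue)
  | .issue t => (t, (G.seq t).length)
  | .loc t => (t, (G.seq t).length)
  | .load t _ _ => (t, (G.seq t).length)

open Classical in
/-- Appending an action to a trace.  When a store is executed, the source relation is updated for
the program-order later loads of the same thread that have already read its value early. -/
noncomputable def extend (G : Trace T D) : Action T D → Trace T D
  | .store t a v =>
    let n := G.nodeOf (.store t a v)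
    { seq := Function.update G.seq t ((G.seq t).set n.2 (.store t a v))
      st := fun p q => G.st p q ∨ (G.IsMaxStore a p ∧ q = n)
      src := fun p q =>
        if Relation.TransGen G.po n q ∧ G.label q = some (.load t a v) then p = n
        else G.src p q }
  | .load t a v =>
    let n := G.nodeOf (.load t a v)
    { seq := Function.update G.seq t (G.seq t ++ [.load t a v])
      st := G.st
      src := fun p q => G.src p q ∨ (G.IsMaxStore a p ∧ q = n) }
  | .issue t =>
    { seq := Function.update G.seq t (G.seq t ++ [.issue t])
      st := G.st
      src := G.src }
  | .loc t =>
    { seq := Function.update G.seq t (G.seq t ++ [.loc t])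
      st := G.st
      src := G.src }

/-- Conflict relation: a load is related to the store that overwrites the value it has read, where
this value was written by a store, or was the initial value of the address. -/
def cf (G : Trace T D) (m n : Node T) : Prop :=
  ∃ t t' a v v', G.label m = some (.load t a v) ∧ G.label n = some (.store t' a v') ∧
    ((∃ p, G.src p m ∧ G.st p n) ∨ ((∀ p, ¬ G.src p m) ∧ ∀ p, ¬ G.st p n))

/-- Happens-before relation. -/
def hb (G : Trace T D) (m n : Node T) : Prop :=
  G.po m n ∨ G.st m n ∨ G.src m n ∨ G.cf m n

end Trace

/-- The trace of a computation. -/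
noncomputable def traceOf (α : List (Action T D)) : Trace T D := α.foldl Trace.extend Trace.empty

/-- The program has the same traces under TSO and under SC. -/
def Robust [Zero D] (P : Program T L R D) : Prop :=
  traceOf '' tsoComputations P = traceOf '' scComputations P

/-! ### Attacks -/

open Classical in
/-- `τ = α · (t, issue) · β · (t, store, a, v) · γ`, where the displayed issue and store stem from
the same instruction instance (buffers are first-in-first-out, so the `k`-th issue of a thread
belongs to its `k`-th store). -/
def IsIssueStorePair (τ : List (Action T D)) (t : T) (α β : List (Action T D)) (a v : D)
    (γ : List (Action T D)) : Prop :=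
  τ = α ++ [.issue t] ++ β ++ [.store t a v] ++ γ ∧
    α.countP (fun x => decide (x.thread = t) && x.isIssue) =
      (α ++ β).countP (fun x => decide (x.thread = t) && x.isStore)

/-- The displayed store is delayed: it is separated from its issue by some action of the thread. -/
def IsDelayed (τ : List (Action T D)) (t : T) (α β : List (Action T D)) (a v : D)
    (γ : List (Action T D)) : Prop :=
  IsIssueStorePair τ t α β a v γ ∧ ∃ x ∈ β, x.thread = t

/-- An attacker thread, a store instruction and a load instruction. -/
structure Attack (T L R D : Type*) where
  attacker : T
  stinst : LInstr L R D
  ldinst : LInstr L R D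

/-- `A` is an attack of `P`: both are instructions of the attacker, a store and a load. -/
def Attack.IsAttackOf (A : Attack T L R D) (P : Program T L R D) : Prop :=
  A.stinst ∈ P.code A.attacker ∧ (∃ ea ev, A.stinst.inst = .store ea ev) ∧
  A.ldinst ∈ P.code A.attacker ∧ (∃ r e, A.ldinst.inst = .load r e)

/-- The event sequence `w₁ · issue · w₂ · load · w₃ · store · w₄` in which the attacker issues an
instance of the store instruction of `A`, loads value `u` from address `b` by an instance of the
load instruction of `A`, and writes value `v` to address `a`. -/
def Attack.events (A : Attack T L R D) (w₁ w₂ w₃ w₄ : List (Event T L R D)) (a v b u : D) :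
    List (Event T L R D) :=
  w₁ ++ [⟨.issue A.attacker, some A.stinst⟩] ++ w₂ ++ [⟨.load A.attacker b u, some A.ldinst⟩] ++
    w₃ ++ [⟨.store A.attacker a v, none⟩] ++ w₄

/-- The sequence `w₁ · issue · w₂ · load · w₃ · store · w₄` is a TSO witness for the attack `A`. -/
structure IsWitness [Zero D] (P : Program T L R D) (A : Attack T L R D)
    (w₁ w₂ w₃ w₄ : List (Event T L R D)) (a v b u : D) : Prop where
  /-- It is a TSO computation. -/
  execution : IsTSOExecution P (A.events w₁ w₂ w₃ w₄ a v b u)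
  /-- The displayed store belongs to the displayed issue, and hence is an instance of the store
  instruction of the attack. -/
  pair : IsIssueStorePair ((A.events w₁ w₂ w₃ w₄ a v b u).map Event.act) A.attacker
    (w₁.map Event.act)
    (w₂.map Event.act ++ [.load A.attacker b u] ++ w₃.map Event.act) a v (w₄.map Event.act)
  /-- Only the attacker delays stores. -/
  onlyAttacker : ∀ t α β c x γ,
    IsDelayed ((A.events w₁ w₂ w₃ w₄ a v b u).map Event.act) t α β c x γ → t = A.attacker
  /-- The displayed store is the first store of the attacker that is delayed: no store of the
  attacker that was issued earlier is delayed. -/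
  firstDelayed : ∀ α β c x γ,
    IsDelayed ((A.events w₁ w₂ w₃ w₄ a v b u).map Event.act) A.attacker α β c x γ →
      w₁.length ≤ α.length
  /-- The load is the last action of the attacker that is overstepped by the store. -/
  lastOverstepped : ∀ e ∈ w₃, e.act.thread ≠ A.attacker
  /-- The load happens before every action `x` of `load · w₃ · store` (issue and store of the same
  instruction instance are one node of the trace). -/
  happensBefore : ∀ α x γ,
    [.load A.attacker b u] ++ w₃.map Event.act ++ [.store A.attacker a v] = α ++ [x] ++ γ →
    Relation.TransGen (traceOf ((A.events w₁ w₂ w₃ w₄ a v b u).map Event.act)).hb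
      ((traceOf (w₁.map Event.act ++ [.issue A.attacker] ++ w₂.map Event.act)).nodeOf
        (.load A.attacker b u))
      ((traceOf (w₁.map Event.act ++ [.issue A.attacker] ++ w₂.map Event.act ++ α)).nodeOf x)
  /-- The final part consists of stores of the attacker only.  (They were issued before the load
  and delayed past it, as the attacker does nothing between the load and the displayed store.) -/
  suffix : ∀ e ∈ w₄, ∃ c x, e.act = .store A.attacker c x
  /-- The load accesses an address different from those of all stores delayed past it. -/
  noEarlyRead : a ≠ b ∧ ∀ e ∈ w₄, ∀ c x, e.act = .store A.attacker c x → c ≠ b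

/-- An attack of `P` is feasible if it has a TSO witness. -/
def Feasible [Zero D] (P : Program T L R D) (A : Attack T L R D) : Prop :=
  A.IsAttackOf P ∧ ∃ w₁ w₂ w₃ w₄ a v b u, IsWitness P A w₁ w₂ w₃ w₄ a v b u

/-! ### Fence insertion

In the modified program, `Sum.inl l` is the label `l`, and `Sum.inr l` is the fresh label that is
introduced for it. -/

open Classical in
/-- `l: inst; goto l';` becomes `l_f: inst; goto l';` if a fence is inserted at `l`. -/
noncomputable def LInstr.fenced (F : Finset L) (i : LInstr L R D) : LInstr (L ⊕ L) R D where
  src := if i.src ∈ F then Sum.inr i.src else Sum.inl i.src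
  inst := i.inst
  dst := Sum.inl i.dst

open Classical in
/-- Insertion of fences `l: mfence; goto l_f;` at all labels `l` in `F`. -/
noncomputable def Program.insertFences (P : Program T L R D) (F : Finset L) :
    Program T (L ⊕ L) R D where
  init := fun t => Sum.inl (P.init t)
  code := fun t => (P.code t).map (LInstr.fenced F) ++
    (F.filter (fun l => l ∈ P.threadLabels t)).toList.map
      (fun l => ⟨Sum.inl l, .mfence, Sum.inr l⟩)

/-- The same attack in the modified program. -/
noncomputable def Attack.fenced (F : Finset L) (A : Attack T L R D) : Attack T (L ⊕ L) R D where
  attacker := A.attacker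
  stinst := A.stinst.fenced F
  ldinst := A.ldinst.fenced F

/-- `F` is a valid fence set: a set of labels of `P` at which inserting fences yields a robust
program. -/
def IsValidFenceSet [Zero D] (P : Program T L R D) (F : Finset L) : Prop :=
  (F : Set L) ⊆ P.labels ∧ Robust (P.insertFences F)

/-- `F` is a valid fence set and no strict subset of it is one. -/
def IsIrreducibleValidFenceSet [Zero D] (P : Program T L R D) (F : Finset L) : Prop :=
  IsValidFenceSet P F ∧ ∀ G, G ⊂ F → ¬ IsValidFenceSet P G

/-- `F` is an eliminating fence set for the attack `A`: a set of labels of `P` such that the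
attack is not feasible after inserting fences at these labels. -/
def IsEliminatingFenceSet [Zero D] (P : Program T L R D) (A : Attack T L R D) (F : Finset L) :
    Prop :=
  (F : Set L) ⊆ P.labels ∧ ¬ Feasible (P.insertFences F) (A.fenced F)

/-- `F` is an eliminating fence set for `A` and no strict subset of it is one. -/
def IsIrreducibleEliminatingFenceSet [Zero D] (P : Program T L R D) (A : Attack T L R D)
    (F : Finset L) : Prop :=
  IsEliminatingFenceSet P A F ∧ ∀ G, G ⊂ F → ¬ IsEliminatingFenceSet P A G

end FenceTSO

open scoped Classical
set_option linter.unusedSectionVars false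

namespace FenceTSO

section

variable {T L R D : Type*}

/-! The lemma follows from two facts about attacks. First, a program is robust if and only if it has
no feasible attack (`Robust.not_feasible`, `exists_feasible_of_not_robust`). Second, an attack that
is feasible with some fences stays feasible when fences are removed (`Feasible.relabel`, hence
`Feasible.anti` and `Feasible.of_insertFences`). By the first fact `F` eliminates every attack, so
it contains an irreducible eliminating set for each feasible attack. Let `U ⊆ F` be the union of
these sets. If `U` were not valid, the program fenced at `U` would have a feasible attack. That
attack stems from an attack of `P`, which is feasible in `P`, and its chosen eliminating set is
contained in `U`; by the second fact the attack would remain feasible with only that set, a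
contradiction. So `U` is valid, and irreducibility of `F` gives `U = F`.

One half of the first fact is short: SC traces are acyclic, because under SC every new node is the
last one of its thread and has no outgoing edge, whereas a witness puts its load on a happens-before
cycle.

The other half is the bulk of the proof. Runs are instrumented so that the state itself records, for
every node, its source or its predecessor in the store order; happens-before (`HB`) can then be read
off the state. Each instruction has a cost, the number of stores of its own thread that are pending
when it executes. Adjacent steps commute unless they form one node or are related by happens-before,
and moving a store before an instruction of its thread lowers the cost (`GStep.commute`,
`GRun.undelay`). Hence a program without a cyclic run can bring every complete run to cost zero, and
runs of cost zero have SC traces; so a program that is not robust has a cyclic run.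

Among the cyclic runs one of minimal `weight` is taken. Its last step is a store `x` overtaking an
instruction `e`, and no earlier store is delayed (`MinViolation.shape`, `MinViolation.allClean`).
After rearrangement everything between `e` and `x` is reachable from `e` (`exists_closed`).
Minimality also forces `e` to be a load from memory (`Closed.read`) and all other threads to have
empty buffers (`Closed.others_empty`). Emptying the buffer of the attacker then yields a witness
(`GAttack.feasible`).

For the second fact, removed fences are nodes without source, store-order or conflict edges.
Deleting them and renumbering the remaining nodes gives a run of the other program, and paths
through deleted nodes are shortcut by the transitivity of program order (`Sim.run`,
`Sim.transGen_hb`). -/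

/-! ### Instrumented semantics

Every thread keeps a log of its nodes.  The record of a load contains the store it reads from, the
record of a store contains its predecessor in the store order, and every memory cell knows the
store that was last written to it. -/

/-- The label of a node together with the source (of a load) or the predecessor in the store order
(of a store). -/
structure NodeRec (T D : Type*) where
  act : Action T D
  pred : Option (Node T)

/-- Local state of a thread; the entries of the buffer carry the index of their node. -/
structure LocalState (T L R D : Type*) where
  pc : L
  reg : R → D
  buf : List (ℕ × D × D)
  len : ℕ
  log : ℕ → Option (NodeRec T D)

/-- Instrumented states; a memory cell contains a value and the store that wrote it. -/
structure GState (T L R D : Type*) where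
  loc : T → LocalState T L R D
  mem : D → D × Option (Node T)

/-- Access of a thread step to the memory. -/
inductive Access (T D : Type*) where
  | none
  | read (a : D) (c : D × Option (Node T))
  | write (a : D) (c c' : D × Option (Node T))

/-- The effect of an access on the memory. -/
def Access.Ok : Access T D → (D → D × Option (Node T)) → (D → D × Option (Node T)) → Prop
  | .none, m, m' => m' = m
  | .read a c, m, m' => m a = c ∧ m' = m
  | .write a c c', m, m' => m a = c ∧ m' = Function.update m a c'

/-- An event with the index of its node and the number of stores that it overtakes. -/
structure Lab (T L R D : Type*) where
  ev : Event T L R D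
  idx : ℕ
  cost : ℕ

def Lab.thread (x : Lab T L R D) : T := x.ev.act.thread

def Lab.node (x : Lab T L R D) : Node T := (x.thread, x.idx)

def Lab.isStore (x : Lab T L R D) : Bool := x.ev.act.isStore

/-- Assignments, assertions and fences. -/
def LocalInstr [Zero D] (i : Instr R D) (ρ : R → D) (β : List (ℕ × D × D)) (ρ' : R → D) : Prop :=
  (i = .mfence ∧ β = [] ∧ ρ' = ρ) ∨
  (∃ r e, i = .assign r e ∧ ρ' = Function.update ρ r (e.eval ρ)) ∨
  (∃ e, i = .assertion e ∧ e.eval ρ ≠ 0 ∧ ρ' = ρ)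

/-- Execution of an instruction by a thread: action, instruction, memory access, new registers,
new buffer entries, and predecessor of the new node. -/
inductive Exec [Zero D] (P : Program T L R D) (t : T) (ℓ : LocalState T L R D) :
    Action T D → LInstr L R D → Access T D → (R → D) → List (ℕ × D × D) → Option (Node T) → Prop
  | early (i : LInstr L R D) (r : R) (e : Expr R D) (k : ℕ) (a v : D) (β : List (ℕ × D × D))
      (hi : i ∈ P.code t) (hpc : ℓ.pc = i.src) (hinst : i.inst = .load r e)
      (ha : a = e.eval ℓ.reg)
      (hbuf : ℓ.buf.filter (fun p => decide (p.2.1 = a)) = β ++ [(k, a, v)]) :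
      Exec P t ℓ (.load t a v) i .none (Function.update ℓ.reg r v) [] (some (t, k))
  | read (i : LInstr L R D) (r : R) (e : Expr R D) (a : D) (c : D × Option (Node T))
      (hi : i ∈ P.code t) (hpc : ℓ.pc = i.src) (hinst : i.inst = .load r e)
      (ha : a = e.eval ℓ.reg)
      (hbuf : ℓ.buf.filter (fun p => decide (p.2.1 = a)) = []) :
      Exec P t ℓ (.load t a c.1) i (.read a c) (Function.update ℓ.reg r c.1) [] c.2
  | issue (i : LInstr L R D) (ea ev : Expr R D)
      (hi : i ∈ P.code t) (hpc : ℓ.pc = i.src) (hinst : i.inst = .store ea ev) :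
      Exec P t ℓ (.issue t) i .none ℓ.reg [(ℓ.len, ea.eval ℓ.reg, ev.eval ℓ.reg)] none
  | internal (i : LInstr L R D) (ρ : R → D)
      (hi : i ∈ P.code t) (hpc : ℓ.pc = i.src) (hinst : LocalInstr i.inst ℓ.reg ℓ.buf ρ) :
      Exec P t ℓ (.loc t) i .none ρ [] none

/-- The local state after the execution of an instruction. -/
noncomputable def LocalState.push (ℓ : LocalState T L R D) (l : L) (ρ : R → D)
    (β : List (ℕ × D × D)) (r : NodeRec T D) : LocalState T L R D where
  pc := l
  reg := ρ
  buf := ℓ.buf ++ β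
  len := ℓ.len + 1
  log := Function.update ℓ.log ℓ.len (some r)

/-- The local state after a store. -/
noncomputable def LocalState.pop (ℓ : LocalState T L R D) (k : ℕ) (β : List (ℕ × D × D))
    (r : NodeRec T D) : LocalState T L R D :=
  { ℓ with buf := β, log := Function.update ℓ.log k (some r) }

/-- Steps of a thread. -/
inductive TStep [Zero D] (P : Program T L R D) (t : T) (ℓ : LocalState T L R D) :
    Lab T L R D → Access T D → LocalState T L R D → Prop
  | exec {act i acc ρ β p} (h : Exec P t ℓ act i acc ρ β p) :
      TStep P t ℓ ⟨⟨act, some i⟩, ℓ.len, ℓ.buf.length⟩ acc (ℓ.push i.dst ρ β ⟨act, p⟩)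
  | flush (k : ℕ) (a v : D) (β : List (ℕ × D × D)) (c : D × Option (Node T))
      (h : ℓ.buf = (k, a, v) :: β) :
      TStep P t ℓ ⟨⟨.store t a v, none⟩, k, 0⟩ (.write a c (v, some (t, k)))
        (ℓ.pop k β ⟨.store t a v, c.2⟩)

/-- Steps of the program. -/
inductive GStep [Zero D] (P : Program T L R D) (s : GState T L R D) :
    Lab T L R D → GState T L R D → Prop
  | mk {t x acc ℓ m} (h : TStep P t (s.loc t) x acc ℓ) (hm : acc.Ok s.mem m) :
      GStep P s x ⟨Function.update s.loc t ℓ, m⟩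

def GRun [Zero D] (P : Program T L R D) :
    GState T L R D → List (Lab T L R D) → GState T L R D → Prop
  | s, [], s' => s = s'
  | s, x :: w, s' => ∃ u, GStep P s x u ∧ GRun P u w s'

def GState.initial [Zero D] (P : Program T L R D) : GState T L R D where
  loc := fun t => ⟨P.init t, fun _ => 0, [], 0, fun _ => none⟩
  mem := fun _ => (0, none)

def GState.node (s : GState T L R D) (n : Node T) : Option (NodeRec T D) := (s.loc n.1).log n.2

variable [Zero D] {P : Program T L R D}

@[simp] theorem gRun_nil {s s' : GState T L R D} : GRun P s [] s' ↔ s = s' := Iff.rfl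

@[simp] theorem gRun_cons {s s' : GState T L R D} {x w} :
    GRun P s (x :: w) s' ↔ ∃ u, GStep P s x u ∧ GRun P u w s' := Iff.rfl

theorem gRun_append {s s' : GState T L R D} {w w'} :
    GRun P s (w ++ w') s' ↔ ∃ u, GRun P s w u ∧ GRun P u w' s' := by
  induction w generalizing s with
  | nil => simp [GRun]
  | cons x w ih => simp only [List.cons_append, gRun_cons, ih]; grind

theorem gRun_snoc {s s' : GState T L R D} {w x} :
    GRun P s (w ++ [x]) s' ↔ ∃ u, GRun P s w u ∧ GStep P u x s' := by
  simp [gRun_append]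

theorem Exec.thread_eq {t ℓ act i acc ρ β p} (h : Exec P t ℓ act i acc ρ β p) :
    act.thread = t := by cases h <;> rfl

theorem Exec.not_store {t ℓ act i acc ρ β p} (h : Exec P t ℓ act i acc ρ β p) :
    act.isStore = false := by cases h <;> rfl

theorem TStep.thread_eq {t ℓ x acc ℓ'} (h : TStep P t ℓ x acc ℓ') : x.thread = t := by
  cases h with
  | exec h => exact h.thread_eq
  | flush => rfl

/-- Inversion of a step of the program. -/
theorem GStep.inv {s s' : GState T L R D} {x} (h : GStep P s x s') :
    ∃ acc ℓ m, TStep P x.thread (s.loc x.thread) x acc ℓ ∧ acc.Ok s.mem m ∧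
      s' = ⟨Function.update s.loc x.thread ℓ, m⟩ := by
  cases h with
  | mk h hm => obtain rfl := h.thread_eq; exact ⟨_, _, _, h, hm, rfl⟩

theorem GStep.loc_of_ne {s s' : GState T L R D} {x t} (h : GStep P s x s') (ht : x.thread ≠ t) :
    s'.loc t = s.loc t := by
  obtain ⟨acc, ℓ, m, -, -, rfl⟩ := h.inv
  simp [Function.update_of_ne ht.symm]

theorem GRun.loc_of_ne {s s' : GState T L R D} {w t} (h : GRun P s w s')
    (ht : ∀ x ∈ w, x.thread ≠ t) : s'.loc t = s.loc t := by
  induction w generalizing s with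
  | nil => simp_all
  | cons x w ih =>
    obtain ⟨u, hu, hw⟩ := h
    rw [ih hw (fun y hy => ht y (List.mem_cons_of_mem _ hy)), hu.loc_of_ne (ht x (by simp))]

/-! ### Correspondence with the TSO semantics -/

def GState.erase (s : GState T L R D) : TSOState T L R D where
  pc := fun t => (s.loc t).pc
  reg := fun t => (s.loc t).reg
  mem := fun a => (s.mem a).1
  buf := fun t => (s.loc t).buf.map Prod.snd

theorem erase_update (s : GState T L R D) (t : T) (ℓ : LocalState T L R D) (m) :
    (GState.mk (Function.update s.loc t ℓ) m).erase =
      { pc := Function.update s.erase.pc t ℓ.pc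
        reg := Function.update s.erase.reg t ℓ.reg
        mem := fun a => (m a).1
        buf := Function.update s.erase.buf t (ℓ.buf.map Prod.snd) } := by
  simp only [GState.erase, TSOState.mk.injEq]
  refine ⟨?_, ?_, trivial, ?_⟩ <;>
  · funext u
    by_cases hu : u = t
    · subst hu; simp
    · simp [Function.update_of_ne hu]

theorem filter_map_snd (β : List (ℕ × D × D)) (a : D) :
    (β.map Prod.snd).filter (fun p => decide (p.1 = a)) =
      (β.filter (fun p => decide (p.2.1 = a))).map Prod.snd := by
  rw [List.filter_map]; rfl

/-- The bookkeeping (indices, logs, writers) never restricts a step, so it can be forgotten. The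
converse `TSOStep.toGStep` holds because the bookkeeping of the successor state can always be filled
in. -/
theorem GStep.toTSO {s s' : GState T L R D} {x} (h : GStep P s x s') :
    TSOStep P s.erase x.ev s'.erase := by
  cases h with
  | @mk t _ _ _ _ h hm =>
  rw [erase_update]
  cases h with
  | flush k a v β c hb =>
    obtain ⟨hc, rfl⟩ := hm
    have := TSOStep.store (P := P) s.erase t a v (β.map Prod.snd) (by simp [GState.erase, hb])
    convert this using 2
    · exact Function.update_eq_self t s.erase.pc
    · exact Function.update_eq_self t s.erase.reg
    · funext b
      by_cases hb : b = a
      · subst hb; simp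
      · simp [Function.update_of_ne hb, GState.erase]
    · rfl
  | @exec _ i _ _ _ _ h =>
    cases h with
    | early _ r e k a v β hi hpc hinst ha hbuf =>
      obtain rfl := hm
      have := TSOStep.loadBuffer (P := P) s.erase t i r e a v (β.map Prod.snd) hi hpc hinst ha
        (by simp only [GState.erase]; rw [filter_map_snd, hbuf]; simp)
      convert this using 2 <;> first | rfl | simp [LocalState.push, GState.erase]
    | read _ r e a c hi hpc hinst ha hbuf =>
      obtain ⟨hc, rfl⟩ := hm
      have := TSOStep.loadMemory (P := P) s.erase t i r e a c.1 hi hpc hinst ha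
        (by simp only [GState.erase]; rw [filter_map_snd, hbuf]; simp) (by rw [← hc]; rfl)
      convert this using 2 <;> first | rfl | simp [LocalState.push, GState.erase]
    | issue _ ea ev hi hpc hinst =>
      obtain rfl := hm
      have := TSOStep.issue (P := P) s.erase t i ea ev _ _ hi hpc hinst rfl rfl
      convert this using 2 <;> first | rfl | simp [LocalState.push, GState.erase]
    | internal _ ρ hi hpc hinst =>
      obtain rfl := hm
      rcases hinst with ⟨h1, h2, rfl⟩ | ⟨r, e, h1, rfl⟩ | ⟨e, h1, h2, rfl⟩
      · convert TSOStep.mfence (P := P) s.erase t i hi hpc h1 (by simp [GState.erase, h2]) using 2 <;>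
          first | rfl | simp [LocalState.push, GState.erase]
      · convert TSOStep.assign (P := P) s.erase t i r e hi hpc h1 using 2 <;>
          first | rfl | simp [LocalState.push, GState.erase]
      · convert TSOStep.assertion (P := P) s.erase t i e hi hpc h1 h2 using 2 <;>
          first | rfl | simp [LocalState.push, GState.erase]

theorem GRun.toTSO {s s' : GState T L R D} {w} (h : GRun P s w s') :
    TSORun P s.erase (w.map Lab.ev) s'.erase := by
  induction w generalizing s with
  | nil => obtain rfl := h; exact .nil _
  | cons x w ih => obtain ⟨u, hu, hw⟩ := h; exact .cons hu.toTSO (ih hw)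

theorem TSOStep.toGStep {s : GState T L R D} {e u} (h : TSOStep P s.erase e u) :
    ∃ x s', x.ev = e ∧ GStep P s x s' ∧ s'.erase = u := by
  have key : ∀ {t : T} {x acc ℓ m}, TStep P t (s.loc t) x acc ℓ → acc.Ok s.mem m →
      ∀ u : TSOState T L R D, u = (GState.mk (Function.update s.loc t ℓ) m).erase → 
      ∃ x' s', x'.ev = x.ev ∧ GStep P s x' s' ∧ s'.erase = u :=
    fun h hm u hu => ⟨_, _, rfl, .mk h hm, hu.symm⟩
  have hb : ∀ t, s.erase.buf = Function.update s.erase.buf t (List.map Prod.snd ((s.loc t).buf)) :=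
    fun t => (Function.update_eq_self t s.erase.buf).symm
  have hr : ∀ t, s.erase.reg = Function.update s.erase.reg t (s.loc t).reg :=
    fun t => (Function.update_eq_self t s.erase.reg).symm
  have hp : ∀ t, s.erase.pc = Function.update s.erase.pc t (s.loc t).pc :=
    fun t => (Function.update_eq_self t s.erase.pc).symm
  cases h with
  | loadBuffer t i r e a v β hi hpc hinst ha hbuf =>
    simp only [GState.erase] at hbuf
    rw [filter_map_snd, List.map_eq_append_iff] at hbuf
    obtain ⟨β₁, β₂, h1, -, h2⟩ := hbuf
    obtain ⟨⟨k, a', v'⟩, rfl, h3⟩ : ∃ p, β₂ = [p] ∧ p.2 = (a, v) := by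
      rw [List.map_eq_singleton_iff] at h2; exact h2
    obtain ⟨rfl, rfl⟩ := Prod.mk.inj h3
    refine key (.exec (.early i r e k _ _ β₁ hi hpc hinst ha h1)) rfl _ ?_
    rw [erase_update]
    simp only [LocalState.push, List.append_nil]
    rw [← hb]; rfl
  | loadMemory t i r e a v hi hpc hinst ha hbuf hv =>
    simp only [GState.erase] at hbuf
    rw [filter_map_snd, List.map_eq_nil_iff] at hbuf
    subst hv
    refine key (.exec (.read i r e a (s.mem a) hi hpc hinst ha hbuf)) ⟨rfl, rfl⟩ _ ?_
    rw [erase_update]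
    simp only [LocalState.push, List.append_nil]
    rw [← hb]; rfl
  | issue t i ea ev a v hi hpc hinst ha hv =>
    refine key (.exec (.issue i ea ev hi hpc hinst)) rfl _ ?_
    rw [erase_update]
    simp only [LocalState.push]
    rw [← hr, ha, hv]; simp [GState.erase]
  | store t a v β hbuf =>
    simp only [GState.erase] at hbuf
    rw [List.map_eq_cons_iff] at hbuf
    obtain ⟨⟨k, a', v'⟩, β₁, h1, h3, rfl⟩ := hbuf
    obtain ⟨rfl, rfl⟩ := Prod.mk.inj h3
    refine key (.flush k _ _ β₁ (s.mem a') h1) ⟨rfl, rfl⟩ _ ?_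
    rw [erase_update]
    simp only [LocalState.pop]
    rw [← hr, ← hp]
    congr 1
    funext b
    by_cases hb : b = a'
    · subst hb; simp
    · simp [Function.update_of_ne hb, GState.erase]
  | mfence t i hi hpc hinst hbuf =>
    simp only [GState.erase, List.map_eq_nil_iff] at hbuf
    refine key (.exec (.internal i _ hi hpc (.inl ⟨hinst, hbuf, rfl⟩))) rfl _ ?_
    rw [erase_update]
    simp only [LocalState.push, List.append_nil]
    rw [← hb, ← hr]; rfl
  | assign t i r e hi hpc hinst =>
    refine key (.exec (.internal i _ hi hpc (.inr (.inl ⟨r, e, hinst, rfl⟩)))) rfl _ ?_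
    rw [erase_update]
    simp only [LocalState.push, List.append_nil]
    rw [← hb]; rfl
  | assertion t i e hi hpc hinst he =>
    refine key (.exec (.internal i _ hi hpc (.inr (.inr ⟨e, hinst, he, rfl⟩)))) rfl _ ?_
    rw [erase_update]
    simp only [LocalState.push, List.append_nil]
    rw [← hb, ← hr]; rfl

theorem TSORun.toGRun {u u'} {w} (h : TSORun P u w u') :
    ∀ s : GState T L R D, s.erase = u →
      ∃ w' s', w'.map Lab.ev = w ∧ GRun P s w' s' ∧ s'.erase = u' := by
  induction h with
  | nil u => rintro s rfl; exact ⟨[], s, rfl, gRun_nil.2 rfl, rfl⟩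
  | cons h _ ih =>
    rintro s rfl
    obtain ⟨x, s', hx, hs', he⟩ := h.toGStep
    obtain ⟨w', s'', rfl, hw', he'⟩ := ih s' he
    exact ⟨x :: w', s'', by simp [hx], ⟨s', hs', hw'⟩, he'⟩

end

section

variable {T L R D : Type*} [Zero D] {P : Program T L R D}

/-! ### Invariants of the instrumented semantics -/

noncomputable def GState.afterExec (s : GState T L R D) (t : T) (l : L) (ρ : R → D)
    (β : List (ℕ × D × D)) (r : NodeRec T D) : GState T L R D :=
  ⟨Function.update s.loc t ((s.loc t).push l ρ β r), s.mem⟩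

noncomputable def GState.afterFlush (s : GState T L R D) (t : T) (k : ℕ) (a v : D)
    (β : List (ℕ × D × D)) : GState T L R D :=
  ⟨Function.update s.loc t ((s.loc t).pop k β ⟨.store t a v, (s.mem a).2⟩),
    Function.update s.mem a (v, some (t, k))⟩

/-- `GStep` is phrased with abstract accesses so that threads and memory are separated; case
analyses are easier with explicit successor states. Only a flush changes the memory, and it can
overwrite whatever is there. -/
theorem GStep.view {s s' : GState T L R D} {x} (h : GStep P s x s') :
    (∃ t act i acc ρ β p, Exec P t (s.loc t) act i acc ρ β p ∧ acc.Ok s.mem s.mem ∧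
      x = ⟨⟨act, some i⟩, (s.loc t).len, (s.loc t).buf.length⟩ ∧
      s' = s.afterExec t i.dst ρ β ⟨act, p⟩) ∨
    (∃ t k a v β, (s.loc t).buf = (k, a, v) :: β ∧ x = ⟨⟨.store t a v, none⟩, k, 0⟩ ∧
      s' = s.afterFlush t k a v β) := by
  cases h with
  | @mk t _ _ _ _ h hm =>
  cases h with
  | exec h =>
    left
    refine ⟨t, _, _, _, _, _, _, h, ?_⟩
    cases h <;> simp_all [Access.Ok, GState.afterExec]
  | flush k a v β c h =>
    right
    obtain ⟨rfl, rfl⟩ := hm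
    exact ⟨t, k, a, v, β, h, rfl, rfl⟩

theorem GStep.exec {s : GState T L R D} {t act i acc ρ β p}
    (h : Exec P t (s.loc t) act i acc ρ β p) (hm : acc.Ok s.mem s.mem) :
    GStep P s ⟨⟨act, some i⟩, (s.loc t).len, (s.loc t).buf.length⟩
      (s.afterExec t i.dst ρ β ⟨act, p⟩) := .mk (.exec h) hm

theorem GStep.flush {s : GState T L R D} {t k a v β} (h : (s.loc t).buf = (k, a, v) :: β) :
    GStep P s ⟨⟨.store t a v, none⟩, k, 0⟩ (s.afterFlush t k a v β) :=
  .mk (.flush k a v β _ h) ⟨rfl, rfl⟩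

/-! ### Nodes, lengths, buffers and memory after a single step. -/

section effects

variable (s : GState T L R D) (t : T) (l : L) (ρ : R → D) (β : List (ℕ × D × D)) (r : NodeRec T D)
  (k : ℕ) (a v : D)

theorem afterExec_node (n : Node T) : (s.afterExec t l ρ β r).node n =
    if n = (t, (s.loc t).len) then some r else s.node n := by
  obtain ⟨u, j⟩ := n
  by_cases hu : u = t
  · subst hu
    simp [GState.node, GState.afterExec, LocalState.push, Function.update_apply]
  · simp [GState.node, GState.afterExec, hu]

theorem afterFlush_node (n : Node T) : (s.afterFlush t k a v β).node n =
    if n = (t, k) then some ⟨.store t a v, (s.mem a).2⟩ else s.node n := by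
  obtain ⟨u, j⟩ := n
  by_cases hu : u = t
  · subst hu
    simp [GState.node, GState.afterFlush, LocalState.pop, Function.update_apply]
  · simp [GState.node, GState.afterFlush, hu]

theorem afterExec_len (u : T) : ((s.afterExec t l ρ β r).loc u).len =
    if u = t then (s.loc t).len + 1 else (s.loc u).len := by
  by_cases hu : u = t
  · subst hu; simp [GState.afterExec, LocalState.push]
  · simp [GState.afterExec, hu]

theorem afterFlush_len (u : T) : ((s.afterFlush t k a v β).loc u).len = (s.loc u).len := by
  by_cases hu : u = t
  · subst hu; simp [GState.afterFlush, LocalState.pop]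
  · simp [GState.afterFlush, hu]

theorem afterExec_buf (u : T) : ((s.afterExec t l ρ β r).loc u).buf =
    if u = t then (s.loc t).buf ++ β else (s.loc u).buf := by
  by_cases hu : u = t
  · subst hu; simp [GState.afterExec, LocalState.push]
  · simp [GState.afterExec, hu]

theorem afterFlush_buf (u : T) : ((s.afterFlush t k a v β).loc u).buf =
    if u = t then β else (s.loc u).buf := by
  by_cases hu : u = t
  · subst hu; simp [GState.afterFlush, LocalState.pop]
  · simp [GState.afterFlush, hu]

theorem afterExec_mem : (s.afterExec t l ρ β r).mem = s.mem := rfl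

theorem afterFlush_mem (b : D) : (s.afterFlush t k a v β).mem b =
    if b = a then (v, some (t, k)) else s.mem b := by
  simp [GState.afterFlush, Function.update_apply]

end effects

/-- Invariants of reachable states. -/
structure WF (s : GState T L R D) : Prop where
  lt : ∀ n r, s.node n = some r → n.2 < (s.loc n.1).len
  defined : ∀ t k, k < (s.loc t).len → ∃ r, s.node (t, k) = some r
  thread : ∀ n r, s.node n = some r → r.act.thread = n.1
  issue : ∀ n t p, s.node n = some ⟨.issue t, p⟩ → p = none
  pending : ∀ t k, s.node (t, k) = some ⟨.issue t, none⟩ ↔ ∃ c ∈ (s.loc t).buf, c.1 = k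
  sorted : ∀ t, (s.loc t).buf.Pairwise (fun p q => p.1 < q.1)
  writer : ∀ a p, (s.mem a).2 = some p → ∃ v o, s.node p = some ⟨.store p.1 a v, o⟩
  pred_ne : ∀ n t a v o, s.node n = some ⟨.store t a v, o⟩ → o ≠ (s.mem a).2
  store_pred : ∀ n t a v p, s.node n = some ⟨.store t a v, some p⟩ →
    ∃ v' o', s.node p = some ⟨.store p.1 a v', o'⟩
  load_pred : ∀ n t a v p, s.node n = some ⟨.load t a v, some p⟩ →
    (∃ v' o', s.node p = some ⟨.store p.1 a v', o'⟩) ∨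
      (p.1 = n.1 ∧ p.2 < n.2 ∧ (p.2, a, v) ∈ (s.loc p.1).buf)
  succ : ∀ n t a v o, s.node n = some ⟨.store t a v, o⟩ → (s.mem a).2 = some n ∨
    ∃ m t' v', s.node m = some ⟨.store t' a v', some n⟩
  early : ∀ t k a v j u o, (k, a, v) ∈ (s.loc t).buf → k < j →
    s.node (t, j) = some ⟨.load t a u, o⟩ →
    ∃ k', o = some (t, k') ∧ k ≤ k' ∧ (k', a, u) ∈ (s.loc t).buf
  loc_pred : ∀ n t p, s.node n = some ⟨.loc t, p⟩ → p = none

theorem WF.initial : WF (GState.initial P) := by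
  constructor <;> simp [GState.initial, GState.node]

theorem WF.buf_lt {s : GState T L R D} (h : WF s) {t c} (hc : c ∈ (s.loc t).buf) :
    c.1 < (s.loc t).len :=
  h.lt (t, c.1) _ ((h.pending t c.1).2 ⟨c, hc, rfl⟩)

theorem WF.node_of_buf {s : GState T L R D} (h : WF s) {t c} (hc : c ∈ (s.loc t).buf) :
    s.node (t, c.1) = some ⟨.issue t, none⟩ := (h.pending t c.1).2 ⟨c, hc, rfl⟩

theorem WF.node_len {s : GState T L R D} (h : WF s) (t) : s.node (t, (s.loc t).len) = none := by
  by_contra hn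
  obtain ⟨r, hr⟩ := Option.ne_none_iff_exists'.1 hn
  exact absurd (h.lt _ _ hr) (by simp)

/-- The flushed node was a pending issue, hence neither the writer of a cell nor the predecessor of
a store. It becomes the new maximal store of its address and the successor of the old one. -/
theorem WF.afterFlush {s : GState T L R D} (h : WF s) {t k a v β}
    (hb : (s.loc t).buf = (k, a, v) :: β) : WF (s.afterFlush t k a v β) := by
  have hk := h.node_of_buf (t := t) (c := (k, a, v)) (by simp [hb])
  have hs := h.sorted t
  rw [hb, List.pairwise_cons] at hs
  obtain ⟨hs1, hs2⟩ := hs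
  obtain ⟨h1, h2, h3, h4, h5, h6, h7, h8, h9, h10, h11, h12, h13⟩ := h
  constructor
  · intro n r hr
    rw [afterFlush_node] at hr; rw [afterFlush_len]
    split_ifs at hr with hn
    · exact h1 _ _ (by rw [hn]; exact hk)
    · exact h1 _ _ hr
  · intro u j hj
    rw [afterFlush_len] at hj; rw [afterFlush_node]
    split_ifs
    · simp
    · exact h2 _ _ hj
  · intro n r hr
    rw [afterFlush_node] at hr
    split_ifs at hr with hn
    · cases hr; rw [hn]; rfl
    · exact h3 _ _ hr
  · intro n u p hr
    rw [afterFlush_node] at hr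
    split_ifs at hr with hn
    · simp at hr
    · exact h4 _ _ _ hr
  · intro u j
    rw [afterFlush_node, afterFlush_buf]
    have := h5 u j
    grind
  · intro u
    rw [afterFlush_buf]
    split_ifs
    · exact hs2
    · exact h6 u
  · intro b p hp
    rw [afterFlush_mem] at hp
    rw [afterFlush_node]
    split_ifs at hp with hba
    · cases hp; simp [hba]
    · have := h7 b p hp
      grind
  · intro n u b w o hr
    rw [afterFlush_node] at hr; rw [afterFlush_mem]
    split_ifs at hr with hn
    · cases hr
      simp only [if_true]
      intro h0
      have := h7 a _ h0
      grind
    · split_ifs with hba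
      · subst hba
        rintro rfl
        have := h9 _ _ _ _ _ hr
        grind
      · exact h8 _ _ _ _ _ hr
  · intro n u b w p hr
    rw [afterFlush_node] at hr; rw [afterFlush_node]
    split_ifs at hr with hn
    · have := h7 a p (by grind)
      grind
    · have := h9 _ _ _ _ _ hr
      grind
  · intro n u b w p hr
    rw [afterFlush_node] at hr; rw [afterFlush_node, afterFlush_buf]
    split_ifs at hr with hn
    · simp at hr
    · have := h10 _ _ _ _ _ hr
      rcases this with h0 | ⟨h0, h0', h0''⟩
      · grind
      · by_cases hpt : p.1 = t
        · rw [hpt, hb] at h0''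
          -- A load that read early from the flushed entry now has an executed store as its source;
          -- other early reads keep pointing into the buffer.
          rcases List.mem_cons.1 h0'' with h' | h'
          · left
            have : p = (t, k) := by ext <;> grind
            cases h'
            rw [if_pos this]; simp [hpt]
          · right; rw [if_pos hpt]; grind
        · right; rw [if_neg hpt]; grind
  · intro n u b w o hr
    rw [afterFlush_node] at hr; rw [afterFlush_mem]
    simp only [afterFlush_node]
    split_ifs at hr with hn
    · left; cases hr; simp [hn]
    · have := h11 _ _ _ _ _ hr
      by_cases hba : b = a
      · subst hba
        right
        rcases this with h0 | ⟨m, u', v', hm⟩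
        · exact ⟨(t, k), t, v, by simp [h0]⟩
        · exact ⟨m, u', v', by grind⟩
      · rw [if_neg hba]
        rcases this with h0 | ⟨m, u', v', hm⟩
        · exact .inl h0
        · exact .inr ⟨m, u', v', by grind⟩
  · intro u j b w i x o hj hji hr
    rw [afterFlush_node] at hr
    rw [afterFlush_buf] at hj ⊢
    split_ifs at hr with hn
    · cases hr
    by_cases hu : u = t
    · subst hu
      rw [if_pos rfl] at hj ⊢
      have := h12 u j b w i x o (by rw [hb]; exact List.mem_cons_of_mem _ hj) hji hr
      have := hs1 _ hj
      grind
    · rw [if_neg hu] at hj ⊢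
      exact h12 u j b w i x o hj hji hr
  · intro n u p hr
    rw [afterFlush_node] at hr
    split_ifs at hr with hn
    · simp at hr
    · exact h13 _ _ _ hr

theorem le_last_of_filter {β : List (ℕ × D × D)} (h : β.Pairwise (fun p q => p.1 < q.1))
    {a : D} {c c' : ℕ × D × D} {γ} (hf : β.filter (fun p => decide (p.2.1 = a)) = γ ++ [c])
    (hc : c' ∈ β) (ha : c'.2.1 = a) : c'.1 ≤ c.1 := by
  have h1 := h.filter (fun p => decide (p.2.1 = a))
  have h2 : c' ∈ γ ++ [c] := by rw [← hf]; simp [hc, ha]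
  rw [hf, List.pairwise_append] at h1
  rcases List.mem_append.1 h2 with h3 | h3
  · exact (h1.2.2 c' h3 c (by simp)).le
  · rw [List.mem_singleton.1 h3]

/-- The new node has the first unused index, so old records are untouched and only the properties of
the new record have to be checked. -/
theorem WF.afterExec {s : GState T L R D} (h : WF s) {t act i acc ρ β p}
    (he : Exec P t (s.loc t) act i acc ρ β p) (hm : acc.Ok s.mem s.mem) :
    WF (s.afterExec t i.dst ρ β ⟨act, p⟩) := by
  have hl := h.node_len t
  have hlt := fun c hc => h.buf_lt (t := t) (c := c) hc
  have hth := he.thread_eq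
  have hns := he.not_store
  have hβ : ∀ c ∈ β, c.1 = (s.loc t).len ∧ act = .issue t ∧ p = none := by
    cases he <;> simp
  have hβ1 : β.Pairwise (fun p q => p.1 < q.1) := by
    cases he <;> simp
  have hiss : act.isIssue → p = none ∧ ∃ c ∈ β, c.1 = (s.loc t).len := by
    cases he <;> simp [Action.isIssue]
  have hloc : act = .loc t → p = none := by cases he <;> simp
  have hload : ∀ a v, act = .load t a v →
      (acc = .read a (v, p) ∧ (s.loc t).buf.filter (fun p => decide (p.2.1 = a)) = []) ∨
      ∃ k γ, p = some (t, k) ∧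
        (s.loc t).buf.filter (fun p => decide (p.2.1 = a)) = γ ++ [(k, a, v)] := by
    cases he with
    | early _ r e k a v γ hi hpc hinst ha hbuf =>
      intro a' v' h'; cases h'; exact .inr ⟨k, γ, rfl, hbuf⟩
    | read _ r e a c hi hpc hinst ha hbuf =>
      intro a' v' h'; cases h'; exact .inl ⟨rfl, hbuf⟩
    | issue => simp
    | internal => simp
  have hload2 : ∀ a v q, act = .load t a v → p = some q →
      (s.mem a).2 = some q ∨ (q.1 = t ∧ (q.2, a, v) ∈ (s.loc t).buf) := by
    intro a v q ha hq
    rcases hload a v ha with ⟨rfl, h0⟩ | ⟨k, γ, h0, h1⟩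
    · left; rw [hm.1, hq]
    · right
      rw [hq] at h0; cases h0
      refine ⟨rfl, ?_⟩
      have : (k, a, v) ∈ (s.loc t).buf.filter (fun p => decide (p.2.1 = a)) := by rw [h1]; simp
      exact List.mem_of_mem_filter this
  -- A load whose address has a pending entry takes the newest one. As buffer indices increase, its
  -- index is at least that of any other pending entry for the address.
  have hearly : ∀ k a v u, act = .load t a u → (k, a, v) ∈ (s.loc t).buf →
      ∃ k', p = some (t, k') ∧ k ≤ k' ∧ (k', a, u) ∈ (s.loc t).buf := by
    intro k a v u ha hk
    rcases hload a u ha with ⟨rfl, h0⟩ | ⟨k', γ, h0, h1⟩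
    · have : (k, a, v) ∈ (s.loc t).buf.filter (fun p => decide (p.2.1 = a)) := by simp [hk]
      rw [h0] at this; simp at this
    · have : (k', a, u) ∈ (s.loc t).buf.filter (fun p => decide (p.2.1 = a)) := by rw [h1]; simp
      exact ⟨k', h0, le_last_of_filter (h.sorted t) h1 hk rfl, List.mem_of_mem_filter this⟩
  obtain ⟨h1, h2, h3, h4, h5, h6, h7, h8, h9, h10, h11, h12, h13⟩ := h
  constructor
  · intro n r hr
    rw [afterExec_node] at hr; rw [afterExec_len]
    split_ifs at hr with hn
    · simp [hn]
    · have := h1 _ _ hr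
      split_ifs with h0
      · rw [h0] at this; omega
      · exact this
  · intro u j hj
    rw [afterExec_len] at hj; rw [afterExec_node]
    have := h2 u j
    grind
  · intro n r hr
    rw [afterExec_node] at hr
    split_ifs at hr with hn
    · cases hr; rw [hn]; exact hth
    · exact h3 _ _ hr
  · intro n u q hr
    rw [afterExec_node] at hr
    split_ifs at hr with hn
    · cases hr; exact (hiss rfl).1
    · exact h4 _ _ _ hr
  · intro u j
    rw [afterExec_node, afterExec_buf]
    have h50 := h5 u j
    by_cases hu : u = t
    · subst hu
      rw [if_pos rfl]
      by_cases hj : j = (s.loc u).len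
      · subst hj
        rw [if_pos rfl]
        constructor
        · intro h0
          cases h0
          obtain ⟨-, c, hc, hc'⟩ := hiss rfl
          exact ⟨c, by simp [hc], hc'⟩
        · rintro ⟨c, hc, hc'⟩
          rcases List.mem_append.1 hc with h0 | h0
          · have := hlt c h0; omega
          · obtain ⟨-, rfl, rfl⟩ := hβ c h0; rfl
      · rw [if_neg (by simpa using hj), h50]
        constructor
        · rintro ⟨c, hc, hc'⟩; exact ⟨c, by simp [hc], hc'⟩
        · rintro ⟨c, hc, hc'⟩
          rcases List.mem_append.1 hc with h0 | h0
          · exact ⟨c, h0, hc'⟩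
          · have := (hβ c h0).1; omega
    · rw [if_neg hu, if_neg (by simp [hu])]; exact h50
  · intro u
    rw [afterExec_buf]
    split_ifs
    · rw [List.pairwise_append]
      refine ⟨h6 t, hβ1, fun c hc c' hc' => ?_⟩
      rw [(hβ c' hc').1]; exact hlt c hc
    · exact h6 u
  · intro b q hq
    rw [afterExec_mem] at hq
    have := h7 b q hq
    rw [afterExec_node]
    grind
  · intro n u b w o hr
    rw [afterExec_node] at hr
    rw [afterExec_mem]
    split_ifs at hr with hn
    · cases hr; simp [Action.isStore] at hns
    · exact h8 _ _ _ _ _ hr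
  · intro n u b w q hr
    rw [afterExec_node] at hr
    rw [afterExec_node]
    split_ifs at hr with hn
    · cases hr; simp [Action.isStore] at hns
    · have := h9 _ _ _ _ _ hr
      grind
  · intro n u b w q hr
    rw [afterExec_node] at hr
    rw [afterExec_node, afterExec_buf]
    split_ifs at hr with hn
    · cases hr
      obtain rfl : u = t := hth
      rcases hload2 b w q rfl rfl with h0 | ⟨h0, h0'⟩
      · left; have := h7 b q h0; grind
      · right; rw [if_pos h0, hn]
        exact ⟨h0, hlt _ h0', by simp [h0']⟩
    · rcases h10 _ _ _ _ _ hr with h0 | h0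
      · left; grind
      · right; grind
  · intro n u b w o hr
    rw [afterExec_node] at hr
    rw [afterExec_mem]
    simp only [afterExec_node]
    split_ifs at hr with hn
    · cases hr; simp [Action.isStore] at hns
    · rcases h11 _ _ _ _ _ hr with h0 | ⟨m, u', v', h0⟩
      · exact .inl h0
      · exact .inr ⟨m, u', v', by grind⟩
  · intro u j b w i' x o hj hji hr
    rw [afterExec_node] at hr
    rw [afterExec_buf] at hj ⊢
    by_cases hu : u = t
    · subst hu
      rw [if_pos rfl] at hj ⊢
      split_ifs at hr with hn
      · cases hr
        rcases List.mem_append.1 hj with h0 | h0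
        · obtain ⟨k', h1, h2, h3⟩ := hearly j b w x rfl h0
          exact ⟨k', h1, h2, by simp [h3]⟩
        · have := (hβ _ h0).2.1; simp at this
      · rcases List.mem_append.1 hj with h0 | h0
        · obtain ⟨k', h1, h2, h3⟩ := h12 u j b w i' x o h0 hji hr
          exact ⟨k', h1, h2, by simp [h3]⟩
        · have h0 := (hβ _ h0).1
          have := h1 _ _ hr
          simp only at this h0
          omega
    · rw [if_neg hu] at hj ⊢
      rw [if_neg (by simp [hu])] at hr
      exact h12 u j b w i' x o hj hji hr
  · intro n u q hr
    rw [afterExec_node] at hr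
    split_ifs at hr with hn
    · cases hr; apply hloc; rw [← hth]; rfl
    · exact h13 _ _ _ hr

theorem GStep.wf {s s' : GState T L R D} {x} (h : GStep P s x s') (hs : WF s) : WF s' := by
  rcases h.view with ⟨t, act, i, acc, ρ, β, p, he, hm, -, rfl⟩ | ⟨t, k, a, v, β, hb, -, rfl⟩
  · exact hs.afterExec he hm
  · exact hs.afterFlush hb

theorem GRun.wf {s s' : GState T L R D} {w} (h : GRun P s w s') (hs : WF s) : WF s' := by
  induction w generalizing s with
  | nil => obtain rfl := h; exact hs
  | cons x w ih => obtain ⟨u, hu, hw⟩ := h; exact ih hw (hu.wf hs)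

/-! ### Happens-before in instrumented states -/

/-- Happens-before: transitive program order, source relation and store order, conflicts. -/
inductive HB (s : GState T L R D) : Node T → Node T → Prop
  | po (t : T) (j k : ℕ) (h : j < k) (hk : k < (s.loc t).len) : HB s (t, j) (t, k)
  | pred (p n : Node T) (r : NodeRec T D) (h : s.node n = some r) (hp : r.pred = some p) : HB s p n
  | cf (m n : Node T) (t t' : T) (a v v' : D) (o : Option (Node T))
      (hm : s.node m = some ⟨.load t a v, o⟩) (hn : s.node n = some ⟨.store t' a v', o⟩) : HB s m n

/-- A step changes only the record of its own node, which was undefined or a pending issue. -/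
theorem GStep.node_update {s s' : GState T L R D} {x} (h : GStep P s x s') (hs : WF s) :
    (∀ n, n ≠ x.node → s'.node n = s.node n) ∧
    (s.node x.node = none ∨ s.node x.node = some ⟨.issue x.thread, none⟩) ∧
    (∀ t, (s.loc t).len ≤ (s'.loc t).len) ∧
    (∀ t, (s'.loc t).len ≤ (s.loc t).len ∨
      (s'.loc t).len = (s.loc t).len + 1 ∧ x.node = (t, (s.loc t).len)) := by
  rcases h.view with ⟨t, act, i, acc, ρ, β, p, he, hm, rfl, rfl⟩ | ⟨t, k, a, v, β, hb, rfl, rfl⟩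
  · have ht := he.thread_eq
    simp only [Lab.node, Lab.thread, ht]
    refine ⟨fun n hn => by rw [afterExec_node, if_neg hn], .inl (hs.node_len t), fun u => ?_,
      fun u => ?_⟩
    · rw [afterExec_len]; grind
    · rw [afterExec_len]; grind
  · simp only [Lab.node, Lab.thread, Action.thread]
    refine ⟨fun n hn => by rw [afterFlush_node, if_neg hn],
      .inr (hs.node_of_buf (c := (k, a, v)) (by simp [hb])), fun u => ?_, fun u => ?_⟩
    · rw [afterFlush_len]
    · rw [afterFlush_len]; simp

/-- The only record that a step overwrites is that of a pending issue, which has no predecessor and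
is neither a load nor a store. So no record witnessing an edge is lost. -/
theorem HB.step {s s' : GState T L R D} {x} (h : GStep P s x s') (hs : WF s) {m n : Node T}
    (hmn : HB s m n) : HB s' m n := by
  obtain ⟨h1, h2, h3, -⟩ := h.node_update hs
  cases hmn with
  | po t j k hj hk => exact .po t j k hj (hk.trans_le (h3 t))
  | pred _ _ r hr hp =>
    refine .pred _ _ r ?_ hp
    rw [h1 n (by rintro rfl; rcases h2 with h2 | h2 <;> rw [h2] at hr <;> cases hr; cases hp)]
    exact hr
  | cf _ _ t t' a v v' o hm hn =>
    refine .cf _ _ t t' a v v' o ?_ ?_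
    · rw [h1 m (by rintro rfl; rcases h2 with h2 | h2 <;> rw [h2] at hm <;> cases hm)]
      exact hm
    · rw [h1 n (by rintro rfl; rcases h2 with h2 | h2 <;> rw [h2] at hn <;> cases hn)]
      exact hn

theorem HB.run {s s' : GState T L R D} {w} (h : GRun P s w s') (hs : WF s) {m n : Node T}
    (hmn : HB s m n) : HB s' m n := by
  induction w generalizing s with
  | nil => obtain rfl := h; exact hmn
  | cons x w ih => obtain ⟨u, hu, hw⟩ := h; exact ih hw (hu.wf hs) (hmn.step hu hs)

/-- Edges between other nodes were present before a step. -/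
theorem HB.of_step {s s' : GState T L R D} {x} (h : GStep P s x s') (hs : WF s) {m n : Node T}
    (hmn : HB s' m n) (hm : m ≠ x.node) (hn : n ≠ x.node) : HB s m n := by
  obtain ⟨h1, -, -, h4⟩ := h.node_update hs
  cases hmn with
  | po t j k hj hk =>
    refine .po t j k hj ?_
    rcases h4 t with h0 | ⟨h0, h0'⟩
    · omega
    · rw [h0'] at hn
      have : k ≠ (s.loc t).len := fun h => hn (by rw [h])
      omega
  | pred _ _ r hr hp => exact .pred _ _ r (by rw [← h1 n hn]; exact hr) hp
  | cf _ _ t t' a v v' o hm' hn' =>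
    exact .cf _ _ t t' a v v' o (by rw [← h1 m hm]; exact hm') (by rw [← h1 n hn]; exact hn')

/-- A pending issue that is the last node of its thread has no outgoing edges. -/
theorem WF.no_out_of_issue {s : GState T L R D} (hs : WF s) {t k} (hl : k + 1 = (s.loc t).len)
    (hk : s.node (t, k) = some ⟨.issue t, none⟩) (n : Node T) : ¬ HB s (t, k) n := by
  intro h
  cases h with
  | po _ _ j h hj => omega
  | pred _ _ r hr hp =>
    obtain ⟨act, p⟩ := r
    obtain rfl : p = some (t, k) := hp
    cases act with
    | issue => have := hs.issue _ _ _ hr; cases this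
    | loc => have := hs.loc_pred _ _ _ hr; cases this
    | load t' a v =>
      rcases hs.load_pred _ _ _ _ _ hr with ⟨v', o', h0⟩ | ⟨h0, h1, -⟩
      · rw [hk] at h0; cases h0
      · have := hs.lt _ _ hr
        simp only at h0 h1; rw [← h0] at this; omega
    | store t' a v =>
      obtain ⟨v', o', h0⟩ := hs.store_pred _ _ _ _ _ hr
      rw [hk] at h0; cases h0
  | cf _ _ t' t'' a v v' o hm hn => rw [hk] at hm; cases hm

/-- If the node of a step is the last one of its thread, then it has no outgoing edges. -/
theorem GStep.no_out {s s' : GState T L R D} {x} (h : GStep P s x s') (hs : WF s)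
    (hl : x.idx + 1 = (s'.loc x.thread).len) (n : Node T) : ¬ HB s' x.node n := by
  have hs' := h.wf hs
  intro hmn
  generalize hx : x.node = m at hmn
  have hm1 : m.1 = x.thread := by rw [← hx]; rfl
  have hm2 : m.2 = x.idx := by rw [← hx]; rfl
  cases hmn with
  | po t j k hj hk => simp only at hm1 hm2; subst hm1; omega
  | pred _ _ r hr hp =>
    obtain ⟨act, p⟩ := r
    obtain rfl : p = some m := hp
    cases act with
    | issue => have := hs'.issue _ _ _ hr; cases this
    | loc => have := hs'.loc_pred _ _ _ hr; cases this
    | load t' a v =>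
      have hnm : n ≠ m := by
        rintro rfl
        rcases hs'.load_pred _ _ _ _ _ hr with ⟨v', o', h0⟩ | ⟨-, h0, -⟩
        · rw [hr] at h0; cases h0
        · omega
      rw [(h.node_update hs).1 n (by rw [hx]; exact hnm)] at hr
      rcases hs.load_pred _ _ _ _ _ hr with ⟨v', o', h0⟩ | ⟨h0, h1, -⟩
      · have h2 := (h.node_update hs).2.1
        rw [hx, h0] at h2; simp at h2
      · have := (hs.lt _ _ hr).trans_le ((h.node_update hs).2.2.1 n.1)
        rw [← h0, hm1, ← hl] at this; omega
    | store t' a v =>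
      have hnm : n ≠ m := by
        rintro rfl
        have := hs'.store_pred _ _ _ _ _ hr
        rcases h.view with ⟨t, act, i, acc, ρ, β, p, he, hm, rfl, rfl⟩ |
          ⟨t, k, a, v, β, hb, rfl, rfl⟩
        · have ht := he.thread_eq
          simp only [Lab.node, Lab.thread, ht] at hx
          rw [afterExec_node, if_pos hx.symm] at hr
          cases hr
          have := he.not_store
          simp [Action.isStore] at this
        · simp only [Lab.node, Lab.thread, Action.thread] at hx
          rw [afterFlush_node, if_pos hx.symm] at hr
          have h1 := hs.writer a n (by grind)
          have h2 := hs.node_of_buf (t := t) (c := (k, a, v)) (by simp [hb])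
          grind
      rw [(h.node_update hs).1 n (by rw [hx]; exact hnm)] at hr
      obtain ⟨v', o', h0⟩ := hs.store_pred _ _ _ _ _ hr
      have h2 := (h.node_update hs).2.1
      rw [hx, h0] at h2; simp at h2
  | cf _ _ t t' a v v' o hm hn =>
    rcases h.view with ⟨t, act, i, acc, ρ, β, p, he, hmem, rfl, rfl⟩ |
      ⟨t, k, a, v, β, hb, rfl, rfl⟩
    · have ht := he.thread_eq
      simp only [Lab.node, Lab.thread, ht] at hx
      rw [afterExec_node, if_pos hx.symm] at hm
      cases hm
      -- A conflict edge out of a load just executed needs a store with the same predecessor. After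
      -- an early read that predecessor is still a pending issue; after a read from memory it is the
      -- current last writer, which nothing has overwritten.
      rcases he with ⟨_, r, e, k, a, v, γ, hi, hpc, hinst, ha, hbuf⟩ |
        ⟨_, r, e, a, c, hi, hpc, hinst, ha, hbuf⟩
      · have h1 : (k, a, v) ∈ (s.loc t).buf.filter (fun p => decide (p.2.1 = a)) := by
          rw [hbuf]; simp
        have h2 := hs.node_of_buf (List.mem_of_mem_filter h1)
        obtain ⟨v', o', h3⟩ := hs'.store_pred _ _ _ _ _ hn
        have h4 := hs.buf_lt (List.mem_of_mem_filter h1)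
        rw [afterExec_node, if_neg (by simp at h4 ⊢; omega), h2] at h3
        cases h3
      · have := hs'.pred_ne _ _ _ _ _ hn
        rw [afterExec_mem, hmem.1] at this
        exact this rfl
    · simp only [Lab.node, Lab.thread, Action.thread] at hx
      rw [afterFlush_node, if_pos hx.symm] at hm
      cases hm

end

section

variable {T L R D : Type*} [Zero D] {P : Program T L R D}

/-! ### Commutation of adjacent steps -/

theorem GStep.congr_right {s s' s'' : GState T L R D} {x} (h : GStep P s x s') (e : s' = s'') :
    GStep P s x s'' := e ▸ h


/-- The same event with a cost that is not larger. -/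
def Lab.Le (x y : Lab T L R D) : Prop := x.ev = y.ev ∧ x.idx = y.idx ∧ x.cost ≤ y.cost

theorem Lab.Le.refl (x : Lab T L R D) : x.Le x := ⟨rfl, rfl, le_rfl⟩

theorem Lab.Le.trans {x y z : Lab T L R D} (h : x.Le y) (h' : y.Le z) : x.Le z :=
  ⟨h.1.trans h'.1, h.2.1.trans h'.2.1, h.2.2.trans h'.2.2⟩

theorem Lab.Le.thread {x y : Lab T L R D} (h : x.Le y) : x.thread = y.thread := by
  simp [Lab.thread, h.1]

theorem Lab.Le.node {x y : Lab T L R D} (h : x.Le y) : x.node = y.node := by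
  simp [Lab.node, h.thread, h.2.1]

theorem Lab.Le.isStore {x y : Lab T L R D} (h : x.Le y) : x.isStore = y.isStore := by
  simp [Lab.isStore, h.1]

/-- A store commutes with a later instruction of its thread. -/
theorem Exec.pop {t ℓ act i acc ρ β p} (h : Exec P t ℓ act i acc ρ β p) {k a v γ}
    (hb : ℓ.buf = (k, a, v) :: γ) (r : NodeRec T D) (m : D → D × Option (Node T))
    (hm : acc.Ok m m) :
    ∃ acc', Exec P t (ℓ.pop k γ r) act i acc' ρ β p ∧
      acc'.Ok (Function.update m a (v, some (t, k))) (Function.update m a (v, some (t, k))) := by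
  cases h with
  | early _ r e k' a' v' δ hi hpc hinst ha hbuf =>
    rw [hb] at hbuf
    by_cases haa : a = a'
    · rw [List.filter_cons_of_pos (by simp [haa])] at hbuf
      cases δ with
      | nil =>
        simp only [List.nil_append, List.cons.injEq, Prod.mk.injEq] at hbuf
        obtain ⟨⟨rfl, -, rfl⟩, h2⟩ := hbuf
        -- The load had read the flushed entry itself. It now finds value and writer in memory, so
        -- its action and its predecessor are unchanged.
        exact ⟨_, .read i r e a' (v, some (t, k)) hi hpc hinst ha h2,
          by simp [Access.Ok, haa]⟩
      | cons c δ =>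
        simp only [List.cons_append, List.cons.injEq] at hbuf
        exact ⟨_, .early i r e k' a' v' δ hi hpc hinst ha hbuf.2, rfl⟩
    · rw [List.filter_cons_of_neg (by simp [haa])] at hbuf
      exact ⟨_, .early i r e k' a' v' δ hi hpc hinst ha hbuf, rfl⟩
  | read _ r e a' c hi hpc hinst ha hbuf =>
    rw [hb] at hbuf
    by_cases haa : a = a'
    · rw [List.filter_cons_of_pos (by simp [haa])] at hbuf
      cases hbuf
    · rw [List.filter_cons_of_neg (by simp [haa])] at hbuf
      refine ⟨_, .read i r e a' c hi hpc hinst ha hbuf, ?_, rfl⟩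
      rw [Function.update_of_ne (Ne.symm haa)]; exact hm.1
  | issue _ ea ev hi hpc hinst => exact ⟨_, .issue i ea ev hi hpc hinst, rfl⟩
  | internal _ ρ hi hpc hinst =>
    refine ⟨_, .internal i ρ hi hpc ?_, rfl⟩
    -- A fence cannot have been executed, as the buffer is nonempty.
    rcases hinst with ⟨-, h, -⟩ | h | h
    · rw [hb] at h; cases h
    · exact .inr (.inl h)
    · exact .inr (.inr h)

theorem Access.ok_self_of_update {acc : Access T D} {m : D → D × Option (Node T)} {a : D} {c}
    (hm : acc.Ok m m) (ha : ∀ c, acc ≠ .read a c) (hw : ∀ b c c', acc ≠ .write b c c') :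
    acc.Ok (Function.update m a c) (Function.update m a c) := by
  cases acc with
  | none => rfl
  | read b c' =>
    refine ⟨?_, rfl⟩
    rw [Function.update_of_ne (by rintro rfl; exact ha _ rfl)]; exact hm.1
  | write b c c' => exact absurd rfl (hw b c c')

theorem Access.ok_self_update {acc : Access T D} {m : D → D × Option (Node T)} {a : D} {c}
    (hm : acc.Ok (Function.update m a c) (Function.update m a c)) (ha : ∀ c, acc ≠ .read a c)
    (hw : ∀ b c c', acc ≠ .write b c c') : acc.Ok m m := by
  cases acc with
  | none => rfl
  | read b c' =>
    refine ⟨?_, rfl⟩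
    have := hm.1
    rwa [Function.update_of_ne (by rintro rfl; exact ha _ rfl)] at this
  | write b c c' => exact absurd rfl (hw b c c')

theorem Exec.not_write {t ℓ act i acc ρ β p} (h : Exec P t ℓ act i acc ρ β p) (b c c') :
    acc ≠ .write b c c' := by cases h <;> simp

theorem Exec.of_read {t ℓ act i ρ β p a c} (h : Exec P t ℓ act i (.read a c) ρ β p) :
    act = .load t a c.1 ∧ p = c.2 := by cases h; exact ⟨rfl, rfl⟩

theorem Exec.buf_eq {t ℓ act i acc ρ β p} (h : Exec P t ℓ act i acc ρ β p) :
    β = [] ∨ ∃ a v, β = [(ℓ.len, a, v)] := by cases h <;> simp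

/-- Two adjacent steps commute, or they belong to the same node, or the first happens before the
second. -/
theorem GStep.commute {s s₁ s₂ : GState T L R D} {x y} (hs : WF s) (hx : GStep P s x s₁)
    (hy : GStep P s₁ y s₂) :
    (∃ s' x', GStep P s y s' ∧ GStep P s' x' s₂ ∧ x'.Le x ∧
      (x.thread = y.thread → x'.cost < x.cost)) ∨ x.node = y.node ∨ HB s₂ x.node y.node := by
  rcases hx.view with ⟨t, act, i, acc, ρ, β, p, he, hm, rfl, rfl⟩ | ⟨t, k, a, v, β, hb, rfl, rfl⟩ <;>
  rcases hy.view with ⟨t', act', i', acc', ρ', β', p', he', hm', rfl, rfl⟩ |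
    ⟨t', k', a', v', β', hb', rfl, rfl⟩ <;> by_cases ht : t' = t
  · subst ht
    right; right
    simp only [Lab.node, Lab.thread, he.thread_eq, he'.thread_eq]
    exact .po _ _ _ (by rw [afterExec_len]; simp) (by simp [afterExec_len])
  · left
    have hl : (s.afterExec t i.dst ρ β ⟨act, p⟩).loc t' = s.loc t' := by
      simp [GState.afterExec, ht]
    rw [hl] at he' ⊢
    have hstep := GStep.exec (P := P) (s := s.afterExec t' i'.dst ρ' β' ⟨act', p'⟩) (t := t)
        (by convert he using 1; simp [GState.afterExec, Ne.symm ht]) hm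
    refine ⟨_, _, .exec he' hm', hstep.congr_right ?_, ?_, ?_⟩
    · simp [GState.afterExec, ht, Ne.symm ht, Function.update_comm ht]
    · simp [Lab.Le, GState.afterExec, Ne.symm ht]
    · simp [Lab.thread, he.thread_eq, he'.thread_eq, Ne.symm ht]
  -- Instruction, then store of the same thread. If the buffer was empty before, the store belongs
  -- to the instruction itself. Otherwise it is the store of an older entry; the instruction can
  -- follow it and then sees a buffer shorter by one, which is the strict drop in cost.
  · subst ht
    rw [afterExec_buf, if_pos rfl] at hb'
    cases hbs : (s.loc t').buf with
    | nil =>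
      right; left
      rw [hbs] at hb'
      rcases he.buf_eq with rfl | ⟨b, w, rfl⟩
      · cases hb'
      · cases hb'; simp only [Lab.node, Lab.thread, he.thread_eq]; rfl
    | cons c γ =>
      left
      rw [hbs] at hb'
      obtain ⟨rfl, rfl⟩ := List.cons.inj hb'
      obtain ⟨acc', h1, h2⟩ := he.pop hbs ⟨.store t' a' v', (s.mem a').2⟩ s.mem hm
      have hstep := GStep.exec (P := P) (s := s.afterFlush t' k' a' v' γ) (t := t')
          (by convert h1 using 1; simp [GState.afterFlush]) (by exact h2)
      refine ⟨_, _, .flush hbs, hstep.congr_right ?_, ?_, ?_⟩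
      · have hk : k' ≠ (s.loc t').len :=
          (hs.buf_lt (t := t') (c := (k', a', v')) (by simp [hbs])).ne
        simp [GState.afterFlush, GState.afterExec, LocalState.push, LocalState.pop,
          Function.update_comm hk]
      · simp [Lab.Le, GState.afterFlush, LocalState.pop]
      · simp [GState.afterFlush, LocalState.pop]
  · have hl : (s.afterExec t i.dst ρ β ⟨act, p⟩).loc t' = s.loc t' := by
      simp [GState.afterExec, ht]
    rw [hl] at hb'
    -- A read followed by a store overwriting what was read is a conflict edge: both records name
    -- the old writer as predecessor. Any other access is independent of the store.
    by_cases hr : ∃ c, acc = .read a' c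
    · obtain ⟨c, rfl⟩ := hr
      obtain ⟨rfl, rfl⟩ := he.of_read
      right; right
      simp only [Lab.node, Lab.thread, Action.thread]
      refine .cf _ _ t t' a' c.1 v' c.2 ?_ ?_
      · rw [afterFlush_node, if_neg (by simp [Ne.symm ht]), afterExec_node, if_pos rfl]
      · rw [afterFlush_node, if_pos rfl, afterExec_mem, hm.1]
    · push Not at hr
      left
      have hstep := GStep.exec (P := P) (s := s.afterFlush t' k' a' v' β') (t := t)
          (by convert he using 1; simp [GState.afterFlush, Ne.symm ht])
          (Access.ok_self_of_update hm hr he.not_write)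
      refine ⟨_, _, .flush hb', hstep.congr_right ?_, ?_, ?_⟩
      · simp [GState.afterExec, GState.afterFlush, ht, Ne.symm ht, Function.update_comm ht]
      · simp [Lab.Le, GState.afterFlush, Ne.symm ht]
      · exact fun h => absurd (he.thread_eq.symm.trans h) (Ne.symm ht)
  · subst ht
    right; right
    have hk := hs.buf_lt (t := t') (c := (k, a, v)) (by simp [hb])
    simp only [Lab.node, Lab.thread, he'.thread_eq]
    refine .po t' k _ ?_ ?_
    · rw [afterFlush_len]; exact hk
    · rw [afterExec_len]; simp
  · have hl : (s.afterFlush t k a v β).loc t' = s.loc t' := by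
      simp [GState.afterFlush, ht]
    rw [hl] at he' ⊢
    by_cases hr : ∃ c, acc' = .read a c
    · obtain ⟨c, rfl⟩ := hr
      obtain ⟨rfl, rfl⟩ := he'.of_read
      have hc := hm'.1
      rw [afterFlush_mem, if_pos rfl] at hc
      subst hc
      right; right
      simp only [Lab.node, Lab.thread, Action.thread]
      refine .pred _ _ _ (by rw [afterExec_node, if_pos (by rw [hl])]) rfl
    · push Not at hr
      left
      have hstep := GStep.flush (P := P) (s := s.afterExec t' i'.dst ρ' β' ⟨act', p'⟩) (t := t)
          (k := k) (a := a) (v := v) (β := β)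
          (by rw [afterExec_buf, if_neg (Ne.symm ht), hb])
      refine ⟨_, _, .exec he' (Access.ok_self_update hm' hr he'.not_write), hstep.congr_right ?_, ?_, ?_⟩
      · simp [GState.afterExec, GState.afterFlush, ht, Ne.symm ht, Function.update_comm ht]
      · exact Lab.Le.refl _
      · exact fun h => absurd (Eq.trans h he'.thread_eq) (Ne.symm ht)
  · subst ht
    rw [afterFlush_buf, if_pos rfl] at hb'
    subst hb'
    have h1 := hs.sorted t'
    have h2 := hs.buf_lt (t := t') (c := (k', a', v')) (by simp [hb])
    rw [hb, List.pairwise_cons] at h1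
    right; right
    simp only [Lab.node, Lab.thread, Action.thread]
    exact .po _ _ _ (h1.1 (k', a', v') (by simp))
      (by rw [afterFlush_len, afterFlush_len]; exact h2)
  · have hl : (s.afterFlush t k a v β).loc t' = s.loc t' := by
      simp [GState.afterFlush, ht]
    rw [hl] at hb'
    -- Stores to the same address are related by store order, stores to different addresses commute.
    by_cases ha : a' = a
    · subst ha
      right; right
      simp only [Lab.node, Lab.thread, Action.thread]
      refine .pred _ _ _ (by rw [afterFlush_node, if_pos rfl]) ?_
      simp [afterFlush_mem]
    · left
      have hstep := GStep.flush (P := P) (s := s.afterFlush t' k' a' v' β') (t := t)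
          (k := k) (a := a) (v := v) (β := β)
          (by rw [afterFlush_buf, if_neg (Ne.symm ht), hb])
      refine ⟨_, _, .flush hb', hstep.congr_right ?_, ?_, ?_⟩
      · simp [GState.afterFlush, ht, Ne.symm ht, Function.update_comm ht, ha, Ne.symm ha,
          Function.update_comm ha]
      · exact Lab.Le.refl _
      · simp [Lab.thread, Action.thread, Ne.symm ht]

/-! ### Moving steps to the left -/

def totalCost (w : List (Lab T L R D)) : ℕ := (w.map Lab.cost).sum

@[simp] theorem totalCost_nil : totalCost ([] : List (Lab T L R D)) = 0 := rfl

@[simp] theorem totalCost_cons (x : Lab T L R D) (w) : totalCost (x :: w) = x.cost + totalCost w := by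
  simp [totalCost]

@[simp] theorem totalCost_append (w w' : List (Lab T L R D)) :
    totalCost (w ++ w') = totalCost w + totalCost w' := by simp [totalCost]

/-- `b` is reachable from `a` by happens-before edges between nodes of `N`. -/
def Reach (s : GState T L R D) (N : Set (Node T)) : Node T → Node T → Prop :=
  Relation.ReflTransGen (fun a b => HB s a b ∧ a ∈ N ∧ b ∈ N)

theorem Reach.run {s s' : GState T L R D} {w} (h : GRun P s w s') (hs : WF s) {N N' : Set (Node T)}
    (hN : N ⊆ N') {a b} (hab : Reach s N a b) : Reach s' N' a b :=
  Relation.ReflTransGen.mono (fun _ _ h' => ⟨h'.1.run h hs, hN h'.2.1, hN h'.2.2⟩) _ _ hab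

def nodesOf (w : List (Lab T L R D)) : Set (Node T) := {n | ∃ x ∈ w, x.node = n}

/-- A step is moved before a sequence of steps, or some step of the sequence reaches it. -/
theorem GRun.move_left {s s₁ s₂ : GState T L R D} {Q y} (hs : WF s) (hQ : GRun P s Q s₁)
    (hy : GStep P s₁ y s₂) :
    (∃ s' Q', GStep P s y s' ∧ GRun P s' Q' s₂ ∧ List.Forall₂ Lab.Le Q' Q ∧
      ((∃ z ∈ Q, z.thread = y.thread) → totalCost Q' < totalCost Q)) ∨
    ∃ z ∈ Q, z.node = y.node ∨ HB s₂ z.node y.node := by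
  induction Q generalizing s with
  | nil =>
    obtain rfl := hQ
    exact .inl ⟨s₂, [], hy, rfl, .nil, by simp⟩
  | cons x Q ih =>
    obtain ⟨u, hx, hQ⟩ := hQ
    rcases ih (hx.wf hs) hQ with ⟨s', Q', hy', hQ', hle, hlt⟩ | ⟨z, hz, h⟩
    · rcases hx.commute hs hy' with ⟨s'', x', h1, h2, h3, h4⟩ | h
      · refine .inl ⟨s'', x' :: Q', h1, ⟨s', h2, hQ'⟩, .cons h3 hle, ?_⟩
        have h5 : totalCost Q' ≤ totalCost Q := by
          clear hlt ih hQ hQ'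
          induction hle with
          | nil => simp
          | cons h _ ih => simp only [totalCost_cons]; have := h.2.2; omega
        rintro ⟨z, hz, hzy⟩
        simp only [totalCost_cons]
        have := h3.2.2
        rcases List.mem_cons.1 hz with rfl | hz
        · have := h4 hzy; omega
        · have := hlt ⟨z, hz, hzy⟩; omega
      · right
        refine ⟨x, by simp, h.imp_right fun h => h.run hQ' (hy'.wf (hx.wf hs))⟩
    · exact .inr ⟨z, by simp [hz], h⟩

theorem totalCost_le_of_forall₂ {Q' Q : List (Lab T L R D)} (h : List.Forall₂ Lab.Le Q' Q) :
    totalCost Q' ≤ totalCost Q := by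
  induction h with
  | nil => simp
  | cons h _ ih => simp only [totalCost_cons]; have := h.2.2; omega

theorem exists_le_of_forall₂ {Q' Q : List (Lab T L R D)} (h : List.Forall₂ Lab.Le Q' Q) {x}
    (hx : x ∈ Q') : ∃ y ∈ Q, x.Le y := by
  induction h with
  | nil => simp at hx
  | cons h _ ih =>
    rcases List.mem_cons.1 hx with rfl | hx
    · exact ⟨_, by simp, h⟩
    · obtain ⟨y, hy, h'⟩ := ih hx; exact ⟨y, by simp [hy], h'⟩

theorem nodesOf_of_forall₂ {Q' Q : List (Lab T L R D)} (h : List.Forall₂ Lab.Le Q' Q) :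
    nodesOf Q' = nodesOf Q := by
  induction h with
  | nil => rfl
  | cons h _ ih =>
    ext n
    have := Set.ext_iff.1 ih n
    simp only [nodesOf, Set.mem_ofPred_eq, List.mem_cons, exists_eq_or_imp] at this ⊢
    rw [this, h.node]

theorem nodesOf_mono {Q' Q : List (Lab T L R D)} (h : Q' ⊆ Q) : nodesOf Q' ⊆ nodesOf Q := by
  rintro n ⟨z, hz, rfl⟩
  exact ⟨z, h hz, rfl⟩

/-- Every sequence of steps can be rearranged so that all steps after its first step `x` are
reachable from `x`. -/
theorem GRun.rearrange {s s₂ : GState T L R D} {x β} (hs : WF s) (h : GRun P s (x :: β) s₂) :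
    ∃ U x' B, GRun P s (U ++ x' :: B) s₂ ∧ x'.Le x ∧
      (∀ y ∈ U, ∃ z ∈ β, y.Le z) ∧ (∀ y ∈ B, ∃ z ∈ β, y.Le z) ∧
      totalCost (U ++ x' :: B) ≤ totalCost (x :: β) ∧
      (U ++ x' :: B).length = (x :: β).length ∧
      ∀ y ∈ B, Reach s₂ (nodesOf (x' :: B)) x'.node y.node := by
  induction β using List.reverseRecOn generalizing s₂ with
  | nil => exact ⟨[], x, [], h, Lab.Le.refl x, by simp, by simp, le_rfl, rfl, by simp⟩
  | append_singleton β y ih =>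
    rw [← List.cons_append, gRun_snoc] at h
    obtain ⟨s₁, h1, hy⟩ := h
    obtain ⟨U, x', B, hr, hx, hU, hB, hc, hl, hreach⟩ := ih h1
    have hs1 := h1.wf hs
    rw [gRun_append] at hr
    obtain ⟨u, hr1, hr2⟩ := hr
    have hmono : ∀ N, nodesOf (x' :: B) ⊆ N → ∀ z ∈ B, Reach s₂ N x'.node z.node :=
      fun N hN z hz =>
      (hreach z hz).run (gRun_cons.2 ⟨s₂, hy, rfl⟩ : GRun P s₁ [y] s₂) hs1 hN
    -- Either `y` moves before `x'` and joins `U`, or a step of `x' :: B` equals its node or happens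
    -- before it; then `y` is reachable from `x'` and joins `B`.
    rcases hr2.move_left (hr1.wf hs) hy with ⟨u', Q', h3, h4, h5, -⟩ | ⟨z, hz, hzy⟩
    · rcases List.forall₂_cons_right_iff.1 h5 with ⟨x'', B', h6, h7, rfl⟩
      refine ⟨U ++ [y], x'', B', ?_, h6.trans hx, ?_, ?_, ?_, ?_, ?_⟩
      · rw [List.append_assoc, gRun_append]
        exact ⟨u, hr1, u', h3, h4⟩
      · intro b hb
        rcases List.mem_append.1 hb with hb | hb
        · obtain ⟨z, hz, hb⟩ := hU b hb
          exact ⟨z, by simp [hz], hb⟩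
        · exact ⟨y, by simp, by rw [List.mem_singleton.1 hb]; exact Lab.Le.refl y⟩
      · intro b hb
        obtain ⟨c, hc, hbc⟩ := exists_le_of_forall₂ h7 hb
        obtain ⟨z, hz, hcz⟩ := hB c hc
        exact ⟨z, by simp [hz], hbc.trans hcz⟩
      · have := totalCost_le_of_forall₂ h5
        simp at hc this ⊢; omega
      · have := h5.length_eq
        simp at hl this ⊢; omega
      · intro b hb
        obtain ⟨c, hc, hbc⟩ := exists_le_of_forall₂ h7 hb
        rw [hbc.node, h6.node, nodesOf_of_forall₂ h5]
        exact hmono _ subset_rfl c hc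
    · have hsub : nodesOf (x' :: B) ⊆ nodesOf (x' :: (B ++ [y])) :=
        nodesOf_mono (by rw [← List.cons_append]; exact List.subset_append_left _ _)
      refine ⟨U, x', B ++ [y], ?_, hx, ?_, ?_, ?_, ?_, ?_⟩
      · rw [← List.cons_append, ← List.append_assoc, gRun_snoc]
        exact ⟨s₁, gRun_append.2 ⟨u, hr1, hr2⟩, hy⟩
      · intro b hb
        obtain ⟨z, hz, hb⟩ := hU b hb
        exact ⟨z, by simp [hz], hb⟩
      · intro b hb
        rcases List.mem_append.1 hb with hb | hb
        · obtain ⟨z, hz, hb⟩ := hB b hb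
          exact ⟨z, by simp [hz], hb⟩
        · exact ⟨y, by simp, by rw [List.mem_singleton.1 hb]; exact Lab.Le.refl y⟩
      · simp at hc ⊢; omega
      · simp at hl ⊢; omega
      · intro b hb
        rcases List.mem_append.1 hb with hb | hb
        · exact hmono _ hsub b hb
        · rw [List.mem_singleton.1 hb]
          have hxz : Reach s₂ (nodesOf (x' :: (B ++ [y]))) x'.node z.node := by
            rcases List.mem_cons.1 hz with rfl | hz
            · exact .refl
            · exact hmono _ hsub z hz
          rcases hzy with hzy | hzy
          · rw [← hzy]; exact hxz
          · exact hxz.tail ⟨hzy, hsub ⟨z, hz, rfl⟩, ⟨y, by simp, rfl⟩⟩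

/-- A store `x` that is executed after an instruction `z` of its thread that it overtakes can be
moved before it, or it can be reached from it. -/
theorem GRun.undelay {s s₂ : GState T L R D} {z β x} (hs : WF s)
    (h : GRun P s (z :: (β ++ [x])) s₂) (hzx : z.thread = x.thread) :
    (∃ w, GRun P s w s₂ ∧ w.length = (z :: (β ++ [x])).length ∧
      totalCost w < totalCost (z :: (β ++ [x]))) ∨
    ∃ U z' B, GRun P s (U ++ z' :: (B ++ [x])) s₂ ∧ z'.Le z ∧
      (∀ y ∈ U, ∃ c ∈ β, y.Le c) ∧ (∀ y ∈ B, ∃ c ∈ β, y.Le c) ∧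
      totalCost (U ++ z' :: (B ++ [x])) ≤ totalCost (z :: (β ++ [x])) ∧
      (U ++ z' :: (B ++ [x])).length = (z :: (β ++ [x])).length ∧
      ∀ y ∈ B ++ [x], Reach s₂ (nodesOf (z' :: (B ++ [x]))) z'.node y.node := by
  rw [← List.cons_append, gRun_snoc] at h
  obtain ⟨s₁, h1, hx⟩ := h
  obtain ⟨U, z', B, hr, hz, hU, hB, hc, hl, hreach⟩ := h1.rearrange hs
  rw [gRun_append] at hr
  obtain ⟨u, hr1, hr2⟩ := hr
  have hs1 := h1.wf hs
  have hsub : nodesOf (z' :: B) ⊆ nodesOf (z' :: (B ++ [x])) :=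
    nodesOf_mono (by rw [← List.cons_append]; exact List.subset_append_left _ _)
  have hmono : ∀ y ∈ B, Reach s₂ (nodesOf (z' :: (B ++ [x]))) z'.node y.node := fun y hy =>
    (hreach y hy).run (gRun_cons.2 ⟨s₂, hx, rfl⟩ : GRun P s₁ [x] s₂) hs1 hsub
  rcases hr2.move_left (hr1.wf hs) hx with ⟨u', Q', h3, h4, h5, h6⟩ | ⟨y, hy, hyx⟩
  · left
    -- If `x` moves to the left of `z'`, it passes an instruction of its own thread, so the total
    -- cost drops strictly while the final state stays the same.
    have h7 := h6 ⟨z', by simp, by rw [hz.thread, hzx]⟩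
    have h8 := h5.length_eq
    refine ⟨U ++ x :: Q', gRun_append.2 ⟨u, hr1, u', h3, h4⟩, ?_, ?_⟩
    · simp at hl h8 ⊢; omega
    · simp at hc h7 ⊢; omega
  · right
    refine ⟨U, z', B, ?_, hz, hU, hB, ?_, ?_, ?_⟩
    · rw [← List.cons_append, ← List.append_assoc, gRun_snoc]
      exact ⟨s₁, gRun_append.2 ⟨u, hr1, hr2⟩, hx⟩
    · simp at hc ⊢; omega
    · simp at hl ⊢; omega
    · intro b hb
      rcases List.mem_append.1 hb with hb | hb
      · exact hmono b hb
      · rw [List.mem_singleton.1 hb]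
        have hzy : Reach s₂ (nodesOf (z' :: (B ++ [x]))) z'.node y.node := by
          rcases List.mem_cons.1 hy with rfl | hy
          · exact .refl
          · exact hmono y hy
        rcases hyx with hyx | hyx
        · rw [← hyx]; exact hzy
        · exact hzy.tail ⟨hyx, hsub ⟨y, hy, rfl⟩, ⟨x, by simp, rfl⟩⟩

end

section

variable {T L R D : Type*} [Zero D] {P : Program T L R D}

/-! ### Deleting a step -/

theorem GStep.of_nonstore {s s' : GState T L R D} {x} (h : GStep P s x s')
    (hx : x.isStore = false) : x.idx = (s.loc x.thread).len ∧
      x.cost = (s.loc x.thread).buf.length ∧ (s'.loc x.thread).len = (s.loc x.thread).len + 1 ∧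
      s'.mem = s.mem ∧
      (∀ k, k ≠ x.idx → (s'.loc x.thread).log k = (s.loc x.thread).log k) ∧
      ∃ β, (s'.loc x.thread).buf = (s.loc x.thread).buf ++ β ∧
        (β = [] ∨ ∃ a v, β = [((s.loc x.thread).len, a, v)] ∧ x.ev.act = .issue x.thread ∧
          s'.node x.node = some ⟨.issue x.thread, none⟩) := by
  rcases h.view with ⟨t, act, i, acc, ρ, β, p, he, hm, rfl, rfl⟩ | ⟨t, k, a, v, β, hb, rfl, rfl⟩
  · simp only [Lab.thread, he.thread_eq]
    refine ⟨trivial, trivial, by simp [afterExec_len], rfl, fun k hk => ?_, β,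
      by simp [afterExec_buf], ?_⟩
    · simp [GState.afterExec, LocalState.push, Function.update_of_ne hk]
    · cases he with
      | issue =>
        refine .inr ⟨_, _, rfl, rfl, ?_⟩
        exact (afterExec_node ..).trans (if_pos rfl)
      | _ => exact .inl rfl
  · simp [Lab.isStore, Action.isStore] at hx

theorem GStep.of_store {s s' : GState T L R D} {x} (h : GStep P s x s')
    (hx : x.isStore = true) : ∃ a v β, x = ⟨⟨.store x.thread a v, none⟩, x.idx, 0⟩ ∧
      (s.loc x.thread).buf = (x.idx, a, v) :: β ∧
      s' = s.afterFlush x.thread x.idx a v β := by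
  rcases h.view with ⟨t, act, i, acc, ρ, β, p, he, hm, rfl, rfl⟩ | ⟨t, k, a, v, β, hb, rfl, rfl⟩
  · simp [Lab.isStore, he.not_store] at hx
  · exact ⟨a, v, β, rfl, hb, rfl⟩

/-- `s'` is `s` without the last node of thread `t`. -/
structure Deleted (t : T) (s' s : GState T L R D) : Prop where
  loc : ∀ u, u ≠ t → s'.loc u = s.loc u
  mem : s'.mem = s.mem
  len : (s.loc t).len = (s'.loc t).len + 1
  log : ∀ k, k ≠ (s'.loc t).len → (s.loc t).log k = (s'.loc t).log k
  buf : ∃ β, (s.loc t).buf = (s'.loc t).buf ++ β ∧ ∀ c ∈ β, c.1 = (s'.loc t).len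

theorem GStep.deleted {s s' : GState T L R D} {x} (h : GStep P s x s') (hx : x.isStore = false) :
    Deleted x.thread s s' := by
  obtain ⟨h1, h2, h3, h4, h5, β, h6, h7⟩ := h.of_nonstore hx
  refine ⟨fun u hu => (h.loc_of_ne hu.symm).symm, h4.symm, h3, fun k hk => h5 k (by rwa [h1]), β,
    h6, ?_⟩
  rcases h7 with rfl | ⟨a, v, rfl, -⟩ <;> simp

/-- The deleted instruction left behind only a last log entry, new registers and program counter,
and possibly a last buffer entry. Steps of other threads and flushes of older entries depend on none
of these; the condition on `z.idx` rules out the flush of the deleted issue. -/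
theorem Deleted.step {t : T} {s' s u : GState T L R D} (hd : Deleted t s' s) {z}
    (h : GStep P s z u) (hz : z.thread = t → z.isStore = true ∧ z.idx ≠ (s'.loc t).len) :
    ∃ u', GStep P s' z u' ∧ Deleted t u' u ∧ (u'.loc t).len = (s'.loc t).len := by
  obtain ⟨h1, h2, h3, h4, γ, h5, h6⟩ := hd
  by_cases hzt : z.thread = t
  · subst hzt
    obtain ⟨hz1, hz2⟩ := hz rfl
    obtain ⟨a, v, β, hx, hb, rfl⟩ := h.of_store hz1
    generalize z.thread = t at *
    rw [hb] at h5
    cases hb' : (s'.loc t).buf with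
    | nil =>
      rw [hb', List.nil_append] at h5
      exact absurd (h6 (z.idx, a, v) (by rw [← h5]; simp)) hz2
    | cons c δ =>
      rw [hb'] at h5
      obtain ⟨rfl, rfl⟩ := List.cons.inj h5
      refine ⟨s'.afterFlush t z.idx a v δ, by rw [hx]; exact .flush hb',
        ⟨fun u hu => ?_, ?_, ?_, ?_, γ, ?_, ?_⟩, ?_⟩
      · simp [GState.afterFlush, hu, h1 u hu]
      · simp [GState.afterFlush, h2]
      · rw [afterFlush_len, afterFlush_len, h3]
      · intro k hk
        rw [afterFlush_len] at hk
        simp only [GState.afterFlush, LocalState.pop, Function.update_self, h2]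
        by_cases hk' : k = z.idx
        · rw [hk']; simp
        · simp [hk', h4 k hk]
      · simp [afterFlush_buf]
      · rw [afterFlush_len]; exact h6
      · rw [afterFlush_len]
  · rcases h.view with ⟨t', act, i, acc, ρ, β, p, he, hm, rfl, rfl⟩ |
      ⟨t', k, a, v, β, hb, rfl, rfl⟩
    · have ht : t' ≠ t := fun e => hzt (he.thread_eq.trans e)
      have hm' : acc.Ok s'.mem s'.mem := by rw [h2]; exact hm
      have he' : Exec P t' (s'.loc t') act i acc ρ β p := by rw [h1 _ ht]; exact he
      have hl := h1 _ ht
      refine ⟨s'.afterExec t' i.dst ρ β ⟨act, p⟩, by rw [← hl]; exact .exec he' hm',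
        ⟨fun u hu => ?_, ?_, ?_, ?_, γ, ?_, ?_⟩, ?_⟩
      · simp only [GState.afterExec, hl]
        by_cases hu' : u = t'
        · subst hu'; simp
        · simp [hu', h1 u hu]
      · exact h2
      · simp [afterExec_len, Ne.symm ht, h3]
      · intro k hk
        simp only [afterExec_len, if_neg (Ne.symm ht)] at hk
        simp [GState.afterExec, Ne.symm ht, h4 k hk]
      · simp [afterExec_buf, Ne.symm ht, h5]
      · simpa [afterExec_len, Ne.symm ht] using h6
      · simp [afterExec_len, Ne.symm ht]
    · have ht : t' ≠ t := hzt
      have hl := h1 _ ht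
      refine ⟨_, .flush (by rw [hl]; exact hb), ⟨fun u hu => ?_, ?_, ?_, ?_, γ, ?_, ?_⟩, ?_⟩
      · simp only [GState.afterFlush, hl, h2]
        by_cases hu' : u = t'
        · subst hu'; simp
        · simp [hu', h1 u hu]
      · simp [GState.afterFlush, h2]
      · simp [afterFlush_len, h3]
      · intro k hk
        simp only [afterFlush_len] at hk
        simp [GState.afterFlush, Ne.symm ht, h4 k hk]
      · simp [afterFlush_buf, Ne.symm ht, h5]
      · simpa [afterFlush_len] using h6
      · simp [afterFlush_len]

theorem Deleted.hb {t : T} {s' s : GState T L R D} (hd : Deleted t s' s) {m n : Node T}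
    (h : HB s m n) (hm : m ≠ (t, (s'.loc t).len)) (hn : n ≠ (t, (s'.loc t).len)) : HB s' m n := by
  have hnode : ∀ n, n ≠ (t, (s'.loc t).len) → s.node n = s'.node n := by
    rintro ⟨u, k⟩ hk
    by_cases hu : u = t
    · subst hu
      exact hd.log k (by simpa using hk)
    · simp [GState.node, hd.loc u hu]
  cases h with
  | po u j k hj hk =>
    refine .po u j k hj ?_
    by_cases hu : u = t
    · subst hu
      rw [hd.len] at hk
      have : k ≠ (s'.loc u).len := by simpa using hn
      omega
    · rw [hd.loc u hu]; exact hk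
  | pred _ _ r hr hp => exact .pred _ _ r (by rw [← hnode n hn]; exact hr) hp
  | cf _ _ t t' a v v' o hm' hn' =>
    exact .cf _ _ t t' a v v' o (by rw [← hnode m hm]; exact hm') (by rw [← hnode n hn]; exact hn')

/-- A step can be deleted if later its thread executes only stores that were issued before. -/
theorem GRun.delete {s s₂ : GState T L R D} {y β} (h : GRun P s (y :: β) s₂)
    (hy : y.isStore = false)
    (hβ : ∀ z ∈ β, z.thread = y.thread → z.isStore = true ∧ z.idx ≠ y.idx) :
    ∃ s', GRun P s β s' ∧
      ∀ m n, HB s₂ m n → m ≠ y.node → n ≠ y.node → HB s' m n := by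
  obtain ⟨s₁, h1, h2⟩ := h
  have hd := h1.deleted hy
  have hi := (h1.of_nonstore hy).1
  have key : ∀ (β : List (Lab T L R D)) (s s₁ : GState T L R D), Deleted y.thread s s₁ →
      y.idx = (s.loc y.thread).len → GRun P s₁ β s₂ →
      (∀ z ∈ β, z.thread = y.thread → z.isStore = true ∧ z.idx ≠ y.idx) →
      ∃ s', GRun P s β s' ∧ Deleted y.thread s' s₂ ∧ y.idx = (s'.loc y.thread).len := by
    intro β
    induction β with
    | nil => rintro s s₁ hd hi rfl -; exact ⟨s, rfl, hd, hi⟩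
    | cons z β ih =>
      rintro s s₁ hd hi ⟨u, hu, hr⟩ hβ
      obtain ⟨u', hu', hd', hl⟩ := hd.step hu (fun h => hi ▸ hβ z (by simp) h)
      obtain ⟨s', h3, h4, h5⟩ := ih u' u hd' (hi.trans hl.symm) hr
        (fun c hc => hβ c (by simp [hc]))
      exact ⟨s', ⟨u', hu', h3⟩, h4, h5⟩
  obtain ⟨s', h3, h4, h5⟩ := key β s s₁ hd hi h2 hβ
  have hn : y.node = (y.thread, (s'.loc y.thread).len) := by rw [← h5]; rfl
  exact ⟨s', h3, fun m n h hm hn' => h4.hb h (hn ▸ hm) (hn ▸ hn')⟩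

/-! ### Minimal violations -/

/-- The happens-before relation has a cycle. -/
def Cyclic (s : GState T L R D) : Prop := ∃ n, Relation.TransGen (HB s) n n

theorem Cyclic.run {s s' : GState T L R D} {w} (h : GRun P s w s') (hs : WF s) (hc : Cyclic s) :
    Cyclic s' := by
  obtain ⟨n, hn⟩ := hc
  exact ⟨n, Relation.TransGen.mono (fun _ _ h' => h'.run h hs) _ _ hn⟩

/-- Every vertex of a cycle has an outgoing edge, so a vertex without one is not on the cycle. -/
theorem transGen_avoid {α : Type*} {r : α → α → Prop} {n m : α} (hn : Relation.TransGen r n n)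
    (hm : ∀ b, ¬ r m b) : Relation.TransGen (fun a b => r a b ∧ a ≠ m ∧ b ≠ m) n n := by
  have key : ∀ a b, Relation.TransGen r a b → (∃ c, r b c) →
      Relation.TransGen (fun a b => r a b ∧ a ≠ m ∧ b ≠ m) a b := by
    intro a b h
    induction h with
    | single h =>
      rintro ⟨c, hc⟩
      exact .single ⟨h, by rintro rfl; exact hm _ h, by rintro rfl; exact hm _ hc⟩
    | tail _ h ih =>
      rintro ⟨c, hc⟩
      exact .tail (ih ⟨_, h⟩) ⟨h, by rintro rfl; exact hm _ h, by rintro rfl; exact hm _ hc⟩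
  refine key n n hn ?_
  obtain ⟨c, hc, -⟩ := Relation.TransGen.head'_iff.1 hn
  exact ⟨c, hc⟩

/-- A cycle that avoids a node without outgoing edges. -/
theorem Cyclic.of_no_out {s s' : GState T L R D} {m} (hc : Cyclic s) (hm : ∀ b, ¬ HB s m b)
    (h : ∀ a b, HB s a b → a ≠ m → b ≠ m → HB s' a b) : Cyclic s' := by
  obtain ⟨n, hn⟩ := hc
  exact ⟨n, Relation.TransGen.mono (fun a b h' => h a b h'.1 h'.2.1 h'.2.2) _ _
    (transGen_avoid hn hm)⟩

/-- This is the reason for recording the node set in `Reach`: a cycle confined to `N` survives the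
deletion of a step whose node lies outside `N`. -/
theorem Reach.cyclic {s s' : GState T L R D} {N a b m} (h : Reach s N a b) (hba : HB s b a)
    (ha : a ∈ N) (hb : b ∈ N) (hm : m ∉ N)
    (hs : ∀ a b, HB s a b → a ≠ m → b ≠ m → HB s' a b) : Cyclic s' := by
  have h1 : ∀ {c}, c ∈ N → c ≠ m := fun hc e => hm (e ▸ hc)
  refine ⟨a, Relation.TransGen.tail' (b := b) ?_ (hs _ _ hba (h1 hb) (h1 ha))⟩
  exact Relation.ReflTransGen.mono (fun c d h' => hs c d h'.1 (h1 h'.2.1) (h1 h'.2.2)) _ _ h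

/-! ### Clean stores and stores that overtake an instruction. -/

/-- The store `x`, executed after `ρ`, was issued by the last step of its thread in `ρ`, and did not
overtake anything. -/
def Clean (ρ : List (Lab T L R D)) (x : Lab T L R D) : Prop :=
  ∃ ρ₁ y ρ₂, ρ = ρ₁ ++ y :: ρ₂ ∧ y.isStore = false ∧ y.cost = 0 ∧ y.node = x.node ∧
    ∀ z ∈ ρ₂, z.thread ≠ x.thread

def AllClean (w : List (Lab T L R D)) : Prop :=
  ∀ ρ x ρ', w = ρ ++ x :: ρ' → x.isStore = true → Clean ρ x

/-- In the second case `x` is the first store that is not clean. -/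
theorem allClean_or (w : List (Lab T L R D)) : AllClean w ∨
    ∃ ρ x ρ', w = ρ ++ x :: ρ' ∧ x.isStore = true ∧ AllClean ρ ∧ ¬ Clean ρ x := by
  induction w using List.reverseRecOn with
  | nil => left; intro ρ x ρ' h; simp at h
  | append_singleton w y ih =>
    rcases ih with ih | ⟨ρ, x, ρ', rfl, h1, h2, h3⟩
    · by_cases hy : y.isStore = true ∧ ¬ Clean w y
      · exact .inr ⟨w, y, [], rfl, hy.1, ih, hy.2⟩
      · left
        intro ρ x ρ' h hx
        rcases List.eq_nil_or_concat' ρ' with rfl | ⟨δ, z, rfl⟩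
        · have := List.append_inj' h rfl
          obtain ⟨rfl, h2⟩ := this
          cases h2
          by_contra hc
          exact hy ⟨hx, hc⟩
        · rw [← List.cons_append, ← List.append_assoc] at h
          obtain ⟨rfl, -⟩ := List.append_inj' h rfl
          exact ih _ _ _ rfl hx
    · exact .inr ⟨ρ, x, ρ' ++ [y], by simp, h1, h2, h3⟩

theorem exists_last {α : Type*} (p : α → Prop) (w : List α) : (∀ z ∈ w, ¬ p z) ∨
    ∃ w₁ y w₂, w = w₁ ++ y :: w₂ ∧ p y ∧ ∀ z ∈ w₂, ¬ p z := by
  induction w with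
  | nil => left; simp
  | cons x w ih =>
    rcases ih with ih | ⟨w₁, y, w₂, rfl, h1, h2⟩
    · by_cases hx : p x
      · exact .inr ⟨[], x, w, rfl, hx, ih⟩
      · left; simpa [hx] using ih
    · exact .inr ⟨x :: w₁, y, w₂, rfl, h1, h2⟩

/-- After a clean store the buffer is empty. -/
theorem Clean.buf_nil {s u s' : GState T L R D} {ρ x} (hc : Clean ρ x) (h : GRun P s ρ u)
    (hx : GStep P u x s') (hst : x.isStore = true) : (s'.loc x.thread).buf = [] := by
  obtain ⟨ρ₁, y, ρ₂, rfl, h1, h2, h3, h4⟩ := hc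
  obtain ⟨s₁, -, s₂, hy, hr⟩ := gRun_append.1 h
  have ht : y.thread = x.thread := congrArg Prod.fst h3
  obtain ⟨-, h5, -, -, -, β, h6, h7⟩ := hy.of_nonstore h1
  rw [ht] at h5 h6
  obtain ⟨a, v, γ, -, h8, rfl⟩ := hx.of_store hst
  rw [hr.loc_of_ne h4, h6, List.eq_nil_of_length_eq_zero (h5.symm.trans h2)] at h8
  rw [afterFlush_buf, if_pos rfl]
  rcases h7 with rfl | ⟨b, w, rfl, -⟩
  · simp at h8
  · simp at h8; tauto

/-- If all stores are clean, then the last step of a thread with nonempty buffer is not a store. -/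
theorem AllClean.last_nonstore {s : GState T L R D} {ρ₁ y ρ₂}
    (h : GRun P (GState.initial P) (ρ₁ ++ y :: ρ₂) s)
    (hc : AllClean (ρ₁ ++ y :: ρ₂)) (hb : (s.loc y.thread).buf ≠ [])
    (hy : ∀ z ∈ ρ₂, z.thread ≠ y.thread) : y.isStore = false := by
  by_contra hst
  rw [Bool.not_eq_false] at hst
  obtain ⟨s₁, h1, s₂, h2, h3⟩ := gRun_append.1 h
  apply hb
  rw [h3.loc_of_ne hy]
  exact (hc _ _ _ rfl hst).buf_nil h1 h2 hst

/-- If all earlier stores are clean, then a store is clean, or it overtakes the last step of its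
thread. -/
theorem AllClean.clean_or {s s' : GState T L R D} {ρ x} (hc : AllClean ρ)
    (h : GRun P (GState.initial P) ρ s) (hx : GStep P s x s') (hst : x.isStore = true) :
    Clean ρ x ∨ ∃ ρ₁ y ρ₂, ρ = ρ₁ ++ y :: ρ₂ ∧ y.isStore = false ∧ 0 < y.cost ∧
      y.thread = x.thread ∧ ∀ z ∈ ρ₂, z.thread ≠ x.thread := by
  obtain ⟨a, v, γ, -, hb, -⟩ := hx.of_store hst
  rcases exists_last (fun z => z.thread = x.thread) ρ with h0 | ⟨ρ₁, y, ρ₂, rfl, h1, h2⟩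
  · rw [h.loc_of_ne h0] at hb
    simp [GState.initial] at hb
  · have hy : y.isStore = false :=
      hc.last_nonstore h (by rw [h1, hb]; simp) (by rwa [h1])
    rcases Nat.eq_zero_or_pos y.cost with h3 | h3
    · left
      refine ⟨ρ₁, y, ρ₂, rfl, hy, h3, ?_, h2⟩
      obtain ⟨s₁, -, s₂, hys, hr⟩ := gRun_append.1 h
      obtain ⟨h4, h5, -, -, -, β, h6, h7⟩ := hys.of_nonstore hy
      rw [h1] at h4 h5 h6 h7
      rw [hr.loc_of_ne h2, h6, List.eq_nil_of_length_eq_zero (h5.symm.trans h3)] at hb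
      rcases h7 with rfl | ⟨b, w, rfl, -⟩
      · simp at hb
      · simp at hb
        simp [Lab.node, h1, h4, hb.1.1]
    · exact .inr ⟨ρ₁, y, ρ₂, rfl, hy, h3, h1, h2⟩

/-- A store that overtakes `y` was pending when `y` was executed. -/
theorem GRun.overtaken {u s : GState T L R D} (hu : WF u) {y β x}
    (h : GRun P u (y :: (β ++ [x])) s) (hy : y.isStore = false) (hc : 0 < y.cost)
    (hyx : y.thread = x.thread) (hβ : ∀ z ∈ β, z.thread ≠ x.thread) (hx : x.isStore = true) :
    x.idx < y.idx ∧ HB s x.node y.node ∧ ∃ a v γ δ,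
      x = ⟨⟨.store x.thread a v, none⟩, x.idx, 0⟩ ∧
      (u.loc x.thread).buf = (x.idx, a, v) :: γ ∧ (s.loc x.thread).buf = γ ++ δ ∧
      (δ = [] ∨ y.ev.act = .issue x.thread) := by
  obtain ⟨u₁, h1, h2⟩ := h
  obtain ⟨u₂, h3, h4⟩ := gRun_snoc.1 h2
  obtain ⟨h5, h6, h7, -, -, δ, h8, h9⟩ := h1.of_nonstore hy
  rw [hyx] at h5 h6 h7 h8 h9
  obtain ⟨a, v, γ, h10, h11, rfl⟩ := h4.of_store hx
  have h12 := h11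
  rw [h3.loc_of_ne hβ, h8] at h11
  cases hb : (u.loc x.thread).buf with
  | nil => rw [hb] at h6; simp at h6; omega
  | cons c γ' =>
    rw [hb] at h11
    obtain ⟨rfl, rfl⟩ := List.cons.inj h11
    have h13 : x.idx < y.idx := by
      rw [h5]; exact hu.buf_lt (c := (x.idx, a, v)) (by rw [hb]; simp)
    refine ⟨h13, ?_, a, v, γ', δ, h10, rfl, by simp [afterFlush_buf], ?_⟩
    · have : y.node = (x.thread, y.idx) := by simp [Lab.node, hyx]
      rw [this]
      refine .po _ _ _ h13 ?_
      rw [afterFlush_len, h3.loc_of_ne hβ, h7, h5]; omega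
    · rcases h9 with rfl | ⟨_, _, -, h9, -⟩
      · exact .inl rfl
      · exact .inr h9

/-- The factor 2 lets a run be prolonged by one flush whenever this flush then allows the cost to
drop: a drop by one outweighs one additional step (see `Closed.others_empty`). -/
def weight (w : List (Lab T L R D)) : ℕ := 2 * totalCost w + w.length

/-- Runs to a cyclic state with minimal weight. -/
structure MinViolation (P : Program T L R D) (w : List (Lab T L R D)) (s : GState T L R D) :
    Prop where
  run : GRun P (GState.initial P) w s
  cyclic : Cyclic s
  min : ∀ w' s', GRun P (GState.initial P) w' s' → Cyclic s' → weight w ≤ weight w'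

theorem exists_minViolation {w : List (Lab T L R D)} {s} (h : GRun P (GState.initial P) w s)
    (hc : Cyclic s) : ∃ w s, MinViolation P w s := by
  let S : Set (List (Lab T L R D)) := {w | ∃ s, GRun P (GState.initial P) w s ∧ Cyclic s}
  have hS : S.Nonempty := ⟨w, s, h, hc⟩
  obtain ⟨s', h1, h2⟩ := Function.argminOn_mem weight S hS
  exact ⟨_, s', h1, h2, fun w' s' h3 h4 => Function.argminOn_le weight S ⟨s', h3, h4⟩⟩

/-- In a minimal violation only the last step can be a store that overtakes an instruction. -/
theorem MinViolation.last_of_overtaking {ρ₁ y ρ₂ x ρ'} {s : GState T L R D}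
    (h : MinViolation P (ρ₁ ++ y :: (ρ₂ ++ x :: ρ')) s) (hy : y.isStore = false) (hc : 0 < y.cost)
    (hyx : y.thread = x.thread) (hρ : ∀ z ∈ ρ₂, z.thread ≠ x.thread) (hx : x.isStore = true) :
    ρ' = [] := by
  have hr : GRun P (GState.initial P) (ρ₁ ++ ((y :: (ρ₂ ++ [x])) ++ ρ')) s := by
    convert h.run using 1; simp
  obtain ⟨u, h1, h2⟩ := gRun_append.1 hr
  obtain ⟨s₁, h3, h4⟩ := gRun_append.1 h2
  have hu := h1.wf WF.initial
  -- Undelaying would contradict minimality. So `y` reaches `x`, and `x` precedes `y` in program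
  -- order: the cycle is complete right after `x`, and by minimality nothing follows.
  rcases h3.undelay hu hyx with ⟨w, h5, h6, h7⟩ | ⟨U, z', B, h5, h6, -, -, -, -, h7⟩
  · have := h.min (ρ₁ ++ (w ++ ρ')) s (gRun_append.2 ⟨u, h1, gRun_append.2 ⟨s₁, h5, h4⟩⟩) h.cyclic
    simp [weight] at this h6 h7
    omega
  · have h8 := (h3.overtaken hu hy hc hyx hρ hx).2.1
    rw [← h6.node] at h8
    have h9 := h7 x (by simp)
    have h10 := h.min (ρ₁ ++ (y :: (ρ₂ ++ [x]))) s₁ (gRun_append.2 ⟨u, h1, h3⟩)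
      ⟨_, Relation.TransGen.tail' (Relation.ReflTransGen.mono (fun _ _ h' => h'.1) _ _ h9) h8⟩
    rw [← List.length_eq_zero_iff]
    simp [weight] at h10
    omega

/-- The first store that is not clean overtakes an instruction, and by
`MinViolation.last_of_overtaking` such a store must end the run; but `x` still follows it. -/
theorem MinViolation.allClean {ρ x} {s : GState T L R D} (h : MinViolation P (ρ ++ [x]) s) :
    AllClean ρ := by
  rcases allClean_or ρ with h1 | ⟨ρ₀, y, ρ', rfl, h1, h2, h3⟩
  · exact h1
  · have hr := h.run
    rw [List.append_assoc, gRun_append] at hr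
    obtain ⟨u, h4, u', h5, -⟩ := hr
    rcases h2.clean_or h4 h5 h1 with h6 | ⟨ρ₁, z, ρ₂, rfl, h6, h7, h8, h9⟩
    · exact absurd h6 h3
    · have := MinViolation.last_of_overtaking (ρ₁ := ρ₁) (y := z) (ρ₂ := ρ₂) (x := y)
        (ρ' := ρ' ++ [x]) (by convert h using 1; simp) h6 h7 h8 h9 h1
      simp at this

theorem not_cyclic_initial : ¬ Cyclic (GState.initial P) := by
  rintro ⟨n, hn⟩
  obtain ⟨c, hc, -⟩ := Relation.TransGen.head'_iff.1 hn
  cases hc with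
  | po t j k h hk => simp [GState.initial] at hk
  | pred _ _ r h => simp [GState.initial, GState.node] at h
  | cf _ _ t t' a v v' o h => simp [GState.initial, GState.node] at h

/-- The last step of a minimal violation is a store that overtakes an instruction. -/
theorem MinViolation.shape {w} {s : GState T L R D} (h : MinViolation P w s) :
    ∃ A e B x, w = A ++ e :: (B ++ [x]) ∧ e.isStore = false ∧ 0 < e.cost ∧ e.thread = x.thread ∧
      (∀ z ∈ B, z.thread ≠ x.thread) ∧ x.isStore = true := by
  rcases List.eq_nil_or_concat' w with rfl | ⟨ρ, x, rfl⟩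
  · obtain rfl := h.run
    exact absurd h.cyclic not_cyclic_initial
  have hcl := h.allClean
  obtain ⟨u, h1, h2⟩ := gRun_snoc.1 h.run
  -- Otherwise the node of `x` has no outgoing edges, the cycle avoids it, and the run without its
  -- last step is a lighter violation.
  have hlast : x.idx + 1 ≠ (s.loc x.thread).len := by
    intro hl
    have hu := h1.wf WF.initial
    have := h.min ρ u h1 (h.cyclic.of_no_out (h2.no_out hu hl)
      (fun a b hab ha hb => hab.of_step h2 hu ha hb))
    simp [weight] at this
    omega
  have hx : x.isStore = true := by
    by_contra hx
    rw [Bool.not_eq_true] at hx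
    obtain ⟨h3, -, h4, -⟩ := h2.of_nonstore hx
    omega
  rcases hcl.clean_or h1 h2 hx with ⟨ρ₁, y, ρ₂, rfl, h3, h4, h5, h6⟩ |
    ⟨ρ₁, y, ρ₂, rfl, h3, h4, h5, h6⟩
  -- A clean final store would belong to the last node of its thread, contrary to `hlast`.
  · exfalso
    apply hlast
    obtain ⟨a, v, β, -, -, rfl⟩ := h2.of_store hx
    obtain ⟨u₁, -, u₂, h7, h8⟩ := gRun_append.1 h1
    obtain ⟨h9, -, h10, -⟩ := h7.of_nonstore h3
    have ht : y.thread = x.thread := congrArg Prod.fst h5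
    have hi : y.idx = x.idx := congrArg Prod.snd h5
    rw [afterFlush_len, h8.loc_of_ne h6, ← ht, h10, ← hi, h9]
  · exact ⟨ρ₁, y, ρ₂, x, by simp, h3, h4, h5, h6, hx⟩

end

section

variable {T L R D : Type*} [Zero D] {P : Program T L R D}

/-! ### From violations to attacks -/

/-- No other thread moves, so a single nonempty buffer can be emptied at the end of a run without
disturbing anything else. -/
theorem exists_flush (t : T) (γ : List (ℕ × D × D)) (s : GState T L R D)
    (h : (s.loc t).buf = γ) : ∃ w s', GRun P s w s' ∧ (s'.loc t).buf = [] ∧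
      (∀ u, u ≠ t → s'.loc u = s.loc u) ∧
      ∀ y ∈ w, ∃ k c v, y = ⟨⟨.store t c v, none⟩, k, 0⟩ ∧ (k, c, v) ∈ γ := by
  induction γ generalizing s with
  | nil => exact ⟨[], s, rfl, h, fun _ _ => rfl, by simp⟩
  | cons c γ ih =>
    obtain ⟨k, a, v⟩ := c
    have hst := GStep.flush (P := P) h
    obtain ⟨w, s', h1, h2, h3, h4⟩ := ih (s.afterFlush t k a v γ) (by simp [afterFlush_buf])
    refine ⟨_ :: w, s', ⟨_, hst, h1⟩, h2, fun u hu => ?_, ?_⟩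
    · rw [h3 u hu]; simp [GState.afterFlush, hu]
    · intro y hy
      rcases List.mem_cons.1 hy with rfl | hy
      · exact ⟨k, a, v, rfl, by simp⟩
      · obtain ⟨k', c', v', h5, h6⟩ := h4 y hy
        exact ⟨k', c', v', h5, by simp [h6]⟩

theorem GRun.node_of_ne {s s' : GState T L R D} {w} (h : GRun P s w s') (hs : WF s) {n : Node T}
    (hn : ∀ z ∈ w, z.node ≠ n) : s'.node n = s.node n := by
  induction w generalizing s with
  | nil => obtain rfl := h; rfl
  | cons x w ih =>
    obtain ⟨u, hu, hw⟩ := h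
    rw [ih hw (hu.wf hs) (fun z hz => hn z (by simp [hz])),
      (hu.node_update hs).1 n (hn x (by simp)).symm]

/-! ### Attacks extracted from minimal violations. -/

/-- An attack in the instrumented semantics: after `A`, the load `e` overtakes the store `x`, all
steps of `B` and `x` are reachable from `e`, and finally the thread of `x` empties its buffer. -/
structure GAttack (P : Program T L R D) (A : List (Lab T L R D)) (e : Lab T L R D)
    (B : List (Lab T L R D)) (x : Lab T L R D) (C : List (Lab T L R D)) (s s' : GState T L R D)
    (i : LInstr L R D) (b u : D) : Prop where
  run : GRun P (GState.initial P) (A ++ e :: (B ++ [x])) s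
  flush : GRun P s C s'
  empty : ∀ t, (s'.loc t).buf = []
  clean : AllClean (A ++ e :: B)
  load : e.ev = ⟨.load x.thread b u, some i⟩
  mem : i ∈ P.code x.thread
  inst : ∃ r ea, i.inst = .load r ea
  no_thread : ∀ z ∈ B, z.thread ≠ x.thread
  store : x.isStore = true
  reach : ∀ y ∈ B ++ [x], Relation.ReflTransGen (HB s) e.node y.node
  back : HB s x.node e.node
  suffix : ∀ y ∈ C, ∃ c v, y.ev = ⟨.store x.thread c v, none⟩ ∧ c ≠ b
  addr : ∀ t a v, x.ev.act = .store t a v → a ≠ b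

/-- The shape of a minimal violation after rearrangement. -/
structure Closed (P : Program T L R D) (A : List (Lab T L R D)) (e : Lab T L R D)
    (B : List (Lab T L R D)) (x : Lab T L R D) (s : GState T L R D) : Prop where
  min : MinViolation P (A ++ e :: (B ++ [x])) s
  nonstore : e.isStore = false
  cost : 0 < e.cost
  thread : e.thread = x.thread
  no_thread : ∀ z ∈ B, z.thread ≠ x.thread
  store : x.isStore = true
  reach : ∀ y ∈ B ++ [x], Reach s (nodesOf (e :: (B ++ [x]))) e.node y.node

/-- The cost of a nonstore is the length of the buffer. -/
theorem GStep.cost_eq_of_ev {s s' : GState T L R D} {x} (h : GStep P s x s')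
    (hx : x.isStore = false) : x.cost = (s.loc x.thread).buf.length := (h.of_nonstore hx).2.1

/-- In a minimal violation `GRun.undelay` cannot lower the cost, so it rearranges the part between
the overtaken instruction and the final store. The weight does not grow, hence the new run is
minimal as well. The steps moved in front of `e'` belong to other threads, so the final store is
still pending when `e'` executes and the cost of `e'` stays positive. -/
theorem exists_closed {w} {s : GState T L R D} (h : MinViolation P w s) :
    ∃ A e B x, Closed P A e B x s := by
  obtain ⟨A, e, B, x, rfl, h1, h2, h3, h4, h5⟩ := h.shape
  obtain ⟨u, h6, h7⟩ := gRun_append.1 h.run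
  have hu := h6.wf WF.initial
  have hbuf := (h7.overtaken hu h1 h2 h3 h4 h5).2.2
  rcases h7.undelay hu h3 with ⟨w', h8, h9, h10⟩ | ⟨U, e', B', h8, h9, h10, h11, h12, h13, h14⟩
  · have := h.min (A ++ w') s (gRun_append.2 ⟨u, h6, h8⟩) h.cyclic
    simp [weight] at this h9 h10
    omega
  · have hU : ∀ z ∈ U, z.thread ≠ x.thread := fun z hz => by
      obtain ⟨c, hc, hzc⟩ := h10 z hz
      rw [hzc.thread]; exact h4 c hc
    have he' : e'.isStore = false := by rw [h9.isStore, h1]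
    have het : e'.thread = x.thread := by rw [h9.thread, h3]
    refine ⟨A ++ U, e', B', x, ⟨?_, h.cyclic, fun w' s' h15 h16 => ?_⟩, he', ?_, het,
      fun z hz => ?_, h5, h14⟩
    · rw [List.append_assoc]; exact gRun_append.2 ⟨u, h6, h8⟩
    · have := h.min w' s' h15 h16
      simp [weight] at this h12 h13 ⊢
      omega
    · obtain ⟨u', h17, u'', h18, -⟩ := gRun_append.1 h8
      obtain ⟨a, v, γ, δ, -, h19, -⟩ := hbuf
      rw [h18.cost_eq_of_ev he', het, h17.loc_of_ne hU, h19]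
      simp
    · obtain ⟨c, hc, hzc⟩ := h11 z hz
      rw [hzc.thread]; exact h4 c hc

variable {A B : List (Lab T L R D)} {e x : Lab T L R D} {s : GState T L R D}

theorem Closed.back (h : Closed P A e B x s) : x.idx < e.idx ∧ HB s x.node e.node := by
  obtain ⟨u, h1, h2⟩ := gRun_append.1 h.min.run
  obtain ⟨h3, h4, -⟩ := h2.overtaken (h1.wf WF.initial) h.nonstore h.cost h.thread h.no_thread
    h.store
  exact ⟨h3, h4⟩

theorem Closed.allClean (h : Closed P A e B x s) : AllClean (A ++ e :: B) :=
  MinViolation.allClean (x := x) (s := s) (P := P) (by convert h.min using 1; simp)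

/-- The overtaking step reads from memory. -/
theorem Closed.read (h : Closed P A e B x s) : ∃ i b u, e.ev = ⟨.load x.thread b u, some i⟩ ∧
    i ∈ P.code x.thread ∧ (∃ r ea, i.inst = .load r ea) ∧
    (∀ c ∈ (s.loc x.thread).buf, c.2.1 ≠ b) ∧ ∀ t a v, x.ev.act = .store t a v → a ≠ b := by
  have hs := h.min.run.wf WF.initial
  obtain ⟨u, h1, h2⟩ := gRun_append.1 h.min.run
  have hu := h1.wf WF.initial
  obtain ⟨h3, h4, a, v, γ, δ, h5, h6, h7, h8⟩ := h2.overtaken hu h.nonstore h.cost h.thread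
    h.no_thread h.store
  obtain ⟨u₁, h9, h10⟩ := h2
  have hu₁ := h9.wf hu
  obtain ⟨h11, -, h12, -⟩ := h9.of_nonstore h.nonstore
  have hlen : (s.loc x.thread).len = e.idx + 1 := by
    obtain ⟨u₂, h13, h14⟩ := gRun_snoc.1 h10
    obtain ⟨_, _, _, -, -, rfl⟩ := h14.of_store h.store
    rw [afterFlush_len, h13.loc_of_ne h.no_thread, ← h.thread, h12, h11]
  have hxm : s.mem a = (v, some x.node) := by
    obtain ⟨u₂, h13, h14⟩ := gRun_snoc.1 h10
    obtain ⟨a', v', β, h15, -, rfl⟩ := h14.of_store h.store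
    have h16 := h5.symm.trans h15
    simp only [Lab.mk.injEq, Event.mk.injEq, Action.store.injEq, and_true, true_and] at h16
    obtain ⟨rfl, rfl⟩ := h16
    rw [afterFlush_mem, if_pos rfl]; rfl
  have hnode : s.node e.node = u₁.node e.node := by
    refine h10.node_of_ne hu₁ fun z hz => ?_
    rcases List.mem_append.1 hz with hz | hz
    · intro h0
      exact h.no_thread z hz ((congrArg Prod.fst h0).trans h.thread)
    · rw [List.mem_singleton.1 hz]
      intro h0
      have := congrArg Prod.snd h0
      simp only [Lab.node] at this
      omega
  -- `e` reaches `x`, and the two nodes differ since `x.idx < e.idx`; so the path starts with an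
  -- edge. As `e` is the last node of its thread and not a store, this edge can only be a conflict,
  -- which makes `e` a load.
  have hout : ∃ n, HB s e.node n := by
    have h13 := h.reach x (by simp)
    rcases Relation.ReflTransGen.cases_head h13 with h14 | ⟨c, hc, -⟩
    · have := congrArg Prod.snd h14
      simp only [Lab.node] at this
      omega
    · exact ⟨c, hc.1⟩
  have hen : e.node = (x.thread, e.idx) := by rw [← h.thread]; rfl
  rcases h9.view with ⟨t, act, i, acc, ρ, β, p, he, hm, rfl, rfl⟩ | ⟨t, k, a', v', β, hb, rfl, rfl⟩
  swap
  · exact absurd h.nonstore (by simp [Lab.isStore, Action.isStore])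
  have ht : t = x.thread := he.thread_eq.symm.trans h.thread
  subst ht
  rw [hen] at hnode hout
  rw [afterExec_node, if_pos rfl] at hnode
  obtain ⟨n, hn⟩ := hout
  cases hn with
  | po _ _ k hk hk' => simp only at hk hlen; omega
  | pred _ _ r hr hp =>
    obtain ⟨act', p'⟩ := r
    obtain rfl : p' = some _ := hp
    exfalso
    have hns := he.not_store
    cases act' with
    | issue => have := hs.issue _ _ _ hr; cases this
    | loc => have := hs.loc_pred _ _ _ hr; cases this
    | load t' a' v' =>
      rcases hs.load_pred _ _ _ _ _ hr with ⟨v', o', h0⟩ | ⟨h0, h0', -⟩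
      · rw [hnode] at h0
        simp only [Option.some.injEq, NodeRec.mk.injEq] at h0
        rw [h0.1] at hns; simp [Action.isStore] at hns
      · have := hs.lt _ _ hr
        simp only at h0 h0' hlen
        rw [← h0, hlen] at this; omega
    | store t' a' v' =>
      obtain ⟨v', o', h0⟩ := hs.store_pred _ _ _ _ _ hr
      rw [hnode] at h0
      simp only [Option.some.injEq, NodeRec.mk.injEq] at h0
      rw [h0.1] at hns; simp [Action.isStore] at hns
  | cf _ _ t t' a' v₁ v₂ o hm' hn' =>
    rw [hnode] at hm'
    cases he with
    | issue => cases hm'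
    | internal => cases hm'
    | early _ r ea k a'' v'' γ' hi hpc hinst ha hbuf =>
      cases hm'
      exfalso
      have hk : (k, a', v₁) ∈ (u.loc x.thread).buf := by
        refine List.mem_of_mem_filter (p := fun p => decide (p.2.1 = a')) ?_
        rw [hbuf]; simp
      rw [h6] at hk
      -- An early read is impossible: a source equal to `x` is the last writer in memory and has no
      -- successor in the store order, and any other source is still pending. Both contradict the
      -- conflict edge.
      rcases List.mem_cons.1 hk with hk | hk
      · cases hk
        refine hs.pred_ne _ _ _ _ _ hn' ?_
        rw [hxm]; rfl
      · obtain ⟨v₃, o', h0⟩ := hs.store_pred _ _ _ _ _ hn'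
        have := hs.node_of_buf (t := x.thread) (c := (k, a', v₁)) (by rw [h7]; simp [hk])
        rw [this] at h0; cases h0
    | read _ r ea b c hi hpc hinst ha hbuf =>
      have hb : ∀ c ∈ (u.loc x.thread).buf, c.2.1 ≠ b := by
        intro c hc hcb
        have : c ∈ (u.loc x.thread).buf.filter (fun p => decide (p.2.1 = b)) := by simp [hc, hcb]
        rw [hbuf] at this; simp at this
      refine ⟨i, b, c.1, rfl, hi, ⟨r, ea, hinst⟩, fun c hc => ?_, fun t₁ a₁ w₁ h0 => ?_⟩
      · rcases h8 with rfl | h8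
        · rw [h7, List.append_nil] at hc
          exact hb c (by rw [h6]; simp [hc])
        · simp at h8
      · rw [h5] at h0
        cases h0
        exact hb (x.idx, a, v) (by rw [h6]; simp)

/-- At the end of a minimal violation the buffers of all other threads are empty. -/
theorem Closed.others_empty (h : Closed P A e B x s) {t : T} (ht : t ≠ x.thread) :
    (s.loc t).buf = [] := by
  by_contra hb
  have hrun : GRun P (GState.initial P) ((A ++ e :: B) ++ [x]) s := by
    convert h.min.run using 1; simp
  obtain ⟨u, h1, h2⟩ := gRun_snoc.1 hrun
  have hs := hrun.wf WF.initial
  have hbu : (u.loc t).buf ≠ [] := by rwa [← h2.loc_of_ne ht.symm]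
  have hclean := h.allClean
  have het : e.thread ≠ t := by rw [h.thread]; exact ht.symm
  have hback := h.back
  have hreach := h.reach x (by simp)
  rcases exists_last (fun z => z.thread = t) B with hB | ⟨B₁, y, B₂, rfl, hy, hB₂⟩
  · rcases exists_last (fun z => z.thread = t) A with hA | ⟨A₁, y, A₂, rfl, hy, hA₂⟩
    · refine hbu ?_
      rw [h1.loc_of_ne (t := t)]
      · rfl
      · intro z hz
        rcases List.mem_append.1 hz with hz | hz
        · exact hA z hz
        · rcases List.mem_cons.1 hz with rfl | hz
          · exact het
          · exact hB z hz
    · have hno : ∀ z ∈ A₂ ++ e :: B, z.thread ≠ t := by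
        intro z hz
        rcases List.mem_append.1 hz with hz | hz
        · exact hA₂ z hz
        · rcases List.mem_cons.1 hz with rfl | hz
          · exact het
          · exact hB z hz
      have hyn : y.isStore = false :=
        AllClean.last_nonstore (P := P) (s := u) (ρ₁ := A₁) (ρ₂ := A₂ ++ e :: B)
          (by convert h1 using 1; simp) (by convert hclean using 1; simp) (by rwa [hy])
          (by rwa [hy])
      have h3 := h.min.run
      rw [List.append_assoc, List.cons_append, gRun_append] at h3
      obtain ⟨u₀, h4, h5⟩ := h3
      have hno' : ∀ z ∈ A₂ ++ e :: (B ++ [x]), z.thread ≠ t := by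
        intro z hz
        by_cases hzx : z = x
        · rw [hzx]; exact ht.symm
        · exact hno z (by simp [hzx] at hz ⊢; tauto)
      -- The last step `y` of the thread precedes `e`. The cycle through `e` and `x` uses only nodes
      -- from `e` on, so it survives the deletion of `y`, contrary to minimality.
      obtain ⟨s', h6, h7⟩ := h5.delete hyn (fun z hz hzy => absurd (hzy.trans hy) (hno' z hz))
      have := h.min.min (A₁ ++ (A₂ ++ e :: (B ++ [x]))) s' (gRun_append.2 ⟨u₀, h4, h6⟩)
        (hreach.cyclic hback.2 ⟨e, by simp, rfl⟩ ⟨x, by simp, rfl⟩ (m := y.node) ?_ h7)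
      · simp [weight] at this; omega
      · rintro ⟨z, hz, hzy⟩
        exact hno' z (by simp at hz ⊢; tauto) ((congrArg Prod.fst hzy).trans hy)
  · have hyn : y.isStore = false :=
      AllClean.last_nonstore (P := P) (s := u) (ρ₁ := A ++ e :: B₁) (ρ₂ := B₂)
        (by convert h1 using 1; simp) (by convert hclean using 1; simp) (by rwa [hy])
        (by rwa [hy])
    have hno' : ∀ z ∈ B₂ ++ [x], z.thread ≠ t := by
      intro z hz
      rcases List.mem_append.1 hz with hz | hz
      · exact hB₂ z hz
      · rw [List.mem_singleton.1 hz]; exact ht.symm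
    have h3 : GRun P (GState.initial P) ((A ++ e :: B₁) ++ y :: (B₂ ++ [x])) s := by
      convert h.min.run using 1; simp
    obtain ⟨u₀, h4, h5⟩ := gRun_append.1 h3
    have hu₀ := h4.wf WF.initial
    rcases Nat.eq_zero_or_pos y.cost with hc | hc
    -- With cost zero and a nonempty final buffer, `y` is an issue that is still pending and the
    -- last node of its thread. It has no outgoing edges, so the cycle avoids it and it can be
    -- deleted.
    · obtain ⟨s', h6, h7⟩ := h5.delete hyn (fun z hz hzy => absurd (hzy.trans hy) (hno' z hz))
      obtain ⟨u₁, h8, h9⟩ := h5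
      obtain ⟨h10, h11, h12, -, -, β, h13, h14⟩ := h8.of_nonstore hyn
      rw [hy] at h10 h11 h12 h13 h14
      have hl := h9.loc_of_ne hno'
      have h15 : s.node y.node = some ⟨.issue t, none⟩ := by
        rcases h14 with rfl | ⟨_, _, -, -, h14⟩
        · exfalso; apply hb
          rw [hl, h13, List.append_nil]
          exact List.eq_nil_of_length_eq_zero (h11.symm.trans hc)
        · rw [h9.node_of_ne (h8.wf hu₀)]
          · exact h14
          · intro z hz hzy
            exact hno' z hz ((congrArg Prod.fst hzy).trans hy)
      have hyn' : y.node = (t, y.idx) := by rw [← hy]; rfl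
      have := h.min.min ((A ++ e :: B₁) ++ (B₂ ++ [x])) s' (gRun_append.2 ⟨u₀, h4, h6⟩)
        (h.min.cyclic.of_no_out (m := y.node) ?_ h7)
      · simp [weight] at this; omega
      · rw [hyn'] at h15 ⊢
        exact hs.no_out_of_issue (by rw [hl, h12, h10]) h15
    -- With positive cost, the run is prolonged by the flush `x'` of the oldest entry, which
    -- overtakes `y`. Undelaying it would gain at least 2 in weight for the one additional step, so
    -- instead `y` and `x'` lie on a cycle of their own.
    · cases hbs : (s.loc t).buf with
      | nil => exact hb hbs
      | cons c γ =>
        obtain ⟨k, a, v⟩ := c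
        have h6 := GStep.flush (P := P) hbs
        generalize hs₃ : s.afterFlush t k a v γ = s₃ at h6
        generalize hx' : (⟨⟨.store t a v, none⟩, k, 0⟩ : Lab T L R D) = x' at h6
        have hxt : x'.thread = t := by rw [← hx']; rfl
        have hxc : x'.cost = 0 := by rw [← hx']
        have hxs : x'.isStore = true := by rw [← hx']; rfl
        have hc₃ : Cyclic s₃ := h.min.cyclic.run (gRun_cons.2 ⟨s₃, h6, rfl⟩ : GRun P s [x'] s₃) hs
        have h7 : GRun P u₀ (y :: ((B₂ ++ [x]) ++ [x'])) s₃ := by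
          rw [← List.cons_append, gRun_snoc]; exact ⟨s, h5, h6⟩
        rcases h7.undelay hu₀ (hy.trans hxt.symm) with ⟨w', h8, h9, h10⟩ |
          ⟨U, y', B', -, h8, -, h9, -, -, h10⟩
        · have := h.min.min ((A ++ e :: B₁) ++ w') s₃ (gRun_append.2 ⟨u₀, h4, h8⟩) hc₃
          simp [weight, hxc] at this h9 h10
          omega
        · have h11 := (h7.overtaken hu₀ hyn hc (hy.trans hxt.symm) (by rwa [hxt]) hxs).2.1
          have h12 : GRun P (GState.initial P) (A ++ e :: (B₁ ++ y :: (B₂ ++ [x]) ++ [x'])) s₃ := by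
            have : A ++ e :: (B₁ ++ y :: (B₂ ++ [x]) ++ [x']) =
                ((A ++ e :: B₁) ++ y :: (B₂ ++ [x])) ++ [x'] := by simp
            rw [this, gRun_snoc]; exact ⟨s, h3, h6⟩
          obtain ⟨u', h13, h14⟩ := gRun_append.1 h12
          -- The new cycle does not contain `e`. The thread of `e` afterwards executes only `x`,
          -- issued before `e`, so `e` can be deleted. This pays for the length of `x'` and saves
          -- the positive cost of `e`.
          obtain ⟨s', h15, h16⟩ := h14.delete h.nonstore (by
            intro z hz hze
            rw [h.thread] at hze
            have hzB : z ∈ B₁ ++ y :: B₂ → False := fun hz => h.no_thread z hz hze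
            have : z = x ∨ z = x' := by
              by_contra hn
              push Not at hn
              simp [hn] at hz hzB; tauto
            rcases this with rfl | rfl
            · exact ⟨h.store, hback.1.ne⟩
            · exact absurd (hxt.symm.trans hze) ht)
          have := h.min.min _ s' (gRun_append.2 ⟨u', h13, h15⟩)
            ((h10 x' (by simp)).cyclic (by rw [h8.node]; exact h11) ⟨y', by simp, rfl⟩
              ⟨x', by simp, rfl⟩ (m := e.node) ?_ h16)
          · have hec := h.cost
            simp [weight, hxc] at this; omega
          · rintro ⟨z, hz, hze⟩
            have hz1 : z.thread = x.thread := (congrArg Prod.fst hze).trans h.thread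
            have hz2 : z.idx = e.idx := congrArg Prod.snd hze
            simp only [List.mem_cons, List.mem_append, List.not_mem_nil, or_false] at hz
            rcases hz with rfl | hz | rfl
            · exact ht (hy.symm.trans (h8.thread.symm.trans hz1))
            · obtain ⟨c, hc, hzc⟩ := h9 z hz
              rw [hzc.thread] at hz1
              rcases List.mem_append.1 hc with hc | hc
              · exact h.no_thread c (by simp [hc]) hz1
              · rw [List.mem_singleton.1 hc] at hzc
                rw [hzc.2.1] at hz2
                have := hback.1
                omega
            · exact ht (hxt.symm.trans hz1)

/-- Only the thread of `x` has pending stores left, and none of them is to the address of the load,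
so flushing that one buffer completes the run. -/
theorem Closed.exists_attack (h : Closed P A e B x s) :
    ∃ C s' i b u, GAttack P A e B x C s s' i b u := by
  obtain ⟨i, b, u, h1, h2, h3, h4, h5⟩ := h.read
  obtain ⟨C, s', h6, h7, h8, h9⟩ := exists_flush (P := P) x.thread _ s rfl
  refine ⟨C, s', i, b, u, h.min.run, h6, fun t => ?_, h.allClean, h1, h2, h3, h.no_thread, h.store,
    fun y hy => ?_, h.back.2, fun y hy => ?_, h5⟩
  · by_cases ht : t = x.thread
    · rw [ht]; exact h7
    · rw [h8 t ht]; exact h.others_empty ht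
  · exact Relation.ReflTransGen.mono (fun _ _ h' => h'.1) _ _ (h.reach y hy)
  · obtain ⟨k, c, v, rfl, hc⟩ := h9 y hy
    exact ⟨c, v, rfl, h4 _ hc⟩

theorem exists_gAttack {w} {s : GState T L R D} (h : GRun P (GState.initial P) w s)
    (hc : Cyclic s) : ∃ A e B x C s s' i b u, GAttack P A e B x C s s' i b u := by
  obtain ⟨w, s, h⟩ := exists_minViolation h hc
  obtain ⟨A, e, B, x, h⟩ := exists_closed h
  obtain ⟨C, s', i, b, u, h⟩ := h.exists_attack
  exact ⟨A, e, B, x, C, s, s', i, b, u, h⟩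

end

section

variable {T L R D : Type*} [Zero D] {P : Program T L R D}

/-! ### Traces and instrumented states -/

theorem Trace.transGen_po {G : Trace T D} {m n : Node T} :
    Relation.TransGen G.po m n ↔ m.1 = n.1 ∧ m.2 < n.2 ∧ n.2 < (G.seq n.1).length := by
  constructor
  · intro h
    induction h with
    | single h => exact ⟨h.2.2.1, by have := h.2.2.2; omega, h.2.1⟩
    | tail _ h ih =>
      have := h.2.2.2
      exact ⟨ih.1.trans h.2.2.1, by omega, h.2.1⟩
  · obtain ⟨t, j⟩ := m
    obtain ⟨u, k⟩ := n
    rintro ⟨rfl, h1, h2⟩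
    simp only at h1 h2
    induction k with
    | zero => omega
    | succ k ih =>
      have h2' : k < (G.seq t).length := by
        have : k + 1 < (G.seq t).length := h2
        omega
      have hstep : G.po (t, k) (t, k + 1) := ⟨h2', h2, rfl, rfl⟩
      rcases Nat.lt_succ_iff_lt_or_eq.1 h1 with h3 | rfl
      · exact .tail (ih h3 h2') hstep
      · exact .single hstep

/-- The load `q` reads from a store that is still pending. -/
def ReadsPending (s : GState T L R D) (q : Node T) : Prop :=
  ∃ t a v p u, s.node q = some ⟨.load t a v, some p⟩ ∧ s.node p = some ⟨.issue u, none⟩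

/-- The trace of a computation and the instrumented state that it leads to. -/
structure Link (G : Trace T D) (s : GState T L R D) : Prop where
  seq : ∀ t k, (G.seq t)[k]? = (s.node (t, k)).map NodeRec.act
  st : ∀ p q, G.st p q ↔ ∃ t a v, s.node q = some ⟨.store t a v, some p⟩
  src : ∀ p q, ¬ ReadsPending s q → (G.src p q ↔ ∃ t a v, s.node q = some ⟨.load t a v, some p⟩)

theorem Link.initial : Link (Trace.empty : Trace T D) (GState.initial P) := by
  constructor <;> simp [Trace.empty, GState.initial, GState.node]

variable {G : Trace T D} {s s' : GState T L R D}

theorem Link.label (h : Link G s) (n : Node T) : G.label n = (s.node n).map NodeRec.act :=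
  h.seq n.1 n.2

theorem Link.label_eq (h : Link G s) {n : Node T} {act} :
    G.label n = some act ↔ ∃ o, s.node n = some ⟨act, o⟩ := by
  rw [h.label, Option.map_eq_some_iff]
  constructor
  · rintro ⟨⟨a, o⟩, h, rfl⟩; exact ⟨o, h⟩
  · rintro ⟨o, h⟩; exact ⟨_, h, rfl⟩

theorem Link.length (h : Link G s) (hs : WF s) (t : T) : (G.seq t).length = (s.loc t).len := by
  apply le_antisymm
  · by_contra hlt
    push Not at hlt
    have h1 := h.seq t (s.loc t).len
    rw [hs.node_len, List.getElem?_eq_getElem hlt] at h1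
    cases h1
  · by_contra hlt
    push Not at hlt
    obtain ⟨r, hr⟩ := hs.defined _ _ hlt
    have h1 := h.seq t (G.seq t).length
    rw [hr, List.getElem?_eq_none le_rfl] at h1
    cases h1

/-- By `WF.succ` and `WF.pred_ne` a store is without successor in the store order exactly if it is
the last writer of its address. -/
theorem Link.isMaxStore (h : Link G s) (hs : WF s) {a p} :
    G.IsMaxStore a p ↔ (s.mem a).2 = some p := by
  constructor
  · rintro ⟨⟨t, v, h1⟩, h2⟩
    obtain ⟨o, h3⟩ := h.label_eq.1 h1
    rcases hs.succ _ _ _ _ _ h3 with h4 | ⟨m, t', v', h4⟩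
    · exact h4
    · exact absurd ((h.st _ _).2 ⟨_, _, _, h4⟩) (h2 m)
  · intro h1
    obtain ⟨v, o, h2⟩ := hs.writer a p h1
    refine ⟨⟨p.1, v, h.label_eq.2 ⟨o, h2⟩⟩, fun m hm => ?_⟩
    obtain ⟨t', a', v', h3⟩ := (h.st _ _).1 hm
    obtain ⟨v₁, o₁, h4⟩ := hs.store_pred _ _ _ _ _ h3
    rw [h2] at h4
    cases h4
    exact hs.pred_ne _ _ _ _ _ h3 h1.symm

/-- The trace assigns a store to the first node still labelled as an issue. Pending issues are the
buffer entries and their indices increase, so this is the node of the oldest entry. -/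
theorem Link.nodeOf_store (h : Link G s) (hs : WF s) {t k a v β}
    (hb : (s.loc t).buf = (k, a, v) :: β) (b w : D) : G.nodeOf (.store t b w) = (t, k) := by
  have hk := hs.node_of_buf (t := t) (c := (k, a, v)) (by simp [hb])
  have hl := hs.lt _ _ hk
  rw [← h.length hs] at hl
  have hso := hs.sorted t
  rw [hb, List.pairwise_cons] at hso
  simp only [Trace.nodeOf, Prod.mk.injEq, true_and]
  rw [List.findIdx_eq hl]
  have hget : ∀ j (hj : j < (G.seq t).length), ∃ o, s.node (t, j) = some ⟨(G.seq t)[j], o⟩ := by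
    intro j hj
    exact h.label_eq.1 (by simp [Trace.label, hj])
  constructor
  · obtain ⟨o, h1⟩ := hget k hl
    rw [hk] at h1
    simp only [Option.some.injEq, NodeRec.mk.injEq] at h1
    rw [← h1.1]; rfl
  · intro j hj
    obtain ⟨o, h1⟩ := hget j (hj.trans hl)
    by_contra hi
    rw [Bool.not_eq_false] at hi
    have hth := hs.thread _ _ h1
    generalize (G.seq t)[j]'(hj.trans hl) = act at *
    cases act with
    | issue u =>
      obtain rfl : u = t := hth
      obtain rfl := hs.issue _ _ _ h1
      obtain ⟨c, hc, rfl⟩ := (hs.pending _ _).1 h1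
      rw [hb] at hc
      rcases List.mem_cons.1 hc with rfl | hc
      · simp at hj
      · have := hso.1 c hc; simp only at this; omega
    | _ => simp [Action.isIssue] at hi

theorem Link.nodeOf_nonstore (h : Link G s) (hs : WF s) {act : Action T D}
    (ha : act.isStore = false) : G.nodeOf act = (act.thread, (s.loc act.thread).len) := by
  cases act <;> simp_all [Trace.nodeOf, Action.isStore, Action.thread, h.length hs]

theorem Link.nodeOf (h : Link G s) (hs : WF s) {x} (hx : GStep P s x s') :
    G.nodeOf x.ev.act = x.node := by
  rcases hx.view with ⟨t, act, i, acc, ρ, β, p, he, hm, rfl, rfl⟩ | ⟨t, k, a, v, β, hb, rfl, rfl⟩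
  · rw [h.nodeOf_nonstore hs he.not_store]
    simp only [Lab.node, Lab.thread, he.thread_eq]
  · exact h.nodeOf_store hs hb a v

theorem not_readsPending_of_exec (hs : WF s) {t l ρ β r q}
    (h : ¬ ReadsPending (s.afterExec t l ρ β r) q) : ¬ ReadsPending s q := by
  have hn := hs.node_len t
  rintro ⟨u, a, v, p, w, h1, h2⟩
  refine h ⟨u, a, v, p, w, ?_, ?_⟩
  · rw [afterExec_node, if_neg (by rintro rfl; rw [hn] at h1; cases h1), h1]
  · rw [afterExec_node, if_neg (by rintro rfl; rw [hn] at h2; cases h2), h2]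

theorem getElem?_append_singleton {α : Type*} (l : List α) (x : α) (k : ℕ) :
    (l ++ [x])[k]? = if k = l.length then some x else l[k]? := by
  rcases lt_trichotomy k l.length with h | rfl | h
  · rw [List.getElem?_append_left h, if_neg h.ne]
  · simp
  · rw [List.getElem?_eq_none (by simp; omega), if_neg h.ne', List.getElem?_eq_none h.le]

/-- Appending a node for an instruction preserves labels. -/
theorem Link.seq_exec (h : Link G s) (hs : WF s) (t : T) (l : L) (ρ : R → D)
    (β : List (ℕ × D × D)) (act : Action T D) (o : Option (Node T)) (u : T) (k : ℕ) :
    (Function.update G.seq t (G.seq t ++ [act]) u)[k]? =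
      ((s.afterExec t l ρ β ⟨act, o⟩).node (u, k)).map NodeRec.act := by
  rw [afterExec_node]
  by_cases hu : u = t
  · subst hu
    rw [Function.update_self, getElem?_append_singleton, h.length hs, h.seq]
    by_cases hk : k = (s.loc u).len <;> simp [hk]
  · rw [Function.update_of_ne hu, h.seq, if_neg (by simp [hu])]

theorem Link.st_exec (h : Link G s) (hs : WF s) {t l ρ β} {act : Action T D} {o}
    (ha : act.isStore = false) (p q : Node T) :
    G.st p q ↔ ∃ u a v, (s.afterExec t l ρ β ⟨act, o⟩).node q = some ⟨.store u a v, some p⟩ := by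
  rw [h.st]
  simp only [afterExec_node]
  by_cases hq : q = (t, (s.loc t).len)
  · subst hq
    simp only [hs.node_len, if_true]
    constructor
    · rintro ⟨_, _, _, h0⟩; cases h0
    · rintro ⟨_, _, _, h0⟩
      simp only [Option.some.injEq, NodeRec.mk.injEq] at h0
      rw [h0.1] at ha; cases ha
  · simp [hq]

theorem Link.src_exec (h : Link G s) (hs : WF s) {t l ρ β} {act : Action T D} {o}
    {p q : Node T} (hq : q ≠ (t, (s.loc t).len))
    (hp : ¬ ReadsPending (s.afterExec t l ρ β ⟨act, o⟩) q) :
    G.src p q ↔ ∃ u a v, (s.afterExec t l ρ β ⟨act, o⟩).node q = some ⟨.load u a v, some p⟩ := by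
  rw [h.src p q (not_readsPending_of_exec hs hp)]
  simp [afterExec_node, hq]

theorem Link.not_src_len (h : Link G s) (hs : WF s) {t p} : ¬ G.src p (t, (s.loc t).len) := by
  have hn := hs.node_len t
  rw [h.src _ _ (by rintro ⟨_, _, _, _, _, h0, -⟩; rw [hn] at h0; cases h0), hn]
  simp

theorem Link.afterExec (h : Link G s) (hs : WF s) {t act i acc ρ β o}
    (he : Exec P t (s.loc t) act i acc ρ β o) (hm : acc.Ok s.mem s.mem) :
    Link (G.extend act) (s.afterExec t i.dst ρ β ⟨act, o⟩) := by
  have hn : ∀ l ρ β r, (s.afterExec t l ρ β r).node (t, (s.loc t).len) = some r :=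
    fun l ρ β r => by rw [afterExec_node, if_pos rfl]
  have hw := hs.afterExec he hm
  have hns := he.not_store
  cases he with
  | issue _ ea ev hi hpc hinst =>
    refine ⟨h.seq_exec hs t _ _ _ _ _, h.st_exec hs hns, fun p q hp => ?_⟩
    by_cases hq : q = (t, (s.loc t).len)
    · subst hq
      rw [hn]
      simp only [Trace.extend]
      simp [h.not_src_len hs]
    · exact h.src_exec hs hq hp
  | internal _ ρ hi hpc hinst =>
    refine ⟨h.seq_exec hs t _ _ _ _ _, h.st_exec hs hns, fun p q hp => ?_⟩
    by_cases hq : q = (t, (s.loc t).len)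
    · subst hq
      rw [hn]
      simp only [Trace.extend]
      simp [h.not_src_len hs]
    · exact h.src_exec hs hq hp
  | early _ r e k a v γ hi hpc hinst ha hbuf =>
    refine ⟨h.seq_exec hs t _ _ _ _ _, h.st_exec hs hns, fun p q hp => ?_⟩
    simp only [Trace.extend, Trace.nodeOf, h.length hs]
    by_cases hq : q = (t, (s.loc t).len)
    -- The trace provisionally gives an early read the last store in memory as its source. The load
    -- still reads a pending store, so `Link` claims nothing about it yet.
    · exfalso
      subst hq
      have hk : (k, a, v) ∈ (s.loc t).buf := by
        refine List.mem_of_mem_filter (p := fun p => decide (p.2.1 = a)) ?_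
        rw [hbuf]; simp
      have hlt := hs.buf_lt hk
      refine hp ⟨t, a, v, (t, k), t, hn _ _ _ _, ?_⟩
      rw [afterExec_node, if_neg (by simp at hlt ⊢; omega)]
      exact hs.node_of_buf hk
    · rw [← h.src_exec hs hq hp]
      simp [hq]
  | read _ r e a c hi hpc hinst ha hbuf =>
    refine ⟨h.seq_exec hs t _ _ _ _ _, h.st_exec hs hns, fun p q hp => ?_⟩
    simp only [Trace.extend, Trace.nodeOf, h.length hs]
    by_cases hq : q = (t, (s.loc t).len)
    · subst hq
      rw [hn]
      simp only [h.not_src_len hs, h.isMaxStore hs, hm.1]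
      simp
    · rw [← h.src_exec hs hq hp]
      simp [hq]

/-- When a store is executed, the trace redirects all later loads of the thread with its address and
value. This fixes the loads that read the flushed entry. It may also hit loads that read a newer
pending entry with the same value; these remain exempt from `Link.src` until their own store is
executed. -/
theorem Link.afterFlush (h : Link G s) (hs : WF s) {t k a v β}
    (hb : (s.loc t).buf = (k, a, v) :: β) :
    Link (G.extend (.store t a v)) (s.afterFlush t k a v β) := by
  have hno := h.nodeOf_store hs hb a v
  have hk := hs.node_of_buf (t := t) (c := (k, a, v)) (by simp [hb])
  have hso := hs.sorted t
  rw [hb, List.pairwise_cons] at hso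
  refine ⟨fun u j => ?_, fun p q => ?_, fun p q hp => ?_⟩
  · simp only [Trace.extend, hno]
    rw [afterFlush_node]
    by_cases hu : u = t
    · subst hu
      rw [Function.update_self]
      by_cases hj : j = k
      · subst hj
        rw [List.getElem?_set_self, if_pos rfl]
        · rfl
        · rw [h.length hs]; exact hs.lt _ _ hk
      · rw [List.getElem?_set_ne (Ne.symm hj), h.seq, if_neg (by simp [hj])]
    · rw [Function.update_of_ne hu, h.seq, if_neg (by simp [hu])]
  · simp only [Trace.extend, hno]
    rw [h.isMaxStore hs, h.st]
    simp only [afterFlush_node]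
    by_cases hq : q = (t, k)
    · subst hq
      rw [hk]; simp
    · simp [hq]
  · simp only [Trace.extend, hno]
    rw [Trace.transGen_po]
    simp only [afterFlush_node]
    by_cases hq : q = (t, k)
    · subst hq
      rw [if_neg (by simp), h.src]
      · rw [hk]; simp
      · rintro ⟨_, _, _, _, _, h0, -⟩; rw [hk] at h0; cases h0
    · simp only [if_neg hq]
      by_cases hpend : ReadsPending s q
      -- The load was pending and is not any more, so its source is the flushed store, and the
      -- redirection gives it exactly this source.
      · obtain ⟨u, b, w, p₀, u', h1, h2⟩ := hpend
        have hp₀ : p₀ = (t, k) := by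
          by_contra hne
          refine hp ⟨u, b, w, p₀, u', ?_, ?_⟩
          · rw [afterFlush_node, if_neg hq, h1]
          · rw [afterFlush_node, if_neg hne, h2]
        subst hp₀
        rcases hs.load_pred _ _ _ _ _ h1 with ⟨v', o', h0⟩ | ⟨h3, h4, h5⟩
        · rw [h2] at h0; cases h0
        · have hut := hs.thread _ _ h1
          have hlt := hs.lt _ _ h1
          simp only [Action.thread] at hut h3 h4 h5
          subst h3
          subst hut
          rw [hb] at h5
          have : b = a ∧ w = v := by
            rcases List.mem_cons.1 h5 with h5 | h5
            · simp at h5; exact h5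
            · have := hso.1 _ h5; simp at this
          obtain ⟨rfl, rfl⟩ := this
          rw [if_pos ⟨⟨rfl, h4, by rw [h.length hs]; exact hlt⟩, h.label_eq.2 ⟨_, h1⟩⟩, h1]
          constructor
          · rintro rfl; exact ⟨_, _, _, rfl⟩
          · rintro ⟨_, _, _, h0⟩; cases h0; rfl
      -- A settled load is not redirected: by `WF.early` a later load of the address, executed while
      -- the entry is pending, reads a pending store.
      · rw [if_neg, h.src p q hpend]
        rintro ⟨⟨h1, h2, h3⟩, h4⟩
        obtain ⟨o, h5⟩ := h.label_eq.1 h4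
        obtain ⟨q1, q2⟩ := q
        simp only at h1 h2
        subst h1
        obtain ⟨k', rfl, -, h6⟩ := hs.early t k a v q2 v o (by rw [hb]; simp) h2 h5
        exact hpend ⟨t, a, v, (t, k'), t, h5, hs.node_of_buf h6⟩

theorem Link.step (h : Link G s) (hs : WF s) {x} (hx : GStep P s x s') :
    Link (G.extend x.ev.act) s' := by
  rcases hx.view with ⟨t, act, i, acc, ρ, β, p, he, hm, rfl, rfl⟩ | ⟨t, k, a, v, β, hb, rfl, rfl⟩
  · exact h.afterExec hs he hm
  · exact h.afterFlush hs hb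

def acts (w : List (Lab T L R D)) : List (Action T D) := w.map (fun x => x.ev.act)

theorem GRun.link {w} (h : GRun P (GState.initial P) w s) : Link (traceOf (acts w)) s := by
  induction w using List.reverseRecOn generalizing s with
  | nil => obtain rfl := h; exact Link.initial
  | append_singleton w x ih =>
    obtain ⟨u, h1, h2⟩ := gRun_snoc.1 h
    have := (ih h1).step (h1.wf WF.initial) h2
    simpa [traceOf, acts, List.foldl_append] using this

theorem not_readsPending (hs : WF s) (hb : ∀ t, (s.loc t).buf = []) (q : Node T) :
    ¬ ReadsPending s q := by
  rintro ⟨t, a, v, p, u, -, h⟩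
  obtain rfl : u = p.1 := hs.thread _ _ h
  obtain ⟨c, hc, -⟩ := (hs.pending p.1 p.2).1 h
  rw [hb] at hc; cases hc

/-- With empty buffers no load is exempt, so the state determines the whole trace. Hence any two
runs to the same such state have the same trace. -/
theorem Link.unique {G' : Trace T D} (h : Link G s) (h' : Link G' s) (hs : WF s)
    (hb : ∀ t, (s.loc t).buf = []) : G = G' := by
  obtain ⟨seq, st, src⟩ := G
  obtain ⟨seq', st', src'⟩ := G'
  obtain rfl : seq = seq' := by
    funext t
    exact List.ext_getElem? fun k => (h.seq t k).trans (h'.seq t k).symm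
  obtain rfl : st = st' := by
    funext p q
    exact propext ((h.st p q).trans (h'.st p q).symm)
  obtain rfl : src = src' := by
    funext p q
    have := not_readsPending hs hb q
    exact propext ((h.src p q this).trans (h'.src p q this).symm)
  rfl

/-- Happens-before of a trace and of the instrumented state have the same transitive closure. -/
theorem Link.transGen_hb (h : Link G s) (hs : WF s) (hb : ∀ t, (s.loc t).buf = []) {m n : Node T} :
    Relation.TransGen G.hb m n ↔ Relation.TransGen (HB s) m n := by
  have hp := not_readsPending hs hb
  constructor
  · refine Relation.TransGen.mono ?_ m n
    rintro ⟨t, j⟩ ⟨u, k⟩ (h1 | h1 | h1 | h1)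
    · obtain ⟨h2, h3, h4, h5⟩ := h1
      simp only at h4 h5
      subst h4
      refine .po t j k (by omega) ?_
      rw [← h.length hs]; exact h3
    · obtain ⟨_, _, _, h2⟩ := (h.st _ _).1 h1
      exact .pred _ _ _ h2 rfl
    · obtain ⟨_, _, _, h2⟩ := (h.src _ _ (hp _)).1 h1
      exact .pred _ _ _ h2 rfl
    · obtain ⟨t', t'', a, v, v', h2, h3, h4⟩ := h1
      obtain ⟨o, h5⟩ := h.label_eq.1 h2
      obtain ⟨o', h6⟩ := h.label_eq.1 h3
      -- The two alternatives of the trace's conflict relation, a common predecessor or none for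
      -- either node, say together that the recorded predecessors coincide.
      have : o' = o := by
        rcases h4 with ⟨p, h7, h8⟩ | ⟨h7, h8⟩
        · obtain ⟨_, _, _, h9⟩ := (h.src _ _ (hp _)).1 h7
          obtain ⟨_, _, _, h10⟩ := (h.st _ _).1 h8
          rw [h5] at h9; rw [h6] at h10
          cases h9; cases h10; rfl
        · have h9 : o = none := by
            cases o with
            | none => rfl
            | some p => exact absurd ((h.src _ _ (hp _)).2 ⟨_, _, _, h5⟩) (h7 p)
          have h10 : o' = none := by
            cases o' with
            | none => rfl
            | some p => exact absurd ((h.st _ _).2 ⟨_, _, _, h6⟩) (h8 p)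
          rw [h9, h10]
      subst this
      exact .cf _ _ _ _ _ _ _ _ h5 h6
  · intro hmn
    refine Relation.TransGen.trans_induction_on hmn (fun {a b} hab => ?_)
      (fun _ _ h1 h2 => h1.trans h2)
    cases hab with
    | po t j k hj hk =>
      refine Relation.TransGen.mono (fun _ _ h' => .inl h') _ _ (Trace.transGen_po.2 ⟨rfl, hj, ?_⟩)
      rw [h.length hs]; exact hk
    | pred _ _ r hr hp' =>
      obtain ⟨act, p⟩ := r
      obtain rfl : p = some _ := hp'
      cases act with
      | issue => have := hs.issue _ _ _ hr; cases this
      | loc => have := hs.loc_pred _ _ _ hr; cases this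
      | load => exact .single (.inr (.inr (.inl ((h.src _ _ (hp _)).2 ⟨_, _, _, hr⟩))))
      | store => exact .single (.inr (.inl ((h.st _ _).2 ⟨_, _, _, hr⟩)))
    | cf _ _ t t' a v v' o hm hn =>
      refine .single (.inr (.inr (.inr ⟨t, t', a, v, v', h.label_eq.2 ⟨_, hm⟩,
        h.label_eq.2 ⟨_, hn⟩, ?_⟩)))
      cases o with
      | some p =>
        exact .inl ⟨p, (h.src _ _ (hp _)).2 ⟨_, _, _, hm⟩, (h.st _ _).2 ⟨_, _, _, hn⟩⟩
      | none =>
        refine .inr ⟨fun p h0 => ?_, fun p h0 => ?_⟩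
        · obtain ⟨_, _, _, h1⟩ := (h.src _ _ (hp _)).1 h0
          rw [hm] at h1; cases h1
        · obtain ⟨_, _, _, h1⟩ := (h.st _ _).1 h0
          rw [hn] at h1; cases h1

end

section

variable {T L R D : Type*} [Zero D] {P : Program T L R D}

/-! ### Sequential consistency -/

def GState.scErase (s : GState T L R D) : SCState T L R D where
  pc := fun t => (s.loc t).pc
  reg := fun t => (s.loc t).reg
  mem := fun a => (s.mem a).1

theorem scErase_update (s : GState T L R D) (t : T) (ℓ : LocalState T L R D) (m) :
    (GState.mk (Function.update s.loc t ℓ) m).scErase =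
      { pc := Function.update s.scErase.pc t ℓ.pc
        reg := Function.update s.scErase.reg t ℓ.reg
        mem := fun a => (m a).1 } := by
  simp only [GState.scErase, SCState.mk.injEq]
  refine ⟨?_, ?_, trivial⟩ <;>
  · funext u
    by_cases hu : u = t
    · subst hu; simp
    · simp [Function.update_of_ne hu]

theorem SCRun.snoc {s s' s'' : SCState T L R D} {σ x} (h : SCRun P s σ s') (hx : SCStep P s' x s'') :
    SCRun P s (σ ++ x) s'' := by
  induction h with
  | nil s => simpa using SCRun.cons hx (.nil _)
  | cons h _ ih => rw [List.append_assoc]; exact .cons h (ih hx)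

@[simp] theorem acts_append (w w' : List (Lab T L R D)) : acts (w ++ w') = acts w ++ acts w' :=
  List.map_append

/-- Between SC steps all buffers are empty, and a store instruction becomes an issue and its flush.
Every step acts on the last node of its thread, which has no outgoing edges, so no cycle can arise.
-/
theorem SCStep.toGRun {s : GState T L R D} {x u} (h : SCStep P s.scErase x u) (hs : WF s)
    (hb : ∀ t, (s.loc t).buf = []) (hc : ¬ Cyclic s) :
    ∃ w s', GRun P s w s' ∧ acts w = x ∧ (∀ t, (s'.loc t).buf = []) ∧ s'.scErase = u ∧
      ¬ Cyclic s' := by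
  have key : ∀ {t act i acc ρ p}, Exec P t (s.loc t) act i acc ρ [] p → acc.Ok s.mem s.mem →
      u = (s.afterExec t i.dst ρ [] ⟨act, p⟩).scErase → x = [act] →
      ∃ w s', GRun P s w s' ∧ acts w = x ∧ (∀ t, (s'.loc t).buf = []) ∧ s'.scErase = u ∧
      ¬ Cyclic s' := by
    intro t act i acc ρ p he hm hu hx
    have hst := GStep.exec he hm
    refine ⟨[_], _, gRun_cons.2 ⟨_, hst, gRun_nil.2 rfl⟩, by simp [acts, hx], fun t' => ?_,
      hu.symm, ?_⟩
    · rw [afterExec_buf]; split_ifs <;> simp [hb]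
    · intro hc'
      refine hc (hc'.of_no_out (hst.no_out hs ?_) fun a b h ha hb => h.of_step hst hs ha hb)
      simp [Lab.thread, he.thread_eq, afterExec_len]
  cases h with
  | load t i r e a v hi hpc hinst ha hv =>
    refine key (.read i r e a (s.mem a) hi hpc hinst ha (by simp [hb])) ⟨rfl, rfl⟩ ?_ ?_
    · rw [GState.afterExec, scErase_update, hv]; rfl
    · rw [hv]; rfl
  | store t i ea ev a v hi hpc hinst ha hv =>
    have he : Exec P t (s.loc t) _ i _ _ _ _ := .issue i ea ev hi hpc hinst
    have h1 := GStep.exec he rfl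
    have hw := h1.wf hs
    have hbuf : ((s.afterExec t i.dst (s.loc t).reg [((s.loc t).len, ea.eval (s.loc t).reg,
      ev.eval (s.loc t).reg)] ⟨.issue t, none⟩).loc t).buf =
        ((s.loc t).len, ea.eval (s.loc t).reg, ev.eval (s.loc t).reg) :: [] := by
      rw [afterExec_buf]; simp [hb]
    have h2 := GStep.flush (P := P) hbuf
    refine ⟨[_, _], _, gRun_cons.2 ⟨_, h1, gRun_cons.2 ⟨_, h2, gRun_nil.2 rfl⟩⟩, ?_,
      fun t' => ?_, ?_, ?_⟩
    · simp only [acts, List.map_cons, List.map_nil, ha, hv]; rfl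
    · rw [afterFlush_buf, afterExec_buf]; split_ifs <;> simp [hb]
    · rw [ha, hv]
      simp only [GState.afterFlush, scErase_update]
      simp only [GState.afterExec, scErase_update]
      simp only [Function.update_self, LocalState.push, LocalState.pop, Function.update_idem,
        SCState.mk.injEq]
      refine ⟨trivial, Function.update_eq_self t s.scErase.reg, ?_⟩
      funext b
      by_cases hba : b = ea.eval (s.loc t).reg
      · simp [hba, GState.scErase]
      · simp [hba, GState.scErase]
    · intro hc'
      have hc1 := hc'.of_no_out (h2.no_out hw (by simp [Lab.thread, Action.thread, afterFlush_len,
        afterExec_len])) fun a b h ha hb => h.of_step h2 hw ha hb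
      exact hc (hc1.of_no_out (h1.no_out hs (by simp [Lab.thread, Action.thread, afterExec_len]))
        fun a b h ha hb => h.of_step h1 hs ha hb)
  | mfence t i hi hpc hinst =>
    refine key (.internal i _ hi hpc (.inl ⟨hinst, hb t, rfl⟩)) rfl ?_ rfl
    rw [GState.afterExec, scErase_update]
    simp only [LocalState.push, SCState.mk.injEq]
    exact ⟨trivial, (Function.update_eq_self t s.scErase.reg).symm, rfl⟩
  | assign t i r e hi hpc hinst =>
    refine key (.internal i _ hi hpc (.inr (.inl ⟨r, e, hinst, rfl⟩))) rfl ?_ rfl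
    rw [GState.afterExec, scErase_update]; rfl
  | assertion t i e hi hpc hinst he =>
    refine key (.internal i _ hi hpc (.inr (.inr ⟨e, hinst, he, rfl⟩))) rfl ?_ rfl
    rw [GState.afterExec, scErase_update]
    simp only [LocalState.push, SCState.mk.injEq]
    exact ⟨trivial, (Function.update_eq_self t s.scErase.reg).symm, rfl⟩

theorem SCRun.toGRun {u u' : SCState T L R D} {σ} (h : SCRun P u σ u') :
    ∀ s : GState T L R D, s.scErase = u → WF s → (∀ t, (s.loc t).buf = []) → ¬ Cyclic s →
      ∃ w s', GRun P s w s' ∧ acts w = σ ∧ (∀ t, (s'.loc t).buf = []) ∧ ¬ Cyclic s' := by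
  induction h with
  | nil u => rintro s rfl hs hb hc; exact ⟨[], s, rfl, rfl, hb, hc⟩
  | cons h _ ih =>
    rintro s rfl hs hb hc
    obtain ⟨w, s', h1, rfl, h3, h4, h5⟩ := h.toGRun hs hb hc
    obtain ⟨w', s'', h6, rfl, h7, h8⟩ := ih s' h4 (h1.wf hs) h3 h5
    exact ⟨w ++ w', s'', gRun_append.2 ⟨s', h1, h6⟩, acts_append w w', h7, h8⟩

/-- Every SC computation comes from a run without delays, and its trace is acyclic. -/
theorem exists_run_of_sc {σ} (h : σ ∈ scComputations P) :
    ∃ w s, GRun P (GState.initial P) w s ∧ acts w = σ ∧ (∀ t, (s.loc t).buf = []) ∧ ¬ Cyclic s := by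
  obtain ⟨u, hu⟩ := h
  exact hu.toGRun (GState.initial P) rfl WF.initial (fun _ => rfl) not_cyclic_initial

theorem mem_tsoComputations {τ : List (Action T D)} : τ ∈ tsoComputations P ↔
    ∃ w s, GRun P (GState.initial P) w s ∧ acts w = τ ∧ ∀ t, (s.loc t).buf = [] := by
  constructor
  · rintro ⟨w, ⟨u, hu, hb⟩, rfl⟩
    obtain ⟨w', s', rfl, h2, rfl⟩ := hu.toGRun (GState.initial P) rfl
    refine ⟨w', s', h2, by simp [acts], fun t => ?_⟩
    simpa [GState.erase] using hb t
  · rintro ⟨w, s, h1, rfl, h2⟩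
    exact ⟨w.map Lab.ev, ⟨s.erase, h1.toTSO, fun t => by simp [GState.erase, h2]⟩, by simp [acts]⟩

/-- An instruction that is executed with empty buffer, and does not issue a store, is an SC step. -/
theorem Exec.toSC {s : GState T L R D} {t act i acc ρ β p} (h : Exec P t (s.loc t) act i acc ρ β p)
    (hm : acc.Ok s.mem s.mem) (hb : (s.loc t).buf = []) (hne : act ≠ .issue t) :
    β = [] ∧ SCStep P s.scErase [act] (s.afterExec t i.dst ρ β ⟨act, p⟩).scErase := by
  rw [GState.afterExec, scErase_update]
  cases h with
  | early _ r e k a v γ hi hpc hinst ha hbuf => rw [hb] at hbuf; simp at hbuf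
  | read _ r e a c hi hpc hinst ha hbuf =>
    refine ⟨rfl, SCStep.load s.scErase t i r e a c.1 hi hpc hinst ha ?_⟩
    rw [← hm.1]; rfl
  | issue => exact absurd rfl hne
  | internal _ ρ hi hpc hinst =>
    refine ⟨rfl, ?_⟩
    rcases hinst with ⟨h1, h2, rfl⟩ | ⟨r, e, h1, rfl⟩ | ⟨e, h1, h2, rfl⟩
    · have := SCStep.mfence s.scErase t i hi hpc h1
      rwa [← Function.update_eq_self t s.scErase.reg] at this
    · exact SCStep.assign s.scErase t i r e hi hpc h1
    · have := SCStep.assertion s.scErase t i e hi hpc h1 h2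
      rwa [← Function.update_eq_self t s.scErase.reg] at this

/-! ### Runs without costs and their SC counterparts. -/

/-- `s'` is `s` without the pending issues. -/
def Postponed (P : Program T L R D) (s s' : GState T L R D) : Prop :=
  s'.mem = s.mem ∧ ∀ t, ((s.loc t).buf = [] ∧ s'.loc t = s.loc t) ∨
    ((s'.loc t).buf = [] ∧ ∃ i ea ev, i ∈ P.code t ∧ (s'.loc t).pc = i.src ∧
      i.inst = .store ea ev ∧
      s.loc t = (s'.loc t).push i.dst (s'.loc t).reg
        [((s'.loc t).len, ea.eval (s'.loc t).reg, ev.eval (s'.loc t).reg)] ⟨.issue t, none⟩)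

/-- Cost zero means that each instruction finds the buffer of its thread empty, so the step of a
thread after an issue can only be the matching store. Each issue is postponed until just before its
store, and the pair forms one SC step. -/
theorem exists_sc_of_cost_zero {w} {s : GState T L R D} (h : GRun P (GState.initial P) w s)
    (hw : ∀ x ∈ w, x.cost = 0) : ∃ w' s', GRun P (GState.initial P) w' s' ∧ Postponed P s s' ∧
      SCRun P (SCState.initial P) (acts w') s'.scErase := by
  induction w using List.reverseRecOn generalizing s with
  | nil => obtain rfl := h; exact ⟨[], _, rfl, ⟨rfl, fun t => .inl ⟨rfl, rfl⟩⟩, .nil _⟩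
  | append_singleton w x ih =>
    obtain ⟨u, h1, h2⟩ := gRun_snoc.1 h
    obtain ⟨w', u', h3, ⟨h4, h5⟩, h6⟩ := ih h1 (fun y hy => hw y (by simp [hy]))
    have hc := hw x (by simp)
    rcases h2.view with ⟨t, act, i, acc, ρ, β, p, he, hm, rfl, rfl⟩ | ⟨t, k, a, v, β, hb, rfl, rfl⟩
    · have hb : (u.loc t).buf = [] := List.eq_nil_of_length_eq_zero hc
      have hl : u'.loc t = u.loc t := by
        rcases h5 t with h0 | ⟨-, i, ea, ev, -, -, -, h0⟩
        · exact h0.2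
        · rw [h0] at hb; simp [LocalState.push] at hb
      by_cases ha : act = .issue t
      · subst ha
        refine ⟨w', u', h3, ⟨h4, fun t' => ?_⟩, h6⟩
        by_cases ht : t' = t
        · subst ht
          right
          rw [hl]
          cases he with
          | issue _ ea ev hi hpc hinst =>
            exact ⟨hb, i, ea, ev, hi, hpc, hinst, by simp [GState.afterExec]⟩
        · simpa [GState.afterExec, ht] using h5 t'
      · have he' : Exec P t (u'.loc t) act i acc ρ β p := by rw [hl]; exact he
        have hm' : acc.Ok u'.mem u'.mem := by rw [h4]; exact hm
        obtain ⟨rfl, hsc⟩ := he'.toSC hm' (by rw [hl, hb]) ha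
        refine ⟨w' ++ [_], _, gRun_snoc.2 ⟨u', h3, .exec he' hm'⟩, ⟨h4, fun t' => ?_⟩, ?_⟩
        · by_cases ht : t' = t
          · subst ht
            left
            simp [GState.afterExec, hl, LocalState.push, hb]
          · simpa [GState.afterExec, ht] using h5 t'
        · rw [acts_append]; exact h6.snoc hsc
    · rcases h5 t with ⟨h0, -⟩ | ⟨h7, i, ea, ev, hi, hpc, hinst, h8⟩
      · rw [hb] at h0; cases h0
      · rw [h8] at hb
        simp only [LocalState.push, h7, List.nil_append, List.cons.injEq, Prod.mk.injEq] at hb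
        obtain ⟨⟨rfl, rfl, rfl⟩, rfl⟩ := hb
        have he' : Exec P t (u'.loc t) _ i _ _ _ _ := .issue i ea ev hi hpc hinst
        have h9 := GStep.exec he' rfl
        have h10 := GStep.flush (P := P) (s := u'.afterExec t i.dst (u'.loc t).reg
          [((u'.loc t).len, ea.eval (u'.loc t).reg, ev.eval (u'.loc t).reg)] ⟨.issue t, none⟩)
          (t := t) (k := (u'.loc t).len) (a := ea.eval (u'.loc t).reg)
          (v := ev.eval (u'.loc t).reg) (β := []) (by simp [afterExec_buf, h7])
        refine ⟨w' ++ [_, _], _, gRun_append.2 ⟨u', h3, gRun_cons.2 ⟨_, h9, gRun_cons.2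
          ⟨_, h10, gRun_nil.2 rfl⟩⟩⟩, ⟨?_, fun t' => ?_⟩, ?_⟩
        · simp [GState.afterFlush, GState.afterExec, h4]
        · by_cases ht : t' = t
          · subst ht
            left
            simp [GState.afterFlush, GState.afterExec, LocalState.pop, h8, h4]
          · simpa [GState.afterExec, GState.afterFlush, ht] using h5 t'
        · rw [acts_append]
          refine h6.snoc ?_
          have hsc := SCStep.store u'.scErase t i ea ev _ _ hi hpc hinst rfl rfl
          refine cast (congrArg (SCStep P u'.scErase _) ?_) hsc
          refine Eq.symm ?_
          rw [GState.afterFlush, scErase_update, GState.afterExec, scErase_update]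
          simp only [Function.update_self, LocalState.push, LocalState.pop, Function.update_idem,
            SCState.mk.injEq]
          refine ⟨trivial, Function.update_eq_self t u'.scErase.reg, ?_⟩
          funext b
          by_cases hba : b = ea.eval (u'.loc t).reg
          · subst hba; simp [GState.scErase]
          · simp [hba, GState.scErase]

/-- A run without costs to a state with empty buffers has the trace of an SC computation. -/
theorem trace_mem_sc_of_cost_zero {w} {s : GState T L R D} (h : GRun P (GState.initial P) w s)
    (hw : ∀ x ∈ w, x.cost = 0) (hb : ∀ t, (s.loc t).buf = []) :
    ∃ σ ∈ scComputations P, ∀ w', GRun P (GState.initial P) w' s →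
      traceOf σ = traceOf (acts w') := by
  obtain ⟨w', s', h1, ⟨h2, h3⟩, h4⟩ := exists_sc_of_cost_zero h hw
  have : s' = s := by
    have : s'.loc = s.loc := by
      funext t
      rcases h3 t with h0 | ⟨-, i, ea, ev, -, -, -, h0⟩
      · exact h0.2
      · have := hb t
        rw [h0] at this; simp [LocalState.push] at this
    cases s; cases s'; simp_all
  subst this
  exact ⟨acts w', ⟨_, h4⟩, fun w'' h5 => h1.link.unique h5.link (h.wf WF.initial) hb⟩

theorem exists_first {α : Type*} (p : α → Prop) (w : List α) : (∀ z ∈ w, ¬ p z) ∨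
    ∃ w₁ y w₂, w = w₁ ++ y :: w₂ ∧ p y ∧ ∀ z ∈ w₁, ¬ p z := by
  induction w with
  | nil => left; simp
  | cons x w ih =>
    by_cases hx : p x
    · exact .inr ⟨[], x, w, rfl, hx, by simp⟩
    · rcases ih with ih | ⟨w₁, y, w₂, rfl, h1, h2⟩
      · left; simpa [hx] using ih
      · exact .inr ⟨x :: w₁, y, w₂, rfl, h1, by simpa [hx] using h2⟩

/-- Every complete run can be replaced by a run without costs, or there is a violation. -/
theorem exists_cost_zero_or_cyclic {w} {s : GState T L R D} (h : GRun P (GState.initial P) w s)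
    (hb : ∀ t, (s.loc t).buf = []) :
    (∃ w', GRun P (GState.initial P) w' s ∧ ∀ x ∈ w', x.cost = 0) ∨
      ∃ w' s', GRun P (GState.initial P) w' s' ∧ Cyclic s' := by
  -- The run is replaced by a cheapest one to the same final state; that state alone determines the
  -- trace.
  obtain ⟨w, hw, hmin⟩ : ∃ w, GRun P (GState.initial P) w s ∧
      ∀ w', GRun P (GState.initial P) w' s → totalCost w ≤ totalCost w' :=
    let S : Set (List (Lab T L R D)) := {w | GRun P (GState.initial P) w s}
    ⟨_, Function.argminOn_mem totalCost S ⟨w, h⟩,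
      fun w' h' => Function.argminOn_le totalCost S h'⟩
  rcases exists_last (fun z => 0 < z.cost) w with h0 | ⟨A, z, B, rfl, hz, hB⟩
  · exact .inl ⟨w, hw, fun x hx => Nat.eq_zero_of_not_pos (h0 x hx)⟩
  right
  obtain ⟨u, h1, u₁, h2, h3⟩ := gRun_append.1 hw
  have hu := h1.wf WF.initial
  have hzs : z.isStore = false := by
    by_contra hst
    rw [Bool.not_eq_false] at hst
    obtain ⟨a, v, β, h4, -⟩ := h2.of_store hst
    rw [h4] at hz; simp at hz
  obtain ⟨-, h4, -, -, -, β, h5, -⟩ := h2.of_nonstore hzs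
  have hne : (u₁.loc z.thread).buf ≠ [] := by
    rw [h5]
    intro h0
    rw [(List.append_eq_nil_iff.1 h0).1] at h4
    simp at h4; omega
  -- Since `z` leaves a nonempty buffer and the final one is empty, its thread acts again. Its next
  -- step is a store, because an instruction would have positive cost and `z` is the last step with
  -- positive cost.
  rcases exists_first (fun y => y.thread = z.thread) B with h0 | ⟨B₁, x, B₂, rfl, hx, hB₁⟩
  · exact absurd (by rw [← h3.loc_of_ne h0, hb]) hne
  obtain ⟨u₂, h6, u₃, h7, h8⟩ := gRun_append.1 h3
  have hxs : x.isStore = true := by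
    by_contra hst
    rw [Bool.not_eq_true] at hst
    have h9 := (h7.of_nonstore hst).2.1
    rw [hx, h6.loc_of_ne hB₁] at h9
    refine hB x (by simp) ?_
    rw [h9]
    exact List.length_pos_iff.2 hne
  have hr : GRun P u (z :: (B₁ ++ [x])) u₃ := ⟨u₁, h2, gRun_snoc.2 ⟨u₂, h6, h7⟩⟩
  rcases hr.undelay hu hx.symm with ⟨w', h9, h10, h11⟩ | ⟨U, z', C, h9, h10, -, -, -, -, h12⟩
  · have := hmin (A ++ (w' ++ B₂)) (gRun_append.2 ⟨u, h1, gRun_append.2 ⟨u₃, h9, h8⟩⟩)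
    simp at this h11
    omega
  · have h13 := (hr.overtaken hu hzs hz hx.symm (by rwa [hx]) hxs).2.1
    rw [← h10.node] at h13
    exact ⟨_, u₃, gRun_append.2 ⟨u, h1, h9⟩, _, Relation.TransGen.tail'
      (Relation.ReflTransGen.mono (fun _ _ h' => h'.1) _ _ (h12 x (by simp))) h13⟩

/-- A program that is not robust has a violation. -/
theorem exists_cyclic_of_not_robust (h : ¬ Robust P) :
    ∃ w s, GRun P (GState.initial P) w s ∧ Cyclic s := by
  by_contra hno
  apply h
  apply Set.Subset.antisymm
  · rintro _ ⟨τ, hτ, rfl⟩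
    obtain ⟨w, s, h1, rfl, h2⟩ := mem_tsoComputations.1 hτ
    rcases exists_cost_zero_or_cyclic h1 h2 with ⟨w', h3, h4⟩ | h3
    · obtain ⟨σ, h5, h6⟩ := trace_mem_sc_of_cost_zero h3 h4 h2
      exact ⟨σ, h5, h6 w h1⟩
    · exact absurd h3 hno
  · rintro _ ⟨σ, hσ, rfl⟩
    obtain ⟨w, s, h1, rfl, h2, -⟩ := exists_run_of_sc hσ
    exact ⟨_, mem_tsoComputations.2 ⟨w, s, h1, rfl, h2⟩, rfl⟩

/-- The happens-before relation of the TSO traces of a robust program is acyclic. -/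
theorem Robust.acyclic (h : Robust P) {τ} (hτ : τ ∈ tsoComputations P) (n : Node T) :
    ¬ Relation.TransGen (traceOf τ).hb n n := by
  obtain ⟨σ, hσ, he⟩ : traceOf τ ∈ traceOf '' scComputations P := by
    rw [← h]; exact ⟨τ, hτ, rfl⟩
  obtain ⟨w, s, h1, rfl, h2, h3⟩ := exists_run_of_sc hσ
  rw [← he, h1.link.transGen_hb (h1.wf WF.initial) h2]
  exact fun hn => h3 ⟨n, hn⟩

/-- The happens-before condition of a witness includes the load itself, so the load would lie on a
cycle of a TSO trace. -/
theorem Robust.not_feasible (h : Robust P) (A : Attack T L R D) : ¬ Feasible P A := by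
  rintro ⟨-, w₁, w₂, w₃, w₄, a, v, b, u, hw⟩
  have := hw.happensBefore [] (.load A.attacker b u) (w₃.map Event.act ++ [.store A.attacker a v])
    (by simp)
  exact h.acyclic ⟨_, hw.execution, rfl⟩ _ (by simpa using this)

end

section

variable {T L R D : Type*} [Zero D] {P : Program T L R D}

/-! ### Matching issues and stores -/

/-- The number of issues of a thread. -/
noncomputable def issueCount (t : T) (τ : List (Action T D)) : ℕ :=
  τ.countP (fun x => decide (x.thread = t) && x.isIssue)

/-- The number of stores of a thread. -/
noncomputable def storeCount (t : T) (τ : List (Action T D)) : ℕ :=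
  τ.countP (fun x => decide (x.thread = t) && x.isStore)

@[simp] theorem issueCount_nil (t : T) : issueCount t ([] : List (Action T D)) = 0 := rfl

@[simp] theorem storeCount_nil (t : T) : storeCount t ([] : List (Action T D)) = 0 := rfl

@[simp] theorem issueCount_cons (t : T) (x : Action T D) (τ) : issueCount t (x :: τ) =
    issueCount t τ + if x.thread = t ∧ x.isIssue = true then 1 else 0 := by
  simp [issueCount, List.countP_cons]

@[simp] theorem storeCount_cons (t : T) (x : Action T D) (τ) : storeCount t (x :: τ) =
    storeCount t τ + if x.thread = t ∧ x.isStore = true then 1 else 0 := by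
  simp [storeCount, List.countP_cons]

@[simp] theorem issueCount_append (t : T) (τ τ' : List (Action T D)) :
    issueCount t (τ ++ τ') = issueCount t τ + issueCount t τ' := List.countP_append

@[simp] theorem storeCount_append (t : T) (τ τ' : List (Action T D)) :
    storeCount t (τ ++ τ') = storeCount t τ + storeCount t τ' := List.countP_append

theorem storeCount_eq_zero {t : T} {τ : List (Action T D)} (h : ∀ x ∈ τ, x.thread ≠ t) :
    storeCount t τ = 0 := by
  simp only [storeCount, List.countP_eq_zero]; intro x hx; simp [h x hx]

@[simp] theorem acts_nil : acts ([] : List (Lab T L R D)) = [] := rfl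

@[simp] theorem acts_cons (x : Lab T L R D) (w) : acts (x :: w) = x.ev.act :: acts w := rfl

theorem Exec.buf_length {t ℓ act i acc ρ β p} (h : Exec P t ℓ act i acc ρ β p) :
    β.length = if act.isIssue = true then 1 else 0 := by
  cases h <;> rfl

/-- With first-in-first-out buffers this invariant turns the matching of issues and stores by
position into one by counting. -/
theorem GRun.issueCount_eq {w} {s : GState T L R D} (h : GRun P (GState.initial P) w s) (t : T) :
    issueCount t (acts w) = storeCount t (acts w) + (s.loc t).buf.length := by
  induction w using List.reverseRecOn generalizing s with
  | nil => obtain rfl := h; rfl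
  | append_singleton w x ih =>
    obtain ⟨u, h1, h2⟩ := gRun_snoc.1 h
    have := ih h1
    rcases h2.view with ⟨t', act, i, acc, ρ, β, p, he, hm, rfl, rfl⟩ |
      ⟨t', k, a, v, β, hb, rfl, rfl⟩
    · rw [afterExec_buf]
      have h3 := he.thread_eq
      have h4 := he.not_store
      have h5 := he.buf_length
      by_cases ht : t = t'
      · subst ht
        simp [acts_append, this, h3, h4, h5]; omega
      · simp [acts_append, this, h3, h4, ht, Ne.symm ht]
    · rw [afterFlush_buf]
      by_cases ht : t = t'
      · subst ht
        simp [acts_append, this, hb, Action.thread, Action.isStore, Action.isIssue]; omega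
      · simp [acts_append, this, Action.thread, ht, Ne.symm ht]

/-- Every buffered store was issued, and buffers are first-in-first-out. -/
theorem GRun.exists_issue {w} {s : GState T L R D} (h : GRun P (GState.initial P) w s) {t : T}
    {β₁ k a v β₂} (hb : (s.loc t).buf = β₁ ++ (k, a, v) :: β₂) :
    ∃ w₁ y w₂ i, w = w₁ ++ y :: w₂ ∧ y.ev = ⟨.issue t, some i⟩ ∧ y.idx = k ∧ i ∈ P.code t ∧
      (∃ ea ev, i.inst = .store ea ev) ∧
      issueCount t (acts w₁) = storeCount t (acts w) + β₁.length := by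
  induction w using List.reverseRecOn generalizing s β₁ β₂ with
  | nil => obtain rfl := h; simp [GState.initial] at hb
  | append_singleton w x ih =>
    obtain ⟨u, h1, h2⟩ := gRun_snoc.1 h
    have old : ∀ {β₃ β₄}, (u.loc t).buf = β₃ ++ (k, a, v) :: β₄ →
        β₃.length = storeCount t [x.ev.act] + β₁.length →
        ∃ w₁ y w₂ i, w ++ [x] = w₁ ++ y :: w₂ ∧ y.ev = ⟨.issue t, some i⟩ ∧ y.idx = k ∧
          i ∈ P.code t ∧ (∃ ea ev, i.inst = .store ea ev) ∧
          issueCount t (acts w₁) = storeCount t (acts (w ++ [x])) + β₁.length := by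
      intro β₃ β₄ h3 h4
      obtain ⟨w₁, y, w₂, j, rfl, h5, h6, h7, h8, h9⟩ := ih h1 h3
      refine ⟨w₁, y, w₂ ++ [x], j, by simp, h5, h6, h7, h8, ?_⟩
      rw [h9, h4, acts_append (w₁ ++ y :: w₂), storeCount_append, add_assoc]; rfl
    rcases h2.view with ⟨t', act, i, acc, ρ, β, p, he, hm, rfl, rfl⟩ |
      ⟨t', k', a', v', β, hb', rfl, rfl⟩
    · have h3 := he.thread_eq
      have h4 := he.not_store
      rw [afterExec_buf] at hb
      by_cases ht : t = t'
      · subst ht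
        rw [if_pos rfl] at hb
        have h5 := h1.issueCount_eq t
        cases he with
        | issue _ ea ev hi hpc hinst =>
          rcases List.append_eq_append_iff.1 hb with ⟨δ, h6, h7⟩ | ⟨δ, h6, h7⟩
          · cases δ with
            | nil =>
              simp only [List.nil_append, List.append_nil] at h6 h7
              refine ⟨w, _, [], i, rfl, rfl, by simp_all, hi, ⟨ea, ev, hinst⟩, ?_⟩
              rw [h5, h6]; simp [acts_append, h4]
            | cons c δ =>
              have := congrArg List.length h7
              simp at this
          · cases δ with
            | nil =>
              simp only [List.nil_append, List.append_nil] at h6 h7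
              refine ⟨w, _, [], i, rfl, rfl, by simp_all, hi, ⟨ea, ev, hinst⟩, ?_⟩
              rw [h5, h6]; simp [acts_append, h4]
            | cons c δ =>
              obtain ⟨rfl, -⟩ := List.cons.inj h7
              exact old h6 (by simp [h4])
        | _ => rw [List.append_nil] at hb; exact old hb (by simp [h4])
      · rw [if_neg ht] at hb
        exact old hb (by simp [h4])
    · rw [afterFlush_buf] at hb
      by_cases ht : t = t'
      · subst ht
        rw [if_pos rfl] at hb
        exact old (β₃ := (k', a', v') :: β₁) (by rw [hb', hb]; rfl)
          (by simp [Action.thread, Action.isStore]; omega)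
      · rw [if_neg ht] at hb
        exact old hb (by simp [Action.thread, Ne.symm ht])

/-- Two positions with the same number of preceding issues. -/
theorem eq_of_issueCount_eq {t : T} {α β α' β' : List (Action T D)}
    (h : α ++ .issue t :: β = α' ++ .issue t :: β') (hc : issueCount t α = issueCount t α') :
    α = α' ∧ β = β' := by
  rcases List.append_eq_append_iff.1 h with ⟨δ, rfl, h1⟩ | ⟨δ, rfl, h1⟩ <;>
  · cases δ with
    | nil => simp_all
    | cons x δ =>
      obtain ⟨rfl, -⟩ := List.cons.inj h1
      simp [Action.thread, Action.isIssue] at hc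

/-- If `α'` reached beyond the displayed issue, it would contain at least one issue more than `α`.
-/
theorem length_le_of_issueCount_le {t : T} {α β α' β' : List (Action T D)}
    (h : α ++ .issue t :: β = α' ++ β') (hc : issueCount t α' ≤ issueCount t α) :
    α'.length ≤ α.length := by
  rcases List.append_eq_append_iff.1 h with ⟨δ, rfl, h1⟩ | ⟨δ, rfl, h1⟩
  · cases δ with
    | nil => simp
    | cons x δ =>
      obtain ⟨rfl, -⟩ := List.cons.inj h1
      simp [Action.thread, Action.isIssue] at hc
  · simp

theorem acts_eq_append {w : List (Lab T L R D)} {α β} (h : acts w = α ++ β) :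
    ∃ w₁ w₂, w = w₁ ++ w₂ ∧ acts w₁ = α ∧ acts w₂ = β := by
  obtain ⟨w₁, w₂, h1, h2, h3⟩ := List.map_eq_append_iff.1 h
  exact ⟨w₁, w₂, h1, h2, h3⟩

theorem acts_eq_cons {w : List (Lab T L R D)} {x β} (h : acts w = x :: β) :
    ∃ y w', w = y :: w' ∧ y.ev.act = x ∧ acts w' = β := by
  obtain ⟨y, w', h1, h2, h3⟩ := List.map_eq_cons_iff.1 h
  exact ⟨y, w', h1, h2, h3⟩

/-- A clean store is not separated from its issue by actions of its thread. -/
theorem Clean.not_delayed {u s' : GState T L R D} {x ρ} (hc : Clean ρ x)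
    (h : GRun P (GState.initial P) ρ u) (hx : GStep P u x s') (hst : x.isStore = true)
    {α β : List (Action T D)} (he : acts ρ = α ++ .issue x.thread :: β)
    (hn : issueCount x.thread α = storeCount x.thread (α ++ β)) : ∀ z ∈ β, z.thread ≠ x.thread := by
  obtain ⟨ρ₁, y, ρ₂, rfl, h1, h2, h3, h4⟩ := hc
  obtain ⟨s₁, h5, s₂, hy, hr⟩ := gRun_append.1 h
  have ht : y.thread = x.thread := congrArg Prod.fst h3
  obtain ⟨-, h6, -, -, -, γ, h7, h8⟩ := hy.of_nonstore h1
  rw [ht] at h6 h7 h8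
  have hb : (s₁.loc x.thread).buf = [] := List.eq_nil_of_length_eq_zero (h6.symm.trans h2)
  have hyi : y.ev.act = .issue x.thread := by
    rcases h8 with rfl | ⟨_, _, -, h8, -⟩
    · obtain ⟨a, v, γ, -, h9, rfl⟩ := hx.of_store hst
      rw [hr.loc_of_ne h4, h7, hb] at h9
      simp at h9
    · exact h8
  have h10 := h5.issueCount_eq x.thread
  have h11 : ∀ z ∈ acts ρ₂, z.thread ≠ x.thread := by
    intro z hz
    obtain ⟨c, hc, rfl⟩ := List.mem_map.1 hz
    exact h4 c hc
  have h12 := congrArg (storeCount x.thread) he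
  rw [acts_append, acts_cons, hyi] at he
  rw [acts_append, acts_cons, hyi] at h12
  simp [Action.isStore, storeCount_eq_zero h11] at h12 hn
  rw [hb] at h10
  obtain ⟨-, rfl⟩ := eq_of_issueCount_eq he (by simp at h10; omega)
  exact h11

/-! ### From instrumented attacks to feasible attacks -/

theorem append_cons_eq_append_cons {α : Type*} {A B A' B' : List α} {x y : α}
    (h : A ++ x :: B = A' ++ y :: B') : (∃ C, A = A' ++ y :: C ∧ B' = C ++ x :: B) ∨
      (A = A' ∧ x = y ∧ B = B') ∨ ∃ C, A' = A ++ x :: C ∧ B = C ++ y :: B' := by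
  rcases List.append_eq_append_iff.1 h with ⟨δ, rfl, h1⟩ | ⟨δ, rfl, h1⟩ <;> cases δ <;> simp_all

/-- The store instruction of the attack is the one whose issue put `x` into the buffer. The earlier
stores are clean, hence not delayed, and the stores from `x` on belong to the attacker; this settles
who delays and which store is delayed first. For the happens-before condition, `e` and `x` lie on a
common cycle and `e` reaches all of `B`. -/
theorem GAttack.feasible {A B C : List (Lab T L R D)} {e x : Lab T L R D} {s s' : GState T L R D}
    {i b u} (h : GAttack P A e B x C s s' i b u) :
    ∃ i₀, Feasible P ⟨x.thread, i₀, i⟩ := by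
  obtain ⟨ux, hr, hx⟩ := gRun_snoc.1 (show GRun P (GState.initial P) ((A ++ e :: B) ++ [x]) s by
    convert h.run using 1; simp)
  obtain ⟨a, v, γ, hxe, hb, -⟩ := hx.of_store h.store
  obtain ⟨A₁, y, A₂, i₀, hA, hy, hyx, hi₀, hst, hcount⟩ := hr.exists_issue (β₁ := []) hb
  have het : e.thread = x.thread := by simp [Lab.thread, h.load, Action.thread]
  have hyt : y.thread = x.thread := by rw [Lab.thread, hy]; rfl
  -- The issue of `x` lies before `e`, since `e` is a load and `B` contains no step of the attacker.
  obtain ⟨A₂, rfl⟩ : ∃ A₃, A = A₁ ++ y :: A₃ := by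
    rcases append_cons_eq_append_cons hA with ⟨δ, h1, -⟩ | ⟨-, h1, -⟩ | ⟨δ, -, h1⟩
    · exact ⟨δ, h1⟩
    · rw [← h1, h.load] at hy; cases hy
    · exact absurd hyt (h.no_thread y (by simp [h1]))
  clear hA
  have hev : Attack.events ⟨x.thread, i₀, i⟩ (A₁.map Lab.ev) (A₂.map Lab.ev) (B.map Lab.ev)
      (C.map Lab.ev) a v b u = (((A₁ ++ y :: A₂) ++ e :: (B ++ [x])) ++ C).map Lab.ev := by
    have : x.ev = ⟨.store x.thread a v, none⟩ := congrArg Lab.ev hxe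
    simp [Attack.events, hy, h.load, this]
  have hact : (Attack.events ⟨x.thread, i₀, i⟩ (A₁.map Lab.ev) (A₂.map Lab.ev) (B.map Lab.ev)
      (C.map Lab.ev) a v b u).map Event.act =
      acts (((A₁ ++ y :: A₂) ++ e :: (B ++ [x])) ++ C) := by
    rw [hev, List.map_map]; rfl
  have hmap : ∀ w : List (Lab T L R D), (w.map Lab.ev).map Event.act = acts w :=
    fun w => List.map_map
  have hxa : x.ev.act = .store x.thread a v := congrArg (fun z => z.ev.act) hxe
  have hrun : GRun P (GState.initial P) (((A₁ ++ y :: A₂) ++ e :: (B ++ [x])) ++ C) s' :=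
    gRun_append.2 ⟨s, h.run, h.flush⟩
  have hcount' : issueCount x.thread (acts A₁) =
      storeCount x.thread (acts ((A₁ ++ y :: A₂) ++ e :: B)) := by rw [hcount]; rfl
  have hdelay : ∀ {t α β c z δ}, IsDelayed (acts (((A₁ ++ y :: A₂) ++ e :: (B ++ [x])) ++ C)) t
      α β c z δ → t = x.thread ∧ A₁.length ≤ α.length := by
    rintro t α β c z δ ⟨⟨h1, h2⟩, q, hq, hqt⟩
    have h1' : acts (((A₁ ++ y :: A₂) ++ e :: (B ++ [x])) ++ C) =
        (α ++ .issue t :: β) ++ .store t c z :: δ := by simpa using h1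
    obtain ⟨w₁, w₂, h3, h4, h5⟩ := acts_eq_append h1'
    obtain ⟨f, w₃, rfl, h6, h7⟩ := acts_eq_cons h5
    have hft : f.thread = t := by simp [Lab.thread, h6, Action.thread]
    have h2' : issueCount t α = storeCount t (α ++ β) := h2
    rw [List.append_assoc] at h3
    have hpos : (∃ C', (A₁ ++ y :: A₂) ++ e :: B = w₁ ++ f :: C') ∨
        ∃ δ', w₁ = ((A₁ ++ y :: A₂) ++ e :: B) ++ δ' ∧ f ∈ x :: C := by
      rcases append_cons_eq_append_cons (show ((A₁ ++ y :: A₂) ++ e :: B) ++ x :: C =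
        w₁ ++ f :: w₃ by rw [← h3]; simp) with ⟨C', h8, -⟩ | ⟨rfl, rfl, -⟩ | ⟨C', rfl, rfl⟩
      · exact .inl ⟨C', h8⟩
      · exact .inr ⟨[], by simp, by simp⟩
      · exact .inr ⟨x :: C', by simp, by simp⟩
    rcases hpos with ⟨C', h8⟩ | ⟨δ', rfl, hfx⟩
    -- A store executed before `x` is clean, so no action of its thread separates it from its issue.
    · exfalso
      rw [h8] at hr
      obtain ⟨u₁, h9, u₂, h10, -⟩ := gRun_append.1 hr
      have hfs : f.isStore = true := by simp [Lab.isStore, h6, Action.isStore]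
      have hclean := h.clean w₁ f C' h8 hfs
      subst hft
      exact hclean.not_delayed h9 h10 hfs h4 h2' q hq hqt
    · have hf : t = x.thread := by
        rw [← hft]
        rcases List.mem_cons.1 hfx with rfl | hf
        · rfl
        · obtain ⟨c, v, hc, -⟩ := h.suffix f hf
          rw [Lab.thread, hc]; rfl
      refine ⟨hf, ?_⟩
      subst hf
      -- At least as many stores precede this one as precede `x`, so at least as many issues precede
      -- its issue as precede that of `x`; hence it was not issued before `x`.
      have h9 := congrArg (storeCount x.thread) h4
      rw [acts_append, storeCount_append, ← hcount'] at h9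
      simp [Action.isStore] at h9
      have : (acts A₁).length ≤ α.length := by
        refine length_le_of_issueCount_le (t := x.thread) (β := β ++ .store x.thread c z :: δ)
          (β' := acts (y :: (A₂ ++ e :: (B ++ x :: C)))) ?_ ?_
        · rw [← acts_append]; simpa using h1'.symm
        · rw [h2']; simp; omega
      simpa [acts] using this
  refine ⟨i₀, ⟨hi₀, hst, h.mem, h.inst⟩, A₁.map Lab.ev, A₂.map Lab.ev, B.map Lab.ev, C.map Lab.ev,
    a, v, b, u, ?_, ?_, ?_, ?_, ?_, ?_, ?_, ?_⟩
  · rw [hev]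
    exact ⟨s'.erase, hrun.toTSO, fun t => by simp [GState.erase, h.empty]⟩
  · rw [hact, hmap, hmap, hmap, hmap]
    refine ⟨by simp [acts_append, hy, hxa, h.load], ?_⟩
    refine hcount'.trans ?_
    simp [acts_append, storeCount, hy, h.load, Action.isStore]
  · intro t α β c z δ hd
    rw [hact] at hd
    exact (hdelay hd).1
  · intro α β c z δ hd
    rw [hact] at hd
    simpa using (hdelay hd).2
  · intro z hz
    obtain ⟨z, hz', rfl⟩ := List.mem_map.1 hz
    exact h.no_thread z hz'
  · intro α z δ hz
    rw [hact, hmap, hmap]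
    rw [hmap] at hz
    obtain ⟨w₁, w₂, h1, rfl, h3⟩ := acts_eq_append (w := e :: (B ++ [x])) (α := α) (β := z :: δ)
      (by simpa [acts_append, h.load, hxa] using hz)
    obtain ⟨f, w₃, rfl, rfl, -⟩ := acts_eq_cons h3
    obtain ⟨u₁, h4, h5⟩ := gRun_append.1 h.run
    have hrun' := h.run
    rw [h1, ← List.append_assoc, gRun_append] at hrun'
    obtain ⟨u₂, h6, u₃, h7, -⟩ := hrun'
    obtain ⟨u₄, h8, -⟩ := h5
    have h9 := h4.link.nodeOf (h4.wf WF.initial) h8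
    have h10 := h6.link.nodeOf (h6.wf WF.initial) h7
    have hs := h.run.wf WF.initial
    have h11 : ∀ {m n}, HB s m n → HB s' m n := fun h' => h'.run h.flush hs
    rw [hrun.link.transGen_hb (hrun.wf WF.initial) h.empty]
    -- Prefixing this cycle turns reachability into a path with at least one edge, also for `e`
    -- itself.
    have h12 : Relation.TransGen (HB s) e.node e.node :=
      Relation.TransGen.tail' (h.reach x (by simp)) h.back
    have h13 : Relation.TransGen (HB s) e.node f.node := by
      have : f ∈ e :: (B ++ [x]) := by rw [h1]; simp
      rcases List.mem_cons.1 this with rfl | hf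
      · exact h12
      · exact h12.trans_left (h.reach f hf)
    convert (Relation.TransGen.mono (fun _ _ => h11)) _ _ h13 using 1
    · rw [← h9, h.load]; simp [acts_append, hy]
    · rw [← h10]; simp [acts_append, hy]
  · intro z hz
    obtain ⟨z, hz', rfl⟩ := List.mem_map.1 hz
    obtain ⟨c, v, hc, -⟩ := h.suffix z hz'
    exact ⟨c, v, by rw [hc]⟩
  · refine ⟨h.addr _ _ _ hxa, fun z hz c v hc => ?_⟩
    obtain ⟨z, hz', rfl⟩ := List.mem_map.1 hz
    obtain ⟨c', v', hc', h'⟩ := h.suffix z hz'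
    rw [hc'] at hc
    cases hc
    exact h'

/-- A program that is not robust has a feasible attack. -/
theorem exists_feasible_of_not_robust (h : ¬ Robust P) : ∃ A, Feasible P A := by
  obtain ⟨w, s, h1, h2⟩ := exists_cyclic_of_not_robust h
  obtain ⟨A, e, B, x, C, s, s', i, b, u, h3⟩ := exists_gAttack h1 h2
  exact ⟨_, h3.feasible.choose_spec⟩

end

section

variable {T L L' R D : Type*} [Zero D] {P : Program T L R D} {P' : Program T L' R D}

/-! ### Removal of fences -/

def LInstr.relabel (π : L → L') (i : LInstr L R D) : LInstr L' R D := ⟨π i.src, i.inst, π i.dst⟩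

def Event.relabel (π : L → L') (e : Event T L R D) : Event T L' R D :=
  ⟨e.act, e.inst.map (LInstr.relabel π)⟩

def Attack.relabel (π : L → L') (A : Attack T L R D) : Attack T L' R D :=
  ⟨A.attacker, A.stinst.relabel π, A.ldinst.relabel π⟩

/-- `P'` arises from `P` by removal of the fences in `X` and identification of their source and
target labels. -/
structure RemovesFences (π : L → L') (X : Set (LInstr L R D)) (P : Program T L R D)
    (P' : Program T L' R D) : Prop where
  init : ∀ t, P'.init t = π (P.init t)
  code : ∀ t, ∀ i ∈ P.code t, i ∉ X → i.relabel π ∈ P'.code t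
  fence : ∀ i ∈ X, i.inst = .mfence ∧ π i.src = π i.dst

/-- The index of a node after the nodes in `K` have been removed. -/
noncomputable def newIdx (K : Set (Node T)) (t : T) (k : ℕ) : ℕ :=
  Nat.count (fun j => (t, j) ∉ K) k

noncomputable def newNode (K : Set (Node T)) (n : Node T) : Node T := (n.1, newIdx K n.1 n.2)

/-- Counting the kept positions is injective only on kept positions: a removed node receives the
same number as the next kept one. -/
theorem newNode_inj {K : Set (Node T)} {m n : Node T} (hm : m ∉ K) (hn : n ∉ K) :
    newNode K m = newNode K n ↔ m = n := by
  refine ⟨fun h => ?_, fun h => by rw [h]⟩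
  obtain ⟨t, j⟩ := m
  obtain ⟨u, k⟩ := n
  obtain rfl : t = u := congrArg Prod.fst h
  have h2 : newIdx K t j = newIdx K t k := congrArg Prod.snd h
  rw [Nat.count_injective (p := fun j => (t, j) ∉ K) hm hn h2]

theorem newIdx_lt {K : Set (Node T)} {t : T} {j k : ℕ} (hj : (t, j) ∉ K) (h : j < k) :
    newIdx K t j < newIdx K t k := Nat.count_strict_mono (p := fun j => (t, j) ∉ K) hj h

theorem newIdx_succ {K : Set (Node T)} {t : T} {k : ℕ} (hk : (t, k) ∉ K) :
    newIdx K t (k + 1) = newIdx K t k + 1 := by simp [newIdx, Nat.count_succ, hk]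

theorem newIdx_succ_of_mem {K : Set (Node T)} {t : T} {k : ℕ} (hk : (t, k) ∈ K) :
    newIdx K t (k + 1) = newIdx K t k := by simp [newIdx, Nat.count_succ, hk]

noncomputable def newEntry (K : Set (Node T)) (t : T) (c : ℕ × D × D) : ℕ × D × D :=
  (newIdx K t c.1, c.2)

noncomputable def Lab.relabel (π : L → L') (K : Set (Node T)) (x : Lab T L R D) : Lab T L' R D :=
  ⟨x.ev.relabel π, newIdx K x.thread x.idx, x.cost⟩

/-- The states `s` and `s'` agree up to the nodes in `K`. -/
structure Sim (π : L → L') (K : Set (Node T)) (s : GState T L R D) (s' : GState T L' R D) :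
    Prop where
  pc : ∀ t, (s'.loc t).pc = π (s.loc t).pc
  reg : ∀ t, (s'.loc t).reg = (s.loc t).reg
  buf : ∀ t, (s'.loc t).buf = (s.loc t).buf.map (newEntry K t)
  len : ∀ t, (s'.loc t).len = newIdx K t (s.loc t).len
  node : ∀ n, n ∉ K → s'.node (newNode K n) =
    (s.node n).map (fun r => ⟨r.act, r.pred.map (newNode K)⟩)
  mem : ∀ a, s'.mem a = ((s.mem a).1, (s.mem a).2.map (newNode K))
  avoid : ∀ t, ∀ c ∈ (s.loc t).buf, (t, c.1) ∉ K
  removed : ∀ n ∈ K, ∀ r, s.node n = some r → r.act = .loc n.1 ∧ r.pred = none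

variable {π : L → L'} {X : Set (LInstr L R D)} {K : Set (Node T)} {s : GState T L R D}
  {s' : GState T L' R D}

theorem RemovesFences.initial (h : RemovesFences π X P P') :
    Sim π K (GState.initial P) (GState.initial P') where
  pc := h.init
  reg _ := rfl
  buf _ := rfl
  len _ := by simp [GState.initial, newIdx]
  node _ _ := rfl
  mem _ := rfl
  avoid _ := by simp [GState.initial]
  removed _ _ _ h := by cases h

noncomputable def Access.rename (K : Set (Node T)) : Access T D → Access T D
  | .none => .none
  | .read a c => .read a (c.1, c.2.map (newNode K))
  | .write a c c' => .write a (c.1, c.2.map (newNode K)) (c'.1, c'.2.map (newNode K))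

theorem filter_map_newEntry (β : List (ℕ × D × D)) (t : T) (a : D) :
    (β.map (newEntry K t)).filter (fun p => decide (p.2.1 = a)) =
      (β.filter (fun p => decide (p.2.1 = a))).map (newEntry K t) := by
  rw [List.filter_map]; rfl

/-- A step that is not removed can be simulated. -/
theorem Sim.exec (h : Sim π K s s') {t act i acc ρ β p} (he : Exec P t (s.loc t) act i acc ρ β p)
    (hi : i.relabel π ∈ P'.code t) : Exec P' t (s'.loc t) act (i.relabel π) (acc.rename K) ρ
      (β.map (newEntry K t)) (p.map (newNode K)) := by
  have hpc' : (s.loc t).pc = i.src → (s'.loc t).pc = (i.relabel π).src := fun h' => by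
    rw [h.pc, h']; rfl
  cases he with
  | early _ r e k a v β hi' hpc hinst ha hbuf =>
    rw [← h.reg]
    refine .early _ r e (newIdx K t k) a v (β.map (newEntry K t)) hi (hpc' hpc) hinst
      (by rw [h.reg, ha]) ?_
    rw [h.buf, filter_map_newEntry, hbuf]; simp [newEntry]
  | read _ r e a c hi' hpc hinst ha hbuf =>
    rw [← h.reg]
    refine .read _ r e a (c.1, c.2.map (newNode K)) hi (hpc' hpc) hinst (by rw [h.reg, ha]) ?_
    rw [h.buf, filter_map_newEntry, hbuf]; rfl
  | issue _ ea ev hi' hpc hinst =>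
    have := Exec.issue (P := P') (ℓ := s'.loc t) (t := t) _ ea ev hi (hpc' hpc) hinst
    rw [h.reg, h.len] at this
    exact this
  | internal _ ρ hi' hpc hinst =>
    refine .internal _ _ hi (hpc' hpc) ?_
    rw [h.reg, h.buf]
    rcases hinst with ⟨h1, h2, rfl⟩ | h1 | h1
    · exact .inl ⟨h1, by rw [h2]; rfl, rfl⟩
    · exact .inr (.inl h1)
    · exact .inr (.inr h1)

theorem Exec.mem_code {t ℓ act i acc ρ β p} (h : Exec P t ℓ act i acc ρ β p) : i ∈ P.code t := by
  cases h <;> assumption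

theorem Exec.pc_eq {t ℓ act i acc ρ β p} (h : Exec P t ℓ act i acc ρ β p) : ℓ.pc = i.src := by
  cases h <;> assumption

theorem Exec.new_entry {t ℓ act i acc ρ β p} (h : Exec P t ℓ act i acc ρ β p) :
    ∀ c ∈ β, c.1 = ℓ.len := by
  cases h <;> simp

theorem Exec.of_mfence {t ℓ act i acc ρ β p} (h : Exec P t ℓ act i acc ρ β p)
    (hi : i.inst = .mfence) : act = .loc t ∧ ρ = ℓ.reg ∧ β = [] ∧ p = none := by
  cases h with
  | internal _ ρ _ _ hinst =>
    rcases hinst with ⟨_, _, rfl⟩ | ⟨_, _, h1, _⟩ | ⟨_, h1, _⟩ <;> simp_all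
  | _ => simp_all

theorem Exec.acc_not_write {t ℓ act i acc ρ β p} (h : Exec P t ℓ act i acc ρ β p)
    (hm : acc.Ok s.mem s.mem) (hs : Sim π K s s') : (acc.rename K).Ok s'.mem s'.mem := by
  cases h with
  | read _ r e a c => exact ⟨by rw [hs.mem, hm.1], rfl⟩
  | _ => exact rfl

theorem Sim.afterExec (h : Sim π K s s') {t l ρ β act p} (hn : (t, (s.loc t).len) ∉ K)
    (hβ : ∀ c ∈ β, c.1 = (s.loc t).len) :
    Sim π K (s.afterExec t l ρ β ⟨act, p⟩) (s'.afterExec t (π l) ρ (β.map (newEntry K t))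
      ⟨act, p.map (newNode K)⟩) where
  pc u := by
    by_cases hu : u = t
    · subst hu; simp [GState.afterExec, LocalState.push]
    · simp [GState.afterExec, hu, h.pc]
  reg u := by
    by_cases hu : u = t
    · subst hu; simp [GState.afterExec, LocalState.push]
    · simp [GState.afterExec, hu, h.reg]
  buf u := by
    rw [afterExec_buf, afterExec_buf, h.buf, h.buf]
    split_ifs with hu
    · subst hu; simp
    · rfl
  len u := by
    rw [afterExec_len, afterExec_len, h.len, h.len]
    split_ifs with hu
    · subst hu; rw [newIdx_succ hn]
    · rfl
  node n hnK := by
    rw [afterExec_node, afterExec_node, h.len]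
    have : newNode K n = (t, newIdx K t (s.loc t).len) ↔ n = (t, (s.loc t).len) :=
      newNode_inj hnK hn
    simp only [this]
    split_ifs
    · rfl
    · exact h.node n hnK
  mem a := h.mem a
  avoid u c hc := by
    rw [afterExec_buf] at hc
    split_ifs at hc with hu
    · subst hu
      rcases List.mem_append.1 hc with hc | hc
      · exact h.avoid _ c hc
      · rw [hβ c hc]; exact hn
    · exact h.avoid _ c hc
  removed n hnK r hr := by
    rw [afterExec_node, if_neg (by rintro rfl; exact hn hnK)] at hr
    exact h.removed n hnK r hr

theorem Sim.afterFlush (h : Sim π K s s') {t k a v β} (hb : (s.loc t).buf = (k, a, v) :: β) :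
    Sim π K (s.afterFlush t k a v β)
      (s'.afterFlush t (newIdx K t k) a v (β.map (newEntry K t))) where
  pc u := by
    by_cases hu : u = t
    · subst hu; simp [GState.afterFlush, LocalState.pop, h.pc]
    · simp [GState.afterFlush, hu, h.pc]
  reg u := by
    by_cases hu : u = t
    · subst hu; simp [GState.afterFlush, LocalState.pop, h.reg]
    · simp [GState.afterFlush, hu, h.reg]
  buf u := by
    rw [afterFlush_buf, afterFlush_buf, h.buf]
    split_ifs with hu
    · subst hu; rfl
    · rfl
  len u := by rw [afterFlush_len, afterFlush_len, h.len]
  node n hnK := by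
    have hk : (t, k) ∉ K := h.avoid t (k, a, v) (by simp [hb])
    rw [afterFlush_node, afterFlush_node]
    have : newNode K n = (t, newIdx K t k) ↔ n = (t, k) := newNode_inj hnK hk
    simp only [this]
    split_ifs
    · simp [h.mem]
    · exact h.node n hnK
  mem b := by
    rw [afterFlush_mem, afterFlush_mem]
    split_ifs
    · rfl
    · exact h.mem b
  avoid u c hc := by
    rw [afterFlush_buf] at hc
    split_ifs at hc with hu
    · subst hu; exact h.avoid _ c (by simp [hb, hc])
    · exact h.avoid _ c hc
  removed n hnK r hr := by
    have hk : (t, k) ∉ K := h.avoid t (k, a, v) (by simp [hb])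
    rw [afterFlush_node, if_neg (by rintro rfl; exact hk hnK)] at hr
    exact h.removed n hnK r hr

/-- A removed fence changes only the program counter and the log. Its two labels are identified by
`π` and its node is not counted, so the other side does not move. -/
theorem Sim.afterRemoved (h : Sim π K s s') {t l} (hn : (t, (s.loc t).len) ∈ K)
    (hl : π l = π (s.loc t).pc) :
    Sim π K (s.afterExec t l (s.loc t).reg [] ⟨.loc t, none⟩) s' where
  pc u := by
    by_cases hu : u = t
    · subst hu; simp [GState.afterExec, LocalState.push, h.pc, hl]
    · simp [GState.afterExec, hu, h.pc]
  reg u := by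
    by_cases hu : u = t
    · subst hu; simp [GState.afterExec, LocalState.push, h.reg]
    · simp [GState.afterExec, hu, h.reg]
  buf u := by
    rw [afterExec_buf, h.buf]
    split_ifs with hu
    · subst hu; simp
    · rfl
  len u := by
    rw [afterExec_len, h.len]
    split_ifs with hu
    · subst hu; rw [newIdx_succ_of_mem hn]
    · rfl
  node n hnK := by
    rw [afterExec_node, if_neg (by rintro rfl; exact hnK hn)]
    exact h.node n hnK
  mem a := h.mem a
  avoid u c hc := by
    rw [afterExec_buf] at hc
    split_ifs at hc with hu
    · subst hu; exact h.avoid _ c (by simpa using hc)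
    · exact h.avoid _ c hc
  removed n hnK r hr := by
    rw [afterExec_node] at hr
    split_ifs at hr with hnt
    · cases hr; subst hnt; exact ⟨rfl, rfl⟩
    · exact h.removed n hnK r hr

/-- The event is the execution of a removed fence. -/
def Event.Removed (X : Set (LInstr L R D)) (e : Event T L R D) : Prop := ∃ i ∈ X, e.inst = some i

/-- The execution without the removed fences. -/
noncomputable def keepLabs (π : L → L') (X : Set (LInstr L R D)) (K : Set (Node T))
    (w : List (Lab T L R D)) : List (Lab T L' R D) :=
  (w.filter (fun x => decide (¬ x.ev.Removed X))).map (Lab.relabel π K)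

theorem keepLabs_append (w w' : List (Lab T L R D)) :
    keepLabs π X K (w ++ w') = keepLabs π X K w ++ keepLabs π X K w' := by simp [keepLabs]

theorem keepLabs_cons_of_not {x : Lab T L R D} (h : ¬ x.ev.Removed X) (w) :
    keepLabs π X K (x :: w) = x.relabel π K :: keepLabs π X K w := by simp [keepLabs, h]

theorem keepLabs_cons_of_removed {x : Lab T L R D} (h : x.ev.Removed X) (w) :
    keepLabs π X K (x :: w) = keepLabs π X K w := by simp [keepLabs, h]

theorem Sim.step (hP : RemovesFences π X P P') (h : Sim π K s s') {x u} (hx : GStep P s x u)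
    (hK : x.node ∈ K ↔ x.ev.Removed X) :
    (x.ev.Removed X → Sim π K u s') ∧
      (¬ x.ev.Removed X → ∃ u', GStep P' s' (x.relabel π K) u' ∧ Sim π K u u') := by
  rcases hx.view with ⟨t, act, i, acc, ρ, β, p, he, hm, rfl, rfl⟩ | ⟨t, k, a, v, β, hb, rfl, rfl⟩
  · simp only [Lab.node, Lab.thread, he.thread_eq] at hK
    constructor
    · intro hr
      obtain ⟨j, hj, hji⟩ := hr
      have hn := hK.2 ⟨j, hj, hji⟩
      cases hji
      obtain ⟨hf, hl⟩ := hP.fence _ hj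
      obtain ⟨rfl, rfl, rfl, rfl⟩ := he.of_mfence hf
      exact h.afterRemoved hn (by rw [he.pc_eq, hl])
    · intro hr
      have hiX : i ∉ X := fun hi => hr ⟨i, hi, rfl⟩
      have he' := h.exec he (hP.code t i he.mem_code hiX)
      refine ⟨_, ?_, h.afterExec (fun hn => hr (hK.1 hn)) he.new_entry⟩
      have := GStep.exec he' (he.acc_not_write hm h)
      rw [h.len, h.buf, List.length_map] at this
      simp only [Lab.relabel, Lab.thread, he.thread_eq]
      exact this
  · constructor
    · rintro ⟨j, -, hj⟩; cases hj
    · intro _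
      refine ⟨_, ?_, h.afterFlush hb⟩
      exact GStep.flush (P := P') (by rw [h.buf, hb]; rfl)

theorem Sim.run (hP : RemovesFences π X P P') (h : Sim π K s s') {w u} (hw : GRun P s w u)
    (hK : ∀ x ∈ w, x.node ∈ K ↔ x.ev.Removed X) :
    ∃ u', GRun P' s' (keepLabs π X K w) u' ∧ Sim π K u u' := by
  induction w generalizing s s' with
  | nil => obtain rfl := hw; exact ⟨s', rfl, h⟩
  | cons x w ih =>
    obtain ⟨v, hx, hw⟩ := hw
    obtain ⟨h1, h2⟩ := h.step hP hx (hK x (by simp))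
    by_cases hr : x.ev.Removed X
    · rw [keepLabs_cons_of_removed hr]
      exact ih (h1 hr) hw fun y hy => hK y (by simp [hy])
    · rw [keepLabs_cons_of_not hr]
      obtain ⟨v', h3, h4⟩ := h2 hr
      obtain ⟨u', h5, h6⟩ := ih h4 hw fun y hy => hK y (by simp [hy])
      exact ⟨u', ⟨v', h3, h5⟩, h6⟩

/-! ### Nodes of a run -/

theorem GStep.node_self {s u : GState T L R D} {x} (h : GStep P s x u) :
    ∃ r, u.node x.node = some r ∧ r.act = x.ev.act := by
  rcases h.view with ⟨t, act, i, acc, ρ, β, p, he, hm, rfl, rfl⟩ | ⟨t, k, a, v, β, hb, rfl, rfl⟩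
  · refine ⟨⟨act, p⟩, ?_, rfl⟩
    simp only [Lab.node, Lab.thread, he.thread_eq]
    rw [afterExec_node, if_pos rfl]
  · refine ⟨⟨.store t a v, (s.mem a).2⟩, ?_, rfl⟩
    simp only [Lab.node, Lab.thread, Action.thread]
    rw [afterFlush_node, if_pos rfl]

/-- A node is written at most twice, at its issue and at its store. If a step on it is still to
come, it is therefore unused or a pending issue. -/
theorem GRun.node_before {u v : GState T L R D} {w} (h : GRun P u w v) (hu : WF u) {y}
    (hy : y ∈ w) : u.node y.node = none ∨ u.node y.node = some ⟨.issue y.thread, none⟩ := by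
  induction w generalizing u with
  | nil => simp at hy
  | cons x w ih =>
    obtain ⟨u₁, hx, hw⟩ := h
    by_cases hxy : y.node = x.node
    · have := (hx.node_update hu).2.1
      rw [hxy, show y.thread = x.thread from congrArg Prod.fst hxy]; exact this
    · rw [← (hx.node_update hu).1 _ hxy]
      rcases List.mem_cons.1 hy with rfl | hy
      · exact absurd rfl hxy
      · exact ih hw (hx.wf hu) hy

theorem GRun.node_before_nonstore {u v : GState T L R D} {w} (h : GRun P u w v) (hu : WF u) {y}
    (hy : y ∈ w) (hs : y.isStore = false) : u.node y.node = none := by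
  induction w generalizing u with
  | nil => simp at hy
  | cons x w ih =>
    obtain ⟨u₁, hx, hw⟩ := h
    rcases List.mem_cons.1 hy with rfl | hy
    · have := hu.node_len y.thread
      rwa [← (hx.of_nonstore hs).1] at this
    · have h1 := ih hw (hx.wf hu) hy
      by_cases hxy : y.node = x.node
      · obtain ⟨r, hr, -⟩ := hx.node_self
        rw [← hxy, h1] at hr; cases hr
      · rwa [← (hx.node_update hu).1 _ hxy]

/-- Only an issue and its store share a node, so the node of a local action determines the step.
This allows removed fences to be described by their nodes. -/
theorem GRun.eq_of_node_eq {u v : GState T L R D} {w} (h : GRun P u w v) (hu : WF u) {x y}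
    (hx : x ∈ w) (hy : y ∈ w) {t} (hxt : x.ev.act = .loc t) (hxy : x.node = y.node) : x = y := by
  have hxs : x.isStore = false := by simp [Lab.isStore, hxt, Action.isStore]
  induction w generalizing u with
  | nil => simp at hy
  | cons z w ih =>
    obtain ⟨u₁, hz, hw⟩ := h
    have hu₁ := hz.wf hu
    rcases List.mem_cons.1 hx with rfl | hx' <;> rcases List.mem_cons.1 hy with rfl | hy'
    · rfl
    · obtain ⟨r, hr, hra⟩ := hz.node_self
      rcases hw.node_before hu₁ hy' with h0 | h0 <;> rw [← hxy, hr] at h0 <;> cases h0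
      rw [hxt] at hra; cases hra
    · obtain ⟨r, hr, -⟩ := hz.node_self
      rw [← hxy, hw.node_before_nonstore hu₁ hx' hxs] at hr; cases hr
    · exact ih hw hu₁ hx' hy'

theorem GRun.removed_act (hP : RemovesFences π X P P') {u v : GState T L R D} {w}
    (h : GRun P u w v) {x} (hx : x ∈ w) (hr : x.ev.Removed X) : x.ev.act = .loc x.thread := by
  obtain ⟨w₁, w₂, rfl⟩ := List.append_of_mem hx
  obtain ⟨u₁, -, u₂, h2, -⟩ := gRun_append.1 h
  obtain ⟨i, hi, hxi⟩ := hr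
  rcases h2.view with ⟨t, act, j, acc, ρ, β, p, he, hm, rfl, rfl⟩ | ⟨t, k, a, v, β, hb, rfl, rfl⟩
  · cases hxi
    obtain ⟨rfl, -⟩ := he.of_mfence (hP.fence _ hi).1
    rfl
  · cases hxi

theorem GRun.mem_removed_iff (hP : RemovesFences π X P P') {v : GState T L R D} {w}
    (h : GRun P (GState.initial P) w v) {x} (hx : x ∈ w) :
    x.node ∈ {n | ∃ y ∈ w, y.ev.Removed X ∧ y.node = n} ↔ x.ev.Removed X := by
  constructor
  · rintro ⟨y, hy, hr, hyx⟩
    rwa [← h.eq_of_node_eq WF.initial hy hx (h.removed_act hP hy hr) hyx]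
  · intro hr; exact ⟨x, hx, hr, rfl⟩

/-! ### Happens-before after removal of fences -/

theorem Sim.hb_of_not_mem (h : Sim π K s s') {m n : Node T} (hm : m ∉ K) (hn : n ∉ K)
    (hmn : HB s m n) : HB s' (newNode K m) (newNode K n) := by
  cases hmn with
  | po t j k hj hk =>
    exact .po t _ _ (newIdx_lt hm hj) (by rw [h.len]; exact newIdx_lt hn hk)
  | pred _ _ r hr hp =>
    refine .pred _ _ ⟨r.act, r.pred.map (newNode K)⟩ ?_ (by simp [hp])
    rw [h.node n hn, hr]; rfl
  | cf _ _ t t' a v v' o hm' hn' =>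
    refine .cf _ _ t t' a v v' (o.map (newNode K)) ?_ ?_
    · rw [h.node m hm, hm']; rfl
    · rw [h.node n hn, hn']; rfl

/-- Removed nodes have only edges of the program order. -/
theorem Sim.po_of_mem (h : Sim π K s s') (hs : WF s) {m n : Node T} (hmn : HB s m n)
    (hK : m ∈ K ∨ n ∈ K) : m.1 = n.1 ∧ m.2 < n.2 ∧ n.2 < (s.loc n.1).len := by
  cases hmn with
  | po t j k hj hk => exact ⟨rfl, hj, hk⟩
  | pred _ _ r hr hp =>
    exfalso
    rcases hK with hK | hK
    · obtain ⟨act, p⟩ := r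
      obtain rfl : p = some m := hp
      cases act with
      | issue => have := hs.issue _ _ _ hr; cases this
      | loc => have := hs.loc_pred _ _ _ hr; cases this
      | load t' a v =>
        rcases hs.load_pred _ _ _ _ _ hr with ⟨v', o', h0⟩ | ⟨-, -, h0⟩
        · have := (h.removed m hK _ h0).1; cases this
        · exact h.avoid _ _ h0 hK
      | store t' a v =>
        obtain ⟨v', o', h0⟩ := hs.store_pred _ _ _ _ _ hr
        have := (h.removed m hK _ h0).1; cases this
    · rw [(h.removed n hK r hr).2] at hp; cases hp
  | cf _ _ t t' a v v' o hm' hn' =>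
    exfalso
    rcases hK with hK | hK
    · have := (h.removed m hK _ hm').1; cases this
    · have := (h.removed n hK _ hn').1; cases this

/-- Removed nodes are entered and left only along program order. A path through them stays in one
thread, and transitive program order links the kept nodes on both sides directly. -/
theorem Sim.transGen_hb (h : Sim π K s s') (hs : WF s) {m n : Node T} (hm : m ∉ K) (hn : n ∉ K)
    (hmn : Relation.TransGen (HB s) m n) :
    Relation.TransGen (HB s') (newNode K m) (newNode K n) := by
  -- `d` is the last kept node on the path so far: it is the current node, or it precedes the
  -- current removed node in program order.
  have key : ∀ {c}, Relation.ReflTransGen (HB s) m c → ∃ d, d ∉ K ∧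
      Relation.ReflTransGen (HB s') (newNode K m) (newNode K d) ∧
      (d = c ∨ c ∈ K ∧ d.1 = c.1 ∧ d.2 < c.2) := by
    intro c hc
    induction hc with
    | refl => exact ⟨m, hm, .refl, .inl rfl⟩
    | @tail b c _ hbc ih =>
      obtain ⟨d, hd, h1, h2⟩ := ih
      by_cases hcK : c ∈ K
      · obtain ⟨h3, h4, -⟩ := h.po_of_mem hs hbc (.inr hcK)
        refine ⟨d, hd, h1, .inr ⟨hcK, ?_⟩⟩
        rcases h2 with rfl | ⟨-, h5, h6⟩
        · exact ⟨h3, h4⟩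
        · exact ⟨h5.trans h3, h6.trans h4⟩
      · refine ⟨c, hcK, ?_, .inl rfl⟩
        rcases h2 with rfl | ⟨hbK, h5, h6⟩
        · exact h1.tail (h.hb_of_not_mem hd hcK hbc)
        · obtain ⟨h3, h4, h7⟩ := h.po_of_mem hs hbc (.inl hbK)
          refine h1.tail (h.hb_of_not_mem hd hcK ?_)
          obtain ⟨dt, dk⟩ := d
          obtain ⟨ct, ck⟩ := c
          obtain rfl : dt = ct := h5.trans h3
          exact .po _ _ _ (h6.trans h4) h7
  obtain ⟨c, hmc, hcn⟩ := Relation.TransGen.tail'_iff.1 hmn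
  obtain ⟨d, hd, h1, h2⟩ := key hmc
  refine Relation.TransGen.tail' h1 ?_
  rcases h2 with rfl | ⟨hbK, h5, h6⟩
  · exact h.hb_of_not_mem hd hn hcn
  · obtain ⟨h3, h4, h7⟩ := h.po_of_mem hs hcn (.inl hbK)
    refine h.hb_of_not_mem hd hn ?_
    obtain ⟨dt, dk⟩ := d
    obtain ⟨ct, ck⟩ := n
    obtain rfl : dt = ct := h5.trans h3
    exact .po _ _ _ (h6.trans h4) h7

end

section

variable {T L L' R D : Type*} [Zero D] {P : Program T L R D} {P' : Program T L' R D}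
  {π : L → L'} {X : Set (LInstr L R D)} {K : Set (Node T)}

/-! ### Feasibility after removal of fences -/

theorem keepLabs_eq_append {w : List (Lab T L R D)} {α β} (h : keepLabs π X K w = α ++ β) :
    ∃ w₁ w₂, w = w₁ ++ w₂ ∧ keepLabs π X K w₁ = α ∧ keepLabs π X K w₂ = β := by
  obtain ⟨v₁, v₂, h1, rfl, rfl⟩ := List.map_eq_append_iff.1 h
  obtain ⟨w₁, w₂, rfl, rfl, rfl⟩ := List.filter_eq_append_iff.1 h1
  exact ⟨w₁, w₂, rfl, rfl, rfl⟩

theorem keepLabs_eq_cons {w : List (Lab T L R D)} {y β} (h : keepLabs π X K w = y :: β) :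
    ∃ w₁ x w₂, w = w₁ ++ x :: w₂ ∧ keepLabs π X K w₁ = [] ∧ ¬ x.ev.Removed X ∧
      x.relabel π K = y ∧ keepLabs π X K w₂ = β := by
  obtain ⟨x, v, h1, rfl, rfl⟩ := List.map_eq_cons_iff.1 h
  obtain ⟨w₁, w₂, rfl, h2, h3, rfl⟩ := List.filter_eq_cons_iff.1 h1
  refine ⟨w₁, x, w₂, rfl, ?_, by simpa using h3, rfl, rfl⟩
  simpa [keepLabs, List.filter_eq_nil_iff] using h2

theorem issueCount_keepLabs {w : List (Lab T L R D)}
    (h : ∀ x ∈ w, x.ev.Removed X → x.ev.act = .loc x.thread) (t : T) :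
    issueCount t (acts (keepLabs π X K w)) = issueCount t (acts w) := by
  induction w with
  | nil => rfl
  | cons x w ih =>
    have ih := ih fun y hy => h y (by simp [hy])
    by_cases hr : x.ev.Removed X
    · rw [keepLabs_cons_of_removed hr, ih, acts_cons, h x (by simp) hr]
      simp [Action.isIssue]
    · rw [keepLabs_cons_of_not hr, acts_cons, acts_cons, issueCount_cons, issueCount_cons, ih]; rfl

theorem storeCount_keepLabs {w : List (Lab T L R D)}
    (h : ∀ x ∈ w, x.ev.Removed X → x.ev.act = .loc x.thread) (t : T) :
    storeCount t (acts (keepLabs π X K w)) = storeCount t (acts w) := by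
  induction w with
  | nil => rfl
  | cons x w ih =>
    have ih := ih fun y hy => h y (by simp [hy])
    by_cases hr : x.ev.Removed X
    · rw [keepLabs_cons_of_removed hr, ih, acts_cons, h x (by simp) hr]
      simp [Action.isStore]
    · rw [keepLabs_cons_of_not hr, acts_cons, acts_cons, storeCount_cons, storeCount_cons, ih]; rfl

theorem acts_eq_append_cons {w : List (Lab T L R D)} {α x β} (h : acts w = α ++ x :: β) :
    ∃ w₁ y w₂, w = w₁ ++ y :: w₂ ∧ acts w₁ = α ∧ y.ev.act = x ∧ acts w₂ = β := by
  obtain ⟨w₁, w₂, rfl, h1, h2⟩ := acts_eq_append h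
  obtain ⟨y, w₃, rfl, h3, h4⟩ := acts_eq_cons h2
  exact ⟨w₁, y, w₃, rfl, h1, h3, h4⟩

theorem keepLabs_eq_append_cons {w : List (Lab T L R D)} {α y β}
    (h : keepLabs π X K w = α ++ y :: β) : ∃ w₁ x w₂, w = w₁ ++ x :: w₂ ∧
      keepLabs π X K w₁ = α ∧ ¬ x.ev.Removed X ∧ x.relabel π K = y ∧ keepLabs π X K w₂ = β := by
  obtain ⟨w₁, w₂, rfl, h1, h2⟩ := keepLabs_eq_append h
  obtain ⟨w₃, x, w₄, rfl, h3, h4, h5, h6⟩ := keepLabs_eq_cons h2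
  exact ⟨w₁ ++ w₃, x, w₄, by simp, by rw [keepLabs_append, h1, h3, List.append_nil], h4, h5, h6⟩

/-- Delayed stores were already delayed before the removal of fences. -/
theorem exists_isDelayed_of_keepLabs {w : List (Lab T L R D)}
    (hw : ∀ x ∈ w, x.ev.Removed X → x.ev.act = .loc x.thread) {t α β c z γ}
    (h : IsDelayed (acts (keepLabs π X K w)) t α β c z γ) :
    ∃ w₁ w₂ β' γ', w = w₁ ++ w₂ ∧ acts (keepLabs π X K w₁) = α ∧
      IsDelayed (acts w) t (acts w₁) β' c z γ' := by
  obtain ⟨⟨h1, h2⟩, q, hq, hqt⟩ := h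
  have h1' : acts (keepLabs π X K w) = α ++ .issue t :: (β ++ .store t c z :: γ) := by
    simpa using h1
  obtain ⟨v₁, y, v₂, h3, rfl, h4, h5⟩ := acts_eq_append_cons h1'
  obtain ⟨v₃, y', v₄, rfl, rfl, h6, h7⟩ := acts_eq_append_cons h5
  obtain ⟨w₁, x, w₂, rfl, rfl, h8, rfl, h9⟩ := keepLabs_eq_append_cons h3
  obtain ⟨w₃, x', w₄, rfl, rfl, h10, rfl, h11⟩ := keepLabs_eq_append_cons h9
  refine ⟨w₁, x :: (w₃ ++ x' :: w₄), acts w₃, acts w₄, rfl, rfl, ⟨?_, ?_⟩, q, ?_, hqt⟩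
  · have h12 : x.ev.act = .issue t := h4
    have h13 : x'.ev.act = .store t c z := h6
    simp [h12, h13]
  · have h2' : issueCount t (acts (keepLabs π X K w₁)) =
        storeCount t (acts (keepLabs π X K w₁) ++ acts (keepLabs π X K w₃)) := h2
    rw [issueCount_keepLabs (fun x hx => hw x (by simp [hx])), storeCount_append,
      storeCount_keepLabs (fun x hx => hw x (by simp [hx])),
      storeCount_keepLabs (fun x hx => hw x (by simp [hx]))] at h2'
    rw [← storeCount_append] at h2'
    exact h2'
  · obtain ⟨b, hb, rfl⟩ := List.mem_map.1 hq
    obtain ⟨b, hb', rfl⟩ := List.mem_map.1 hb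
    exact List.mem_map.2 ⟨b, (List.mem_filter.1 hb').1, rfl⟩

theorem Attack.IsAttackOf.relabel (hP : RemovesFences π X P P') {A : Attack T L R D}
    (h : A.IsAttackOf P) : (A.relabel π).IsAttackOf P' := by
  obtain ⟨h1, ⟨ea, ev, h2⟩, h3, r, e, h4⟩ := h
  refine ⟨hP.code _ _ h1 fun hX => ?_, ⟨ea, ev, h2⟩, hP.code _ _ h3 fun hX => ?_, r, e, h4⟩
  · have := (hP.fence _ hX).1; rw [h2] at this; cases this
  · have := (hP.fence _ hX).1; rw [h4] at this; cases this

theorem exists_labs_of_events {A : Attack T L R D} {w₁ w₂ w₃ w₄ : List (Event T L R D)} {a v b u}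
    {W : List (Lab T L R D)} (h : W.map Lab.ev = A.events w₁ w₂ w₃ w₄ a v b u) :
    ∃ W₁ x W₂ e W₃ y W₄, W = W₁ ++ x :: (W₂ ++ e :: (W₃ ++ y :: W₄)) ∧
      W₁.map Lab.ev = w₁ ∧ W₂.map Lab.ev = w₂ ∧ W₃.map Lab.ev = w₃ ∧ W₄.map Lab.ev = w₄ ∧
      x.ev = ⟨.issue A.attacker, some A.stinst⟩ ∧ e.ev = ⟨.load A.attacker b u, some A.ldinst⟩ ∧
      y.ev = ⟨.store A.attacker a v, none⟩ := by
  have h' : W.map Lab.ev = w₁ ++ ⟨.issue A.attacker, some A.stinst⟩ :: (w₂ ++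
      ⟨.load A.attacker b u, some A.ldinst⟩ :: (w₃ ++ ⟨.store A.attacker a v, none⟩ :: w₄)) := by
    simpa [Attack.events] using h
  obtain ⟨W₁, V₁, rfl, h1, h2⟩ := List.map_eq_append_iff.1 h'
  obtain ⟨x, V₂, rfl, h3, h4⟩ := List.map_eq_cons_iff.1 h2
  obtain ⟨W₂, V₃, rfl, h5, h6⟩ := List.map_eq_append_iff.1 h4
  obtain ⟨e, V₄, rfl, h7, h8⟩ := List.map_eq_cons_iff.1 h6
  obtain ⟨W₃, V₅, rfl, h9, h10⟩ := List.map_eq_append_iff.1 h8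
  obtain ⟨y, V₆, rfl, h11, h12⟩ := List.map_eq_cons_iff.1 h10
  exact ⟨W₁, x, W₂, e, W₃, y, V₆, rfl, h1, h5, h9, h12, h3, h7, h11⟩

theorem length_keepLabs_le {w₁ w₂ v₁ v₂ : List (Lab T L R D)} (h : w₁ ++ w₂ = v₁ ++ v₂)
    (hl : w₁.length ≤ v₁.length) : (keepLabs π X K w₁).length ≤ (keepLabs π X K v₁).length := by
  obtain ⟨δ, rfl⟩ : ∃ δ, v₁ = w₁ ++ δ := by
    obtain ⟨δ, h⟩ := List.prefix_of_prefix_length_le (l₃ := w₁ ++ w₂) ⟨w₂, rfl⟩ ⟨v₂, h.symm⟩ hl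
    exact ⟨δ, h.symm⟩
  simp [keepLabs_append]

/-- An attack remains feasible if fences are removed. -/
theorem Feasible.relabel (hP : RemovesFences π X P P') {A : Attack T L R D} (h : Feasible P A) :
    Feasible P' (A.relabel π) := by
  obtain ⟨hA, w₁, w₂, w₃, w₄, a, v, b, u, hw⟩ := h
  obtain ⟨s₀, hs₀, hb₀⟩ := hw.execution
  obtain ⟨W, s, hW, hrun, hse⟩ := hs₀.toGRun (GState.initial P) rfl
  obtain ⟨W₁, x, W₂, e, W₃, y, W₄, hW', rfl, rfl, rfl, rfl, hx, he, hy⟩ := exists_labs_of_events hW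
  have hempty : ∀ t, (s.loc t).buf = [] := fun t => by
    have := hb₀ t; rw [← hse] at this; simpa [GState.erase] using this
  -- The removed nodes are collected from the complete run in advance, so one renumbering serves all
  -- intermediate states.
  set K : Set (Node T) := {n | ∃ y ∈ W, y.ev.Removed X ∧ y.node = n} with hKdef
  have hK : ∀ x ∈ W, x.node ∈ K ↔ x.ev.Removed X := fun x hx => hrun.mem_removed_iff hP hx
  have hloc : ∀ x ∈ W, x.ev.Removed X → x.ev.act = .loc x.thread :=
    fun x hx => hrun.removed_act hP hx
  have hactsW : (A.events (W₁.map Lab.ev) (W₂.map Lab.ev) (W₃.map Lab.ev) (W₄.map Lab.ev)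
      a v b u).map Event.act = acts W := by rw [← hW, List.map_map]; rfl
  obtain ⟨s', hrun', hsim⟩ := (hP.initial (K := K)).run hP hrun hK
  have hempty' : ∀ t, (s'.loc t).buf = [] := fun t => by rw [hsim.buf, hempty]; rfl
  have hxr : ¬ x.ev.Removed X := fun hr => by
    have := hloc x (by simp [hW']) hr; rw [hx] at this; cases this
  have her : ¬ e.ev.Removed X := fun hr => by
    have := hloc e (by simp [hW']) hr; rw [he] at this; cases this
  have hyr : ¬ y.ev.Removed X := fun hr => by
    have := hloc y (by simp [hW']) hr; rw [hy] at this; cases this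
  have hkeep : keepLabs π X K W = keepLabs π X K W₁ ++ x.relabel π K :: (keepLabs π X K W₂ ++
      e.relabel π K :: (keepLabs π X K W₃ ++ y.relabel π K :: keepLabs π X K W₄)) := by
    simp [hW', keepLabs_append, keepLabs_cons_of_not, hxr, her, hyr]
  have hev : (A.relabel π).events ((keepLabs π X K W₁).map Lab.ev) ((keepLabs π X K W₂).map Lab.ev)
      ((keepLabs π X K W₃).map Lab.ev) ((keepLabs π X K W₄).map Lab.ev) a v b u =
      (keepLabs π X K W).map Lab.ev := by
    simp [hkeep, Attack.events, Lab.relabel, Event.relabel, hx, he, hy, Attack.relabel]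
  have hact : ((A.relabel π).events ((keepLabs π X K W₁).map Lab.ev)
      ((keepLabs π X K W₂).map Lab.ev) ((keepLabs π X K W₃).map Lab.ev)
      ((keepLabs π X K W₄).map Lab.ev) a v b u).map Event.act = acts (keepLabs π X K W) := by
    rw [hev, List.map_map]; rfl
  have hmap : ∀ w : List (Lab T L R D), (w.map Lab.ev).map Event.act = acts w :=
    fun w => List.map_map
  have hmap' : ∀ w : List (Lab T L' R D), (w.map Lab.ev).map Event.act = acts w :=
    fun w => List.map_map
  have hxa : x.ev.act = .issue A.attacker := by rw [hx]
  have hea : e.ev.act = .load A.attacker b u := by rw [he]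
  have hya : y.ev.act = .store A.attacker a v := by rw [hy]
  have hrel : ∀ z : Lab T L R D, (z.relabel π K).ev.act = z.ev.act := fun _ => rfl
  have hmem : ∀ {w : List (Lab T L R D)} {z}, z ∈ (keepLabs π X K w).map Lab.ev →
      ∃ c ∈ w, z.act = c.ev.act := by
    intro w z hz
    obtain ⟨z, hz', rfl⟩ := List.mem_map.1 hz
    obtain ⟨c, hc, rfl⟩ := List.mem_map.1 hz'
    exact ⟨c, (List.mem_filter.1 hc).1, rfl⟩
  refine ⟨hA.relabel hP, (keepLabs π X K W₁).map Lab.ev, (keepLabs π X K W₂).map Lab.ev,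
    (keepLabs π X K W₃).map Lab.ev, (keepLabs π X K W₄).map Lab.ev, a, v, b, u,
    ?_, ?_, ?_, ?_, ?_, ?_, ?_, ?_⟩
  · rw [hev]
    exact ⟨s'.erase, hrun'.toTSO, fun t => by simp [GState.erase, hempty']⟩
  · rw [hact, hmap', hmap', hmap', hmap']
    have hpair := hw.pair.2
    rw [hmap, hmap, hmap] at hpair
    refine ⟨?_, ?_⟩
    · rw [hkeep]; simp [hrel, hxa, hea, hya, Attack.relabel]
    · have h1 : issueCount A.attacker (acts W₁) = storeCount A.attacker (acts W₁ ++
          (acts W₂ ++ [.load A.attacker b u] ++ acts W₃)) := hpair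
      change issueCount A.attacker (acts (keepLabs π X K W₁)) = storeCount A.attacker
        (acts (keepLabs π X K W₁) ++ (acts (keepLabs π X K W₂) ++ [.load A.attacker b u] ++
          acts (keepLabs π X K W₃)))
      simp only [storeCount_append] at h1 ⊢
      rw [issueCount_keepLabs (fun z hz => hloc z (by simp [hW', hz])),
        storeCount_keepLabs (fun z hz => hloc z (by simp [hW', hz])),
        storeCount_keepLabs (fun z hz => hloc z (by simp [hW', hz])),
        storeCount_keepLabs (fun z hz => hloc z (by simp [hW', hz])), h1]
  · intro t α β c z γ hd
    rw [hact] at hd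
    -- Fences are neither issues nor stores, so the counts that match issues with stores are
    -- unchanged and every delay was already present with the fences.
    obtain ⟨v₁, v₂, β', γ', -, -, h3⟩ := exists_isDelayed_of_keepLabs hloc hd
    rw [← hactsW] at h3
    exact hw.onlyAttacker _ _ _ _ _ _ h3
  · intro α β c z γ hd
    rw [hact] at hd
    obtain ⟨v₁, v₂, β', γ', h1, rfl, h3⟩ := exists_isDelayed_of_keepLabs hloc hd
    rw [← hactsW] at h3
    have h4 := hw.firstDelayed _ _ _ _ _ h3
    have h5 := length_keepLabs_le (π := π) (X := X) (K := K) (hW'.symm.trans h1)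
      (by simpa [acts] using h4)
    simpa [acts] using h5
  · intro z hz
    obtain ⟨c, hc, h1⟩ := hmem hz
    rw [h1]
    exact hw.lastOverstepped _ (List.mem_map_of_mem hc)
  · intro α z δ hz
    rw [hact, hmap', hmap']
    rw [hmap'] at hz
    obtain ⟨v₁, f', v₂, h1, rfl, rfl, -⟩ := acts_eq_append_cons
      (w := keepLabs π X K (e :: (W₃ ++ [y]))) (α := α) (x := z) (β := δ) (by
        rw [keepLabs_cons_of_not her, keepLabs_append, keepLabs_cons_of_not hyr]
        simpa [keepLabs, hrel, hea, hya, Attack.relabel] using hz)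
    obtain ⟨V₁, f, V₂, h2, rfl, hfr, rfl, -⟩ := keepLabs_eq_append_cons h1
    have hsplit : W = (W₁ ++ x :: W₂) ++ e :: (W₃ ++ y :: W₄) := by simp [hW']
    have hsplit' : W = (W₁ ++ x :: (W₂ ++ V₁)) ++ f :: (V₂ ++ W₄) := by
      have : e :: (W₃ ++ y :: W₄) = (V₁ ++ f :: V₂) ++ W₄ := by rw [← h2]; simp
      rw [hsplit, this]; simp
    have h3 := hw.happensBefore (acts V₁) f.ev.act (acts V₂) (by
      rw [hmap]
      have := congrArg acts h2
      simpa [hea, hya] using this)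
    rw [hactsW, hmap, hmap, hrun.link.transGen_hb (hrun.wf WF.initial) hempty] at h3
    -- nodes before and after the removal
    have nodes : ∀ {U g U'}, W = U ++ g :: U' → ¬ g.ev.Removed X →
        (traceOf (acts U)).nodeOf g.ev.act = g.node ∧ g.node ∉ K ∧
        (traceOf (acts (keepLabs π X K U))).nodeOf g.ev.act = newNode K g.node := by
      intro U g U' hU hg
      have hr := hrun
      have hr' := hrun'
      rw [hU] at hr hr'
      rw [keepLabs_append, keepLabs_cons_of_not hg] at hr'
      obtain ⟨u₁, h4, u₂, h5, -⟩ := gRun_append.1 hr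
      obtain ⟨u₁', h4', u₂', h5', -⟩ := gRun_append.1 hr'
      exact ⟨h4.link.nodeOf (h4.wf WF.initial) h5,
        fun hgK => hg ((hK g (by simp [hU])).1 hgK),
        h4'.link.nodeOf (h4'.wf WF.initial) h5'⟩
    obtain ⟨h4, h5, h6⟩ := nodes hsplit her
    obtain ⟨h7, h8, h9⟩ := nodes hsplit' hfr
    rw [hrun'.link.transGen_hb (hrun'.wf WF.initial) hempty']
    rw [hea] at h4 h6
    simp only [keepLabs_append, keepLabs_cons_of_not hxr, acts_append, acts_cons, hrel, hxa]
      at h4 h6 h7 h9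
    have h10 := hsim.transGen_hb (hrun.wf WF.initial) h5 h8 (by
      rw [← h4, ← h7]
      simpa using h3)
    rw [← h6, ← h9] at h10
    simpa [Attack.relabel, hrel] using h10
  · intro z hz
    obtain ⟨c, hc, h1⟩ := hmem hz
    rw [h1]
    exact hw.suffix _ (List.mem_map_of_mem hc)
  · refine ⟨hw.noEarlyRead.1, fun z hz c d hcd => ?_⟩
    obtain ⟨g, hg, h1⟩ := hmem hz
    rw [h1] at hcd
    exact hw.noEarlyRead.2 _ (List.mem_map_of_mem hg) c d hcd

end

section

variable {T L R D : Type*} [Zero D] {P : Program T L R D}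

/-! ### Fence sets -/

/-- For a label outside `G` the fresh label is merged back into the original one, which turns its
fence into a self-loop that can be dropped; labels in `G` keep both copies. -/
theorem removesFences_insertFences (P : Program T L R D) {G U : Finset L} (h : G ⊆ U) :
    RemovesFences (Sum.elim Sum.inl fun l => if l ∈ G then Sum.inr l else Sum.inl l)
      {i | ∃ l ∉ G, i = ⟨Sum.inl l, .mfence, Sum.inr l⟩} (P.insertFences U)
      (P.insertFences G) where
  init _ := rfl
  code t i hi hX := by
    simp only [Program.insertFences, List.mem_append, List.mem_map, Finset.mem_toList,
      Finset.mem_filter] at hi ⊢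
    rcases hi with ⟨j, hj, rfl⟩ | ⟨l, ⟨hl, hlt⟩, rfl⟩
    · refine .inl ⟨j, hj, ?_⟩
      by_cases h1 : j.src ∈ G
      · simp [LInstr.fenced, LInstr.relabel, h1, h h1]
      · by_cases h2 : j.src ∈ U <;> simp [LInstr.fenced, LInstr.relabel, h1, h2]
    · have hG : l ∈ G := by
        by_contra hG; exact hX ⟨l, hG, rfl⟩
      exact .inr ⟨l, ⟨hG, hlt⟩, by simp [LInstr.relabel, hG]⟩
  fence := by
    rintro _ ⟨l, hl, rfl⟩
    simp [hl]

theorem removesFences_program (P : Program T L R D) (U : Finset L) :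
    RemovesFences (Sum.elim id id) {i | ∃ l, i = ⟨Sum.inl l, .mfence, Sum.inr l⟩}
      (P.insertFences U) P where
  init _ := rfl
  code t i hi hX := by
    simp only [Program.insertFences, List.mem_append, List.mem_map, Finset.mem_toList,
      Finset.mem_filter] at hi
    rcases hi with ⟨j, hj, rfl⟩ | ⟨l, -, rfl⟩
    · convert hj
      by_cases h2 : j.src ∈ U <;> simp [LInstr.fenced, LInstr.relabel, h2]
    · exact absurd ⟨l, rfl⟩ hX
  fence := by
    rintro _ ⟨l, rfl⟩
    exact ⟨rfl, rfl⟩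

theorem LInstr.relabel_fenced (i : LInstr L R D) {G U : Finset L} (h : G ⊆ U) :
    (i.fenced U).relabel (Sum.elim Sum.inl fun l => if l ∈ G then Sum.inr l else Sum.inl l) =
      i.fenced G := by
  by_cases h1 : i.src ∈ G
  · simp [LInstr.fenced, LInstr.relabel, h1, h h1]
  · by_cases h2 : i.src ∈ U <;> simp [LInstr.fenced, LInstr.relabel, h1, h2]

theorem LInstr.relabel_fenced_id (i : LInstr L R D) (U : Finset L) :
    (i.fenced U).relabel (Sum.elim id id) = i := by
  by_cases h2 : i.src ∈ U <;> simp [LInstr.fenced, LInstr.relabel, h2]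

/-- Removal of fences preserves feasibility. -/
theorem Feasible.anti {A : Attack T L R D} {G U : Finset L} (h : G ⊆ U)
    (hA : Feasible (P.insertFences U) (A.fenced U)) :
    Feasible (P.insertFences G) (A.fenced G) := by
  have := hA.relabel (removesFences_insertFences P h)
  rwa [show (A.fenced U).relabel _ = A.fenced G by
    simp only [Attack.fenced, Attack.relabel, LInstr.relabel_fenced _ h]] at this

theorem Feasible.of_insertFences {A : Attack T L R D} {U : Finset L}
    (hA : Feasible (P.insertFences U) (A.fenced U)) : Feasible P A := by
  have := hA.relabel (removesFences_program P U)
  rwa [show (A.fenced U).relabel _ = A by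
    simp only [Attack.fenced, Attack.relabel, LInstr.relabel_fenced_id]] at this

theorem exists_fenced_of_mem {U : Finset L} {t : T} {i : LInstr (L ⊕ L) R D}
    (hi : i ∈ (P.insertFences U).code t) (hm : i.inst ≠ .mfence) : ∃ j : LInstr L R D, j.fenced U = i := by
  simp only [Program.insertFences, List.mem_append, List.mem_map] at hi
  rcases hi with ⟨j, -, rfl⟩ | ⟨l, -, rfl⟩
  · exact ⟨j, rfl⟩
  · exact absurd rfl hm

/-- Every attack of the program with fences stems from an attack of the program. -/
theorem Attack.IsAttackOf.exists_fenced {U : Finset L} {A : Attack T (L ⊕ L) R D}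
    (h : A.IsAttackOf (P.insertFences U)) : ∃ B : Attack T L R D, B.fenced U = A := by
  obtain ⟨t, i, j⟩ := A
  obtain ⟨h1, ⟨ea, ev, h2⟩, h3, r, e, h4⟩ := h
  obtain ⟨i, rfl⟩ := exists_fenced_of_mem h1 (by rw [h2]; simp)
  obtain ⟨j, rfl⟩ := exists_fenced_of_mem h3 (by rw [h4]; simp)
  exact ⟨⟨t, i, j⟩, rfl⟩

/-- A fence set that eliminates all feasible attacks is valid. -/
theorem isValidFenceSet_of_eliminating {U : Finset L} (hU : (U : Set L) ⊆ P.labels)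
    (h : ∀ A, Feasible P A → ∃ G ⊆ U, IsEliminatingFenceSet P A G) : IsValidFenceSet P U := by
  refine ⟨hU, ?_⟩
  by_contra hR
  -- The attack found with the fences in `U` comes from a feasible attack of `P`. It would remain
  -- feasible with only its own eliminating set, since that set is contained in `U`.
  obtain ⟨A, hA⟩ := exists_feasible_of_not_robust hR
  obtain ⟨B, rfl⟩ := hA.1.exists_fenced
  obtain ⟨G, hG, -, hBG⟩ := h B hA.of_insertFences
  exact hBG (hA.anti hG)

/-- A valid fence set eliminates all attacks. -/
theorem IsValidFenceSet.isEliminatingFenceSet {F : Finset L} (h : IsValidFenceSet P F)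
    (A : Attack T L R D) : IsEliminatingFenceSet P A F := ⟨h.1, h.2.not_feasible _⟩

theorem IsEliminatingFenceSet.exists_irreducible {A : Attack T L R D} {F : Finset L}
    (h : IsEliminatingFenceSet P A F) : ∃ G ⊆ F, IsIrreducibleEliminatingFenceSet P A G := by
  induction F using Finset.strongInduction with
  | H F ih =>
    by_cases hF : ∃ G, G ⊂ F ∧ IsEliminatingFenceSet P A G
    · obtain ⟨G, hG, hAG⟩ := hF
      obtain ⟨G', hG', h'⟩ := ih G hG hAG
      exact ⟨G', hG'.trans hG.subset, h'⟩
    · exact ⟨F, subset_rfl, h, fun G hG hAG => hF ⟨G, hG, hAG⟩⟩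

end

end FenceTSO

/-! ### The decomposition of an irreducible valid fence set. -/

theorem mainTheorem9 {T L R D : Type*} [Finite T] [Zero D]
    (P : FenceTSO.Program T L R D) (F : Finset L)
    (hF : FenceTSO.IsIrreducibleValidFenceSet P F) :
    ∃ G : {A : FenceTSO.Attack T L R D // FenceTSO.Feasible P A} → Finset L,
      (∀ A, FenceTSO.IsIrreducibleEliminatingFenceSet P A.1 (G A)) ∧
      (F : Set L) = ⋃ A, (G A : Set L) := by
  classical
  choose G hGF hG using fun A : {A : FenceTSO.Attack T L R D // FenceTSO.Feasible P A} =>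
    (hF.1.isEliminatingFenceSet A.1).exists_irreducible
  refine ⟨G, hG, ?_⟩
  -- The union of the chosen sets, cut out of `F` so as to be finite; nothing is lost, as every
  -- chosen set lies in `F`.
  set U : Finset L := F.filter fun l => ∃ A, l ∈ G A with hU
  have hUF : U ⊆ F := Finset.filter_subset _ _
  have hvalid : FenceTSO.IsValidFenceSet P U := by
    refine FenceTSO.isValidFenceSet_of_eliminating
      ((Finset.coe_subset.2 hUF).trans hF.1.1) fun A hA => ⟨G ⟨A, hA⟩, fun l hl => ?_, (hG ⟨A, hA⟩).1⟩
    exact Finset.mem_filter.2 ⟨hGF _ hl, _, hl⟩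
  have hUF' : U = F := by
    -- A proper subset of `F` cannot be valid, by irreducibility.
    by_contra hne
    exact hF.2 U (hUF.ssubset_of_ne hne) hvalid
  ext l
  simp only [Finset.mem_coe, Set.mem_iUnion]
  constructor
  · intro hl
    rw [← hUF'] at hl
    exact (Finset.mem_filter.1 hl).2
  · rintro ⟨A, hl⟩
    exact hGF A hl
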